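/- **Setting.** Let $M$ be a smooth (Hausdorff) manifold of dimension $2n$ with a Fedosov structure: a symplectic form $J_{ab}$ together with a smooth torsion-free connection $\nabla_a$ on the tangent bundle (and hence on all tensor bundles) such that $\nabla_aJ_{bc}=0$. Let $J^{ab}$ be the inverse of $J_{ab}$, normalised by $J_{ab}J^{ac}=\delta_b{}^c$. The curvature $R_{ab}{}^c{}_d$ of $\nabla_a$ is given by $(\nabla_a\nabla_b-\nabla_b\nabla_a)X^c=R_{ab}{}^c{}_dX^d$. Put $\Phi_{bd}=\frac1{2(n+1)}R_{ab}{}^a{}_d$ and define $V_{ab}{}^c{}_d$ by $$R_{ab}{}^c{}_d=V_{ab}{}^c{}_d+\delta_a{}^c\Phi_{bd}-\delta_b{}^c\Phi_{ad}+J_{ad}\Phi_{be}J^{ce}-J_{bd}\Phi_{ae}J^{ce}+2J_{ab}\Phi_{de}J^{ce}.$$ Put $$S_a=\tfrac1{2n+1}J^{bc}\nabla_c\Phi_{ab},\qquad Y_{abd}=\tfrac1{2n+1}\nabla_cV_{ab}{}^c{}_d.$$ The standard tractor bundle is $\mathcal T=\Lambda^0\oplus\Lambda^1\oplus\Lambda^0$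 (of rank $2n+2$), with the tractor connection $$\nabla_a\begin{bmatrix}\sigma\\ \mu_b\\ \rho\end{bmatrix}=\begin{bmatrix}\nabla_a\sigma-\mu_a\\ \nabla_a\mu_b+J_{ab}\rho+\Phi_{ab}\sigma\\ \nabla_a\rho-\Phi_{ab}J^{bc}\mu_c+S_a\sigma\end{bmatrix}.$$ **Proposition.** The skew form on $\mathcal T$ $$\left\langle\begin{bmatrix}\sigma\\ \mu_b\\ \rho\end{bmatrix},\begin{bmatrix}\tilde\sigma\\ \tilde\mu_c\\ \tilde\rho\end{bmatrix}\right\rangle=\sigma\tilde\rho+J^{bc}\mu_b\tilde\mu_c-\rho\tilde\sigma$$ is non-degenerate and is preserved by the tractor connection: $\nabla_a\langle s,t\rangle=\langle\nabla_as,t\rangle+\langle s,\nabla_at\rangle$ for all smooth sections $s,t$ of $\mathcal T$. For every smooth section of $\mathcal T$, the curvature of the tractor connection is given by $$(\nabla_a\nabla_b-\nabla_b\nabla_a)\begin{bmatrix}\sigma\\ \mu_d\\ \rho\end{bmatrix}=\begin{bmatrix}0\\ -V_{ab}{}^c{}_d\mu_c+Y_{abd}\sigma\\ -Y_{abc}J^{cd}\mu_d+\frac1{2n}\big(J^{cd}V_{ab}{}^e{}_c\Phi_{de}-J^{cd}\nabla_cY_{abd}\big)\sigma\end{bmatrix}+2J_{ab}\begin{bmatrix}\rho\\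 J^{ce}\Phi_{cd}\mu_e-S_d\sigma\\ S_cJ^{cd}\mu_d+\frac1{2n}J^{cd}\big(\nabla_cS_d-J^{ef}\Phi_{ce}\Phi_{df}\big)\sigma\end{bmatrix}.$$ (On the left, the two derivatives are formed with the tractor connection coupled to $\nabla_a$. If $n=0$, the terms with $\frac1{2n}$ are read as $0$.) -/

import Mathlib

open Bundle
open scoped Manifold ContDiff Topology

set_option linter.unusedSectionVars false

/-! ### The bundle of homomorphisms between two vector bundles -/

noncomputable section

/-- The normed space `F →L[ℝ] F'`, sealed in a definition (see `HomBundle`). -/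
def HomFiber (F F' : Type*) [NormedAddCommGroup F] [NormedSpace ℝ F] [NormedAddCommGroup F']
    [NormedSpace ℝ F'] : Type _ := F →L[ℝ] F'

section HomFiber

variable (F F' : Type*) [NormedAddCommGroup F] [NormedSpace ℝ F] [NormedAddCommGroup F']
    [NormedSpace ℝ F']

instance : NormedAddCommGroup (HomFiber F F') := inferInstanceAs (NormedAddCommGroup (F →L[ℝ] F'))

instance : NormedSpace ℝ (HomFiber F F') := inferInstanceAs (NormedSpace ℝ (F →L[ℝ] F'))

instance [FiniteDimensional ℝ F] [FiniteDimensional ℝ F'] : FiniteDimensional ℝ (HomFiber F F') :=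
  inferInstanceAs (FiniteDimensional ℝ (F →L[ℝ] F'))

end HomFiber

section HomBundle

variable {B : Type*} {V V' : B → Type*}
  [∀ x, AddCommGroup (V x)] [∀ x, Module ℝ (V x)] [∀ x, TopologicalSpace (V x)]
  [∀ x, AddCommGroup (V' x)] [∀ x, Module ℝ (V' x)] [∀ x, TopologicalSpace (V' x)]

variable (V V') in
/-- The family of spaces `Hom(V_x, V'_x)`.  This is Mathlib's bundle `fun x ↦ V x →L[ℝ] V' x`,
sealed in a definition so that iterated bundles of homomorphisms (tensor bundles) have a
well-behaved instance search. -/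
def HomBundle (x : B) : Type _ := V x →L[ℝ] V' x

namespace HomBundle

instance (x : B) : FunLike (HomBundle V V' x) (V x) (V' x) :=
  inferInstanceAs (FunLike (V x →L[ℝ] V' x) (V x) (V' x))

instance (x : B) : ContinuousLinearMapClass (HomBundle V V' x) ℝ (V x) (V' x) :=
  inferInstanceAs (ContinuousLinearMapClass (V x →L[ℝ] V' x) ℝ (V x) (V' x))

@[ext] theorem ext {x : B} {A A' : HomBundle V V' x} (h : ∀ v, A v = A' v) : A = A' :=
  ContinuousLinearMap.ext h

variable [∀ x, IsTopologicalAddGroup (V' x)] [∀ x, ContinuousSMul ℝ (V' x)]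

instance (x : B) : TopologicalSpace (HomBundle V V' x) :=
  inferInstanceAs (TopologicalSpace (V x →L[ℝ] V' x))

instance (x : B) : AddCommGroup (HomBundle V V' x) :=
  inferInstanceAs (AddCommGroup (V x →L[ℝ] V' x))

instance (x : B) : Module ℝ (HomBundle V V' x) :=
  inferInstanceAs (Module ℝ (V x →L[ℝ] V' x))

instance (x : B) : IsTopologicalAddGroup (HomBundle V V' x) :=
  inferInstanceAs (IsTopologicalAddGroup (V x →L[ℝ] V' x))

instance (x : B) : ContinuousSMul ℝ (HomBundle V V' x) :=
  inferInstanceAs (ContinuousSMul ℝ (V x →L[ℝ] V' x))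

@[simp] theorem add_apply {x : B} (A A' : HomBundle V V' x) (v : V x) :
    (A + A') v = A v + A' v := rfl

@[simp] theorem sub_apply {x : B} (A A' : HomBundle V V' x) (v : V x) :
    (A - A') v = A v - A' v := rfl

@[simp] theorem neg_apply {x : B} (A : HomBundle V V' x) (v : V x) : (-A) v = -A v := rfl

@[simp] theorem smul_apply {x : B} (c : ℝ) (A : HomBundle V V' x) (v : V x) :
    (c • A) v = c • A v := rfl

@[simp] theorem zero_apply {x : B} (v : V x) : (0 : HomBundle V V' x) v = 0 := rfl

instance (x : B) [FiniteDimensional ℝ (V x)] [FiniteDimensional ℝ (V' x)]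
    [IsTopologicalAddGroup (V x)] [ContinuousSMul ℝ (V x)] [T2Space (V x)] :
    FiniteDimensional ℝ (HomBundle V V' x) :=
  inferInstanceAs (FiniteDimensional ℝ (V x →L[ℝ] V' x))

instance (x : B) [ContinuousSMul ℝ (V x)] [T2Space (V' x)] : T2Space (HomBundle V V' x) :=
  inferInstanceAs (T2Space (V x →L[ℝ] V' x))

/-- The linear map underlying an element of `Hom(V_x, V'_x)`. -/
def toLinear {x : B} (A : HomBundle V V' x) : V x →ₗ[ℝ] V' x :=
  ContinuousLinearMap.toLinearMap (show V x →L[ℝ] V' x from A)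

@[simp] theorem toLinear_apply {x : B} (A : HomBundle V V' x) (v : V x) : A.toLinear v = A v := rfl

/-- On finite-dimensional fibres, an element of `Hom(V_x, V'_x)` is just a linear map. -/
def ofLinear {x : B} [IsTopologicalAddGroup (V x)] [ContinuousSMul ℝ (V x)]
    [FiniteDimensional ℝ (V x)] [T2Space (V x)] (f : V x →ₗ[ℝ] V' x) : HomBundle V V' x :=
  LinearMap.toContinuousLinearMap f

@[simp] theorem ofLinear_apply {x : B} [IsTopologicalAddGroup (V x)] [ContinuousSMul ℝ (V x)]
    [FiniteDimensional ℝ (V x)] [T2Space (V x)] (f : V x →ₗ[ℝ] V' x) (v : V x) :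
    ofLinear f v = f v := rfl

variable [TopologicalSpace B]
  {F : Type*} [NormedAddCommGroup F] [NormedSpace ℝ F] [TopologicalSpace (TotalSpace F V)]
  [FiberBundle F V] [VectorBundle ℝ F V]
  {F' : Type*} [NormedAddCommGroup F'] [NormedSpace ℝ F'] [TopologicalSpace (TotalSpace F' V')]
  [FiberBundle F' V'] [VectorBundle ℝ F' V']

instance : TopologicalSpace (TotalSpace (HomFiber F F') (HomBundle V V')) :=
  inferInstanceAs (TopologicalSpace (TotalSpace (F →L[ℝ] F') (fun x ↦ V x →L[ℝ] V' x)))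

instance : FiberBundle (HomFiber F F') (HomBundle V V') :=
  inferInstanceAs (FiberBundle (F →L[ℝ] F') (fun x ↦ V x →L[ℝ] V' x))

instance : VectorBundle ℝ (HomFiber F F') (HomBundle V V') :=
  inferInstanceAs (VectorBundle ℝ (F →L[ℝ] F') (fun x ↦ V x →L[ℝ] V' x))

instance {EB : Type*} [NormedAddCommGroup EB] [NormedSpace ℝ EB] {HB : Type*} [TopologicalSpace HB]
    {IB : ModelWithCorners ℝ EB HB} [ChartedSpace HB B] {n : WithTop ℕ∞}
    [ContMDiffVectorBundle n F V IB] [ContMDiffVectorBundle n F' V' IB] :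
    ContMDiffVectorBundle n (HomFiber F F') (HomBundle V V') IB :=
  inferInstanceAs (ContMDiffVectorBundle n (F →L[ℝ] F') (fun x ↦ V x →L[ℝ] V' x) IB)

end HomBundle
end HomBundle

/-! ### Sections -/

section Sections

variable {E : Type*} [NormedAddCommGroup E] [NormedSpace ℝ E]
  {H : Type*} [TopologicalSpace H] (I : ModelWithCorners ℝ E H)
  {M : Type*} [TopologicalSpace M] [ChartedSpace H M]
  (F : Type*) [NormedAddCommGroup F] [NormedSpace ℝ F]
  {V : M → Type*} [TopologicalSpace (TotalSpace F V)]
  [∀ x, TopologicalSpace (V x)] [FiberBundle F V]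

/-- The section `s` of the vector bundle `V` with model fibre `F` is differentiable at `x`. -/
abbrev DiffSectionAt (s : Π x, V x) (x : M) : Prop :=
  MDifferentiableAt I (I.prod 𝓘(ℝ, F)) (fun y ↦ TotalSpace.mk' F y (s y)) x

/-- The section `s` of the vector bundle `V` with model fibre `F` is smooth. -/
abbrev SmoothSection (s : Π x, V x) : Prop :=
  ContMDiff I (I.prod 𝓘(ℝ, F)) ∞ (fun y ↦ TotalSpace.mk' F y (s y))

end Sections

/-! ### Trivial connection, direct sums and homomorphisms -/

namespace CovariantDerivative
section Generic
variable {E : Type*} [NormedAddCommGroup E] [NormedSpace ℝ E]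
  {H : Type*} [TopologicalSpace H] {I : ModelWithCorners ℝ E H}
  {M : Type*} [TopologicalSpace M] [ChartedSpace H M]
  {F : Type*} [NormedAddCommGroup F] [NormedSpace ℝ F]
  {V : M → Type*} [TopologicalSpace (TotalSpace F V)]
  [∀ x, AddCommGroup (V x)] [∀ x, Module ℝ (V x)] [∀ x, TopologicalSpace (V x)]
  [∀ x, IsTopologicalAddGroup (V x)] [∀ x, ContinuousSMul ℝ (V x)]
  [FiberBundle F V] [VectorBundle ℝ F V]
  {F' : Type*} [NormedAddCommGroup F'] [NormedSpace ℝ F']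
  {V' : M → Type*} [TopologicalSpace (TotalSpace F' V')]
  [∀ x, AddCommGroup (V' x)] [∀ x, Module ℝ (V' x)] [∀ x, TopologicalSpace (V' x)]
  [∀ x, IsTopologicalAddGroup (V' x)] [∀ x, ContinuousSMul ℝ (V' x)]
  [FiberBundle F' V'] [VectorBundle ℝ F' V']

variable (I M) in
/-- The connection on the trivial line bundle given by the differential of functions. -/
def trivialLine : CovariantDerivative I ℝ (Bundle.Trivial M ℝ) where
  toFun f x := mvfderiv I (fun y : M ↦ (f y : ℝ)) x
  isCovariantDerivativeOnUniv := {
    add := by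
      intro f g x hf hg _
      rw [mdifferentiableAt_section] at hf hg
      exact mvfderiv_fun_add hf hg
    leibniz := by
      intro f g x hf hg _
      rw [mdifferentiableAt_section] at hf
      exact mvfderiv_fun_smul hg hf }

theorem diffSectionAt_prod_iff (s : Π x, (V ×ᵇ V') x) (x : M) :
    DiffSectionAt I (F × F') s x ↔
      DiffSectionAt I F (fun y ↦ (s y).1) x ∧ DiffSectionAt I F' (fun y ↦ (s y).2) x := by
  unfold DiffSectionAt
  rw [mdifferentiableAt_section, mdifferentiableAt_section, mdifferentiableAt_section]
  exact mdifferentiableAt_prod_module_iff _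

/-- The direct sum of two connections. -/
def directSum (D : CovariantDerivative I F V) (D' : CovariantDerivative I F' V') :
    CovariantDerivative I (F × F') (V ×ᵇ V') where
  toFun s x := (D (fun y ↦ (s y).1) x).prod (D' (fun y ↦ (s y).2) x)
  isCovariantDerivativeOnUniv := {
    add := by
      intro s t x hs ht _
      replace hs := (diffSectionAt_prod_iff s x).1 hs
      replace ht := (diffSectionAt_prod_iff t x).1 ht
      have h1 := D.isCovariantDerivativeOnUniv.add hs.1 ht.1
      have h2 := D'.isCovariantDerivativeOnUniv.add hs.2 ht.2
      ext u
      · exact congr($h1 u)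
      · exact congr($h2 u)
    leibniz := by
      intro s g x hs hg _
      replace hs := (diffSectionAt_prod_iff s x).1 hs
      have h1 := D.isCovariantDerivativeOnUniv.leibniz hs.1 hg
      have h2 := D'.isCovariantDerivativeOnUniv.leibniz hs.2 hg
      ext u
      · exact congr($h1 u)
      · exact congr($h2 u) }

theorem diffSectionAt_homBundle_apply {A : Π x, HomBundle V V' x} {σ : Π x, V x} {x : M}
    (hA : DiffSectionAt I (HomFiber F F') A x) (hσ : DiffSectionAt I F σ x) :
    DiffSectionAt I F' (fun y ↦ A y (σ y)) x :=
  MDifferentiableAt.clm_bundle_apply hA hσ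

variable [FiniteDimensional ℝ F] [ContMDiffVectorBundle 1 F V I]

theorem tensorialAt_hom (D : CovariantDerivative I F V) (D' : CovariantDerivative I F' V')
    {A : Π x, HomBundle V V' x} {x : M} (hA : DiffSectionAt I (HomFiber F F') A x)
    (u : TangentSpace I x) :
    TensorialAt I F (fun σ : Π x, V x ↦ D' (fun y ↦ A y (σ y)) x u - A x (D σ x u)) x where
  smul := by
    intro f σ hf hσ
    have h1 := D'.isCovariantDerivativeOnUniv.leibniz (diffSectionAt_homBundle_apply hA hσ) hf
    have h2 := D.isCovariantDerivativeOnUniv.leibniz hσ hf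
    have h3 : (fun y ↦ A y ((f • σ) y)) = f • (fun y ↦ A y (σ y)) := by
      funext y; simp
    simp only [h3]
    erw [h1, h2]
    simp
    module
  add := by
    intro σ τ hσ hτ
    have h1 := D'.isCovariantDerivativeOnUniv.add (diffSectionAt_homBundle_apply hA hσ)
      (diffSectionAt_homBundle_apply hA hτ)
    have h2 := D.isCovariantDerivativeOnUniv.add hσ hτ
    have h3 : (fun y ↦ A y ((σ + τ) y)) = (fun y ↦ A y (σ y)) + (fun y ↦ A y (τ y)) := by
      funext y; simp
    simp only [h3]
    erw [h1, h2]
    simp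
    module

instance [FiniteDimensional ℝ E] (x : M) : FiniteDimensional ℝ (TangentSpace I x) :=
  inferInstanceAs (FiniteDimensional ℝ E)

instance (x : M) : T2Space (TangentSpace I x) := inferInstanceAs (T2Space E)

/-- The homomorphism `∇_u A`, for a section `A` of `Hom(V, V')` which is differentiable at `x`. -/
def homAux (D : CovariantDerivative I F V) (D' : CovariantDerivative I F' V')
    {A : Π x, HomBundle V V' x} {x : M} (hA : DiffSectionAt I (HomFiber F F') A x)
    (u : TangentSpace I x) : HomBundle V V' x :=
  TensorialAt.mkHom _ x (tensorialAt_hom D D' hA u)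

theorem homAux_apply (D : CovariantDerivative I F V) (D' : CovariantDerivative I F' V')
    {A : Π x, HomBundle V V' x} {x : M} (hA : DiffSectionAt I (HomFiber F F') A x)
    (u : TangentSpace I x) {σ : Π x, V x} (hσ : DiffSectionAt I F σ x) :
    homAux D D' hA u (σ x) = D' (fun y ↦ A y (σ y)) x u - A x (D σ x u) :=
  TensorialAt.mkHom_apply (tensorialAt_hom D D' hA u) hσ

theorem homAux_apply_extend (D : CovariantDerivative I F V) (D' : CovariantDerivative I F' V')
    {A : Π x, HomBundle V V' x} {x : M} (hA : DiffSectionAt I (HomFiber F F') A x)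
    (u : TangentSpace I x) (v : V x) :
    homAux D D' hA u v = D' (fun y ↦ A y (FiberBundle.extend F v y)) x u
      - A x (D (FiberBundle.extend F v) x u) := rfl

open Classical in
/-- The connection on `Hom(V, V')` induced by connections on `V` and `V'`:
`(∇_u A) (σ) = ∇_u (A σ) - A (∇_u σ)` for every section `σ` of `V`; see `hom_apply`.
(The value at a section `A` which is not differentiable at the point is a junk value.) -/
def hom [FiniteDimensional ℝ E] (D : CovariantDerivative I F V) (D' : CovariantDerivative I F' V') :
    CovariantDerivative I (HomFiber F F') (HomBundle V V') where
  toFun A x := if hA : DiffSectionAt I (HomFiber F F') A x then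
      LinearMap.toContinuousLinearMap
        { toFun u := homAux D D' hA u
          map_add' u u' := by
            ext v
            simp only [HomBundle.add_apply, homAux_apply_extend, map_add]
            module
          map_smul' c u := by
            ext v
            simp only [HomBundle.smul_apply, homAux_apply_extend, map_smul, RingHom.id_apply]
            module }
    else 0
  isCovariantDerivativeOnUniv := {
    add := by
      intro A A' x hA hA' _
      have hs : DiffSectionAt I (HomFiber F F') (A + A') x := mdifferentiableAt_add_section hA hA'
      rw [dif_pos hA, dif_pos hA', dif_pos hs]
      ext u v
      have hv : DiffSectionAt I F (FiberBundle.extend F v) x :=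
        FiberBundle.mdifferentiableAt_extend ..
      have h1 := D'.isCovariantDerivativeOnUniv.add (diffSectionAt_homBundle_apply hA hv)
        (diffSectionAt_homBundle_apply hA' hv)
      replace h1 := congr($h1 u)
      change homAux D D' hs u v = homAux D D' hA u v + homAux D D' hA' u v
      simp only [homAux_apply_extend]
      erw [h1]
      change _ - (A x _ + A' x _) = _
      simp
      module
    leibniz := by
      intro A g x hA hg _
      have hs : DiffSectionAt I (HomFiber F F') (g • A) x := MDifferentiableAt.smul_section hg hA
      rw [dif_pos hA, dif_pos hs]
      ext u v
      have hv : DiffSectionAt I F (FiberBundle.extend F v) x :=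
        FiberBundle.mdifferentiableAt_extend ..
      have h1 := D'.isCovariantDerivativeOnUniv.leibniz (diffSectionAt_homBundle_apply hA hv) hg
      replace h1 := congr($h1 u)
      change homAux D D' hs u v = g x • homAux D D' hA u v + (mvfderiv I g x u) • A x v
      simp only [homAux_apply_extend]
      erw [h1]
      change _ - g x • A x _ = _
      simp
      module }

theorem hom_apply [FiniteDimensional ℝ E] (D : CovariantDerivative I F V)
    (D' : CovariantDerivative I F' V') {A : Π x, HomBundle V V' x} {σ : Π x, V x} {x : M}
    (hA : DiffSectionAt I (HomFiber F F') A x) (hσ : DiffSectionAt I F σ x)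
    (u : TangentSpace I x) :
    (hom D D' A x u : HomBundle V V' x) (σ x) = D' (fun y ↦ A y (σ y)) x u - A x (D σ x u) := by
  have h : hom D D' A x u = homAux D D' hA u := by
    exact congrArg (fun L : TangentSpace I x →L[ℝ] HomBundle V V' x ↦ L u) (dif_pos hA)
  rw [h, homAux_apply D D' hA u hσ]

end Generic
end CovariantDerivative

/-! ### Fedosov structures -/

section Fedosov

variable (E : Type*) [NormedAddCommGroup E] [NormedSpace ℝ E]
  (M : Type*) [TopologicalSpace M] [ChartedSpace E M]

/-- The tangent bundle of `M`. -/
abbrev Tan : M → Type _ := TangentSpace 𝓘(ℝ, E)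

/-- The trivial real line bundle on `M`. -/
abbrev Line : M → Type := Bundle.Trivial M ℝ

/-- The cotangent bundle of `M`. -/
abbrev Cotan : M → Type _ := HomBundle (Tan E M) (Line M)

/-- A symplectic form on a manifold: a smooth closed nondegenerate `2`-form.
Closedness is expressed by the invariant formula for the exterior derivative. -/
structure SymplecticForm [IsManifold 𝓘(ℝ, E) ∞ M] where
  form : Π x, HomBundle (Tan E M) (Cotan E M) x
  smooth : SmoothSection 𝓘(ℝ, E) (HomFiber E (HomFiber E ℝ)) form
  skew : ∀ x (u v : Tan E M x), form x u v = -form x v u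
  nondegenerate : ∀ x (u : Tan E M x), (∀ v, form x u v = 0) → u = 0
  closed : ∀ X Y Z : Π x, Tan E M x, SmoothSection 𝓘(ℝ, E) E X → SmoothSection 𝓘(ℝ, E) E Y →
    SmoothSection 𝓘(ℝ, E) E Z → ∀ x,
      mvfderiv 𝓘(ℝ, E) (fun y ↦ form y (Y y) (Z y) : M → ℝ) x (X x)
        + mvfderiv 𝓘(ℝ, E) (fun y ↦ form y (Z y) (X y) : M → ℝ) x (Y x)
        + mvfderiv 𝓘(ℝ, E) (fun y ↦ form y (X y) (Y y) : M → ℝ) x (Z x)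
        - form x (VectorField.mlieBracket 𝓘(ℝ, E) X Y x) (Z x)
        - form x (VectorField.mlieBracket 𝓘(ℝ, E) Y Z x) (X x)
        - form x (VectorField.mlieBracket 𝓘(ℝ, E) Z X x) (Y x) = 0

/-- A Fedosov structure on a manifold of dimension `2n`: a symplectic form `J` together with a
smooth torsion-free connection `∇` on the tangent bundle such that `∇ J = 0`. -/
structure FedosovStructure [FiniteDimensional ℝ E] [IsManifold 𝓘(ℝ, E) ∞ M] (n : ℕ)
    extends SymplecticForm E M where
  finrank_eq : Module.finrank ℝ E = 2 * n
  conn : CovariantDerivative 𝓘(ℝ, E) E (Tan E M)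
  conn_smooth : CovariantDerivative.ContMDiffCovariantDerivative conn ∞
  torsion_eq_zero : conn.torsion = 0
  parallel : conn.hom (conn.hom (CovariantDerivative.trivialLine 𝓘(ℝ, E) M)) form = 0

end Fedosov


namespace FedosovStructure

variable {E : Type*} [NormedAddCommGroup E] [NormedSpace ℝ E] [FiniteDimensional ℝ E]
  {M : Type*} [TopologicalSpace M] [ChartedSpace E M] [IsManifold 𝓘(ℝ, E) ∞ M] {n : ℕ}

section SecondDerivative

variable {F : Type*} [NormedAddCommGroup F] [NormedSpace ℝ F]
  {V : M → Type*} [TopologicalSpace (TotalSpace F V)]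
  [∀ x, AddCommGroup (V x)] [∀ x, Module ℝ (V x)] [∀ x, TopologicalSpace (V x)]
  [∀ x, IsTopologicalAddGroup (V x)] [∀ x, ContinuousSMul ℝ (V x)]
  [FiberBundle F V] [VectorBundle ℝ F V]

/-- The section `D σ` of `T^*M ⊗ V = Hom(TM, V)`. -/
def derivSection (D : CovariantDerivative 𝓘(ℝ, E) F V) (σ : Π x, V x) (x : M) :
    HomBundle (Tan E M) V x := D σ x

/-- The second covariant derivative `u^a v^b ∇_a ∇_b σ` at `x` of a section `σ` of a bundle with
connection `D`: the derivative along `u` of the section `D σ` of `T^*M ⊗ V = Hom(TM, V)`, for the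
connection induced by `∇` and `D`, evaluated on `v`. -/
def secondDeriv (𝓕 : FedosovStructure E M n) (D : CovariantDerivative 𝓘(ℝ, E) F V)
    (σ : Π x, V x) (x : M) (u v : Tan E M x) : V x :=
  (𝓕.conn.hom D (derivSection D σ) x u : HomBundle (Tan E M) V x) v

/-- `u^a v^b (∇_a ∇_b - ∇_b ∇_a) σ` at `x`. -/
def curv (𝓕 : FedosovStructure E M n) (D : CovariantDerivative 𝓘(ℝ, E) F V)
    (σ : Π x, V x) (x : M) (u v : Tan E M x) : V x :=
  𝓕.secondDeriv D σ x u v - 𝓕.secondDeriv D σ x v u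

end SecondDerivative

section Curvature

variable [T2Space M] (𝓕 : FedosovStructure E M n)

theorem diffSectionAt_conn {X : Π x, Tan E M x} {x : M} {s : Set M} (hs : s ∈ 𝓝 x)
    (hX : ContMDiffOn 𝓘(ℝ, E) (𝓘(ℝ, E).prod 𝓘(ℝ, E)) ∞ (fun y ↦ TotalSpace.mk' E y (X y)) s) :
    DiffSectionAt 𝓘(ℝ, E) (HomFiber E E)
      (derivSection 𝓕.conn X) x := by
  obtain ⟨f, hf, -⟩ := ((SmoothBumpFunction.nhds_basis_support (I := 𝓘(ℝ, E))
    (interior_mem_nhds.2 hs)).mem_iff).1 (Filter.univ_mem (f := 𝓝 x))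
  have h1 : ContMDiff 𝓘(ℝ, E) (𝓘(ℝ, E).prod 𝓘(ℝ, E)) ∞
      (fun y ↦ TotalSpace.mk' E y (((f : M → ℝ) • X) y)) :=
    ContMDiffOn.smul_section_of_tsupport f.contMDiff.contMDiffOn isOpen_interior hf
      (hX.mono interior_subset)
  have h2 := (𝓕.conn_smooth.contMDiff.contMDiff (σ := (f : M → ℝ) • X)
    (by simpa using h1.contMDiffOn)) x (Set.mem_univ _)
  have h3 : DiffSectionAt 𝓘(ℝ, E) (HomFiber E E)
      (derivSection 𝓕.conn ((f : M → ℝ) • X)) x :=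
    (contMDiffWithinAt_univ.1 h2).mdifferentiableAt (by simp)
  refine h3.congr_of_eventuallyEq ?_
  filter_upwards [f.eventuallyEq_one.eventually_nhds, eventually_mem_nhds_iff.2 hs] with y hy hys
  refine congrArg (TotalSpace.mk' (HomFiber E E) y) ?_
  have hXy : DiffSectionAt 𝓘(ℝ, E) E X y :=
    ((hX y (mem_of_mem_nhds hys)).contMDiffAt hys).mdifferentiableAt (by simp)
  refine 𝓕.conn.isCovariantDerivativeOnUniv.congr_of_eventuallyEq hXy
    ((h1 y).mdifferentiableAt (by simp)) Filter.univ_mem ?_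
  filter_upwards [hy] with z hz
  simp [hz]

theorem extend_add {x y : M} (hy : y ∈ (trivializationAt E (Tan E M) x).baseSet)
    (w w' : Tan E M x) :
    (FiberBundle.extend E (w + w') : Π y, Tan E M y) y =
      FiberBundle.extend E w y + FiberBundle.extend E w' y := by
  have h := Trivialization.linear ℝ (trivializationAt E (Tan E M) x)
    (FiberBundle.mem_baseSet_trivializationAt' x)
  change (trivializationAt E (Tan E M) x).symm y _ =
    (trivializationAt E (Tan E M) x).symm y _ + (trivializationAt E (Tan E M) x).symm y _
  rw [h.map_add, ← Trivialization.coe_symmₗ (R := ℝ) _ hy]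
  exact map_add _ _ _

theorem extend_smul {x y : M} (hy : y ∈ (trivializationAt E (Tan E M) x).baseSet)
    (c : ℝ) (w : Tan E M x) :
    (FiberBundle.extend E (c • w) : Π y, Tan E M y) y = c • FiberBundle.extend E w y := by
  have h := Trivialization.linear ℝ (trivializationAt E (Tan E M) x)
    (FiberBundle.mem_baseSet_trivializationAt' x)
  change (trivializationAt E (Tan E M) x).symm y _ =
    c • (trivializationAt E (Tan E M) x).symm y _
  rw [h.map_smul, ← Trivialization.coe_symmₗ (R := ℝ) _ hy]
  exact map_smul _ _ _

theorem eventually_mem_baseSet (x : M) :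
    ∀ᶠ y in 𝓝 x, ∀ᶠ z in 𝓝 y, z ∈ (trivializationAt E (Tan E M) x).baseSet :=
  eventually_mem_nhds_iff.2 ((trivializationAt E (Tan E M) x).open_baseSet.mem_nhds
    (FiberBundle.mem_baseSet_trivializationAt' x))

theorem contMDiffOn_extend {x : M} (w : Tan E M x) : ∃ s ∈ 𝓝 x,
    ContMDiffOn 𝓘(ℝ, E) (𝓘(ℝ, E).prod 𝓘(ℝ, E)) ∞
      (fun y ↦ TotalSpace.mk' E y ((FiberBundle.extend E w : Π y, Tan E M y) y)) s :=
  FiberBundle.exists_contMDiffOn_extend 𝓘(ℝ, E) E w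

theorem secondDeriv_extend_add {x : M} (u v w w' : Tan E M x) :
    𝓕.secondDeriv 𝓕.conn (FiberBundle.extend E (w + w')) x u v =
      𝓕.secondDeriv 𝓕.conn (FiberBundle.extend E w) x u v +
        𝓕.secondDeriv 𝓕.conn (FiberBundle.extend E w') x u v := by
  obtain ⟨s, hs, h⟩ := contMDiffOn_extend w
  obtain ⟨s', hs', h'⟩ := contMDiffOn_extend w'
  obtain ⟨s'', hs'', h''⟩ := contMDiffOn_extend (w + w')
  have d := 𝓕.diffSectionAt_conn hs h
  have d' := 𝓕.diffSectionAt_conn hs' h'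
  have d'' := 𝓕.diffSectionAt_conn hs'' h''
  have key : (𝓕.conn.hom 𝓕.conn) (derivSection 𝓕.conn (FiberBundle.extend E (w + w'))) x =
      (𝓕.conn.hom 𝓕.conn) (derivSection 𝓕.conn (FiberBundle.extend E w)
        + derivSection 𝓕.conn (FiberBundle.extend E w')) x := by
    refine (𝓕.conn.hom 𝓕.conn).isCovariantDerivativeOnUniv.congr_of_eventuallyEq d''
      (mdifferentiableAt_add_section d d') Filter.univ_mem ?_
    filter_upwards [eventually_mem_nhds_iff.2 hs, eventually_mem_nhds_iff.2 hs',
      eventually_mem_nhds_iff.2 hs'', eventually_mem_baseSet (E := E) x] with y hy hy' hy'' hb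
    have e1 : DiffSectionAt 𝓘(ℝ, E) E (FiberBundle.extend E w : Π y, Tan E M y) y :=
      ((h y (mem_of_mem_nhds hy)).contMDiffAt hy).mdifferentiableAt (by simp)
    have e2 : DiffSectionAt 𝓘(ℝ, E) E (FiberBundle.extend E w' : Π y, Tan E M y) y :=
      ((h' y (mem_of_mem_nhds hy')).contMDiffAt hy').mdifferentiableAt (by simp)
    have e3 := 𝓕.conn.isCovariantDerivativeOnUniv.add e1 e2
    have e4 : DiffSectionAt 𝓘(ℝ, E) E (FiberBundle.extend E (w + w') : Π y, Tan E M y) y :=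
      ((h'' y (mem_of_mem_nhds hy'')).contMDiffAt hy'').mdifferentiableAt (by simp)
    refine Eq.trans ?_ e3
    refine 𝓕.conn.isCovariantDerivativeOnUniv.congr_of_eventuallyEq e4
      (mdifferentiableAt_add_section e1 e2) Filter.univ_mem ?_
    filter_upwards [hb] with z hz
    exact extend_add hz w w'
  have e4 := (𝓕.conn.hom 𝓕.conn).isCovariantDerivativeOnUniv.add d d'
  unfold secondDeriv
  rw [key]
  exact congr(($e4 u : HomBundle (Tan E M) (Tan E M) x) v)

theorem secondDeriv_extend_smul {x : M} (u v w : Tan E M x) (c : ℝ) :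
    𝓕.secondDeriv 𝓕.conn (FiberBundle.extend E (c • w)) x u v =
      c • 𝓕.secondDeriv 𝓕.conn (FiberBundle.extend E w) x u v := by
  obtain ⟨s, hs, h⟩ := contMDiffOn_extend w
  obtain ⟨s'', hs'', h''⟩ := contMDiffOn_extend (c • w)
  have d := 𝓕.diffSectionAt_conn hs h
  have d'' := 𝓕.diffSectionAt_conn hs'' h''
  have key : (𝓕.conn.hom 𝓕.conn) (derivSection 𝓕.conn (FiberBundle.extend E (c • w))) x =
      (𝓕.conn.hom 𝓕.conn) (c • derivSection 𝓕.conn (FiberBundle.extend E w)) x := by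
    refine (𝓕.conn.hom 𝓕.conn).isCovariantDerivativeOnUniv.congr_of_eventuallyEq d''
      (mdifferentiableAt_const.smul_section d) Filter.univ_mem ?_
    filter_upwards [eventually_mem_nhds_iff.2 hs, eventually_mem_nhds_iff.2 hs'',
      eventually_mem_baseSet (E := E) x] with y hy hy'' hb
    have e1 : DiffSectionAt 𝓘(ℝ, E) E (FiberBundle.extend E w : Π y, Tan E M y) y :=
      ((h y (mem_of_mem_nhds hy)).contMDiffAt hy).mdifferentiableAt (by simp)
    have e3 := 𝓕.conn.isCovariantDerivativeOnUniv.smul_const c e1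
    have e4 : DiffSectionAt 𝓘(ℝ, E) E (FiberBundle.extend E (c • w) : Π y, Tan E M y) y :=
      ((h'' y (mem_of_mem_nhds hy'')).contMDiffAt hy'').mdifferentiableAt (by simp)
    refine Eq.trans ?_ e3
    refine 𝓕.conn.isCovariantDerivativeOnUniv.congr_of_eventuallyEq e4
      (mdifferentiableAt_const.smul_section e1) Filter.univ_mem ?_
    filter_upwards [hb] with z hz
    exact extend_smul hz c w
  have e4 := (𝓕.conn.hom 𝓕.conn).isCovariantDerivativeOnUniv.smul_const c d
  unfold secondDeriv
  rw [key]
  exact congr(($e4 u : HomBundle (Tan E M) (Tan E M) x) v)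

/-- The curvature tensor `R_{ab}{}^c{}_d u^a v^b w^d`, defined by
`(∇_a ∇_b - ∇_b ∇_a) X^c = R_{ab}{}^c{}_d X^d`. -/
def R (x : M) : HomBundle (Tan E M) (HomBundle (Tan E M) (HomBundle (Tan E M) (Tan E M))) x :=
  .ofLinear
    { toFun u := .ofLinear
        { toFun v := .ofLinear
            { toFun w := 𝓕.curv 𝓕.conn (FiberBundle.extend E w) x u v
              map_add' w w' := by
                simp only [curv, secondDeriv_extend_add]
                module
              map_smul' c w := by
                simp only [curv, secondDeriv_extend_smul, RingHom.id_apply]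
                module }
          map_add' v v' := by
            ext w
            simp only [curv, secondDeriv, HomBundle.ofLinear_apply, LinearMap.coe_mk,
              AddHom.coe_mk, map_add, HomBundle.add_apply]
            module
          map_smul' c v := by
            ext w
            simp only [curv, secondDeriv, HomBundle.ofLinear_apply, LinearMap.coe_mk,
              AddHom.coe_mk, map_smul, HomBundle.smul_apply, RingHom.id_apply]
            module }
      map_add' u u' := by
        ext v w
        simp only [curv, secondDeriv, HomBundle.ofLinear_apply, LinearMap.coe_mk,
          AddHom.coe_mk, map_add, HomBundle.add_apply]
        module
      map_smul' c u := by
        ext v w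
        simp only [curv, secondDeriv, HomBundle.ofLinear_apply, LinearMap.coe_mk,
          AddHom.coe_mk, map_smul, HomBundle.smul_apply, RingHom.id_apply]
        module }

theorem R_apply (x : M) (u v w : Tan E M x) :
    𝓕.R x u v w = 𝓕.curv 𝓕.conn (FiberBundle.extend E w) x u v := rfl

end Curvature

section Contraction

variable (𝓕 : FedosovStructure E M n)

/-- The map `T_x M → T_x^* M`, `u ↦ J(u, ·)`. -/
def lower (x : M) : Tan E M x →ₗ[ℝ] Cotan E M x := (𝓕.form x).toLinear

theorem lower_injective (x : M) : Function.Injective (𝓕.lower x) := by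
  refine (injective_iff_map_eq_zero _).2 fun u hu ↦ 𝓕.nondegenerate x u fun v ↦ ?_
  exact congr(($hu : Cotan E M x) v)

theorem finrank_cotan (x : M) :
    Module.finrank ℝ (Tan E M x) = Module.finrank ℝ (Cotan E M x) := by
  have e : Module.Dual ℝ (Tan E M x) ≃ₗ[ℝ] (Tan E M x →L[ℝ] ℝ) := LinearMap.toContinuousLinearMap
  exact Subspace.dual_finrank_eq.symm.trans e.finrank_eq

/-- Raising an index with `J^{ab}`: `(raise φ)^a = J^{ab} φ_b`.  This is the inverse of
`u^a ↦ u^a J_{ab}`, because `J_{ab} J^{ac} = δ_b^c`. -/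
def raise (x : M) : Cotan E M x →ₗ[ℝ] Tan E M x :=
  (LinearMap.linearEquivOfInjective (𝓕.lower x) (𝓕.lower_injective x)
    (finrank_cotan x)).symm.toLinearMap

theorem form_raise (x : M) (φ : Cotan E M x) : 𝓕.form x (𝓕.raise x φ) = φ :=
  (LinearMap.linearEquivOfInjective (𝓕.lower x) (𝓕.lower_injective x)
    (finrank_cotan x)).apply_symm_apply φ

/-- The full contraction `J^{ab} T_{ab}` of a tensor `T`, where `T p q = T_{ab} p^a q^b`. -/
def contract (x : M) (T : HomBundle (Tan E M) (Cotan E M) x) : ℝ :=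
  LinearMap.trace ℝ (Tan E M x) (𝓕.raise x ∘ₗ T.toLinear)

end Contraction

section Tensors

variable [T2Space M] (𝓕 : FedosovStructure E M n)

/-- The endomorphism `u ↦ A u v w` of the tangent space. -/
def firstSlot {x : M}
    (A : HomBundle (Tan E M) (HomBundle (Tan E M) (HomBundle (Tan E M) (Tan E M))) x)
    (v w : Tan E M x) : Tan E M x →ₗ[ℝ] Tan E M x where
  toFun u := A u v w
  map_add' u u' := by simp
  map_smul' c u := by simp

/-- `Φ_{bd} = (1 / (2 (n + 1))) R_{ab}{}^a{}_d`, as `Φ v w = Φ_{bd} v^b w^d`. -/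
def Phi (x : M) : HomBundle (Tan E M) (Cotan E M) x :=
  .ofLinear
    { toFun v := .ofLinear
        { toFun w := (1 / (2 * ((n : ℝ) + 1))) *
            LinearMap.trace ℝ (Tan E M x) (firstSlot (𝓕.R x) v w)
          map_add' w w' := by
            rw [← mul_add, ← map_add]
            congr 2
            ext u
            simp [firstSlot]
          map_smul' c w := by
            rw [RingHom.id_apply, smul_eq_mul, mul_left_comm, ← smul_eq_mul c, ← map_smul]
            congr 2
            ext u
            simp [firstSlot] }
      map_add' v v' := by
        ext w
        change (_ * _ : ℝ) = (_ * _ : ℝ) + (_ * _ : ℝ)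
        rw [← mul_add, ← map_add]
        congr 2
        ext u
        simp [firstSlot]
      map_smul' c v := by
        ext w
        change (_ * _ : ℝ) = c * (_ * _ : ℝ)
        rw [mul_left_comm, ← smul_eq_mul c, ← map_smul]
        congr 2
        ext u
        simp [firstSlot] }

theorem Phi_apply (x : M) (v w : Tan E M x) :
    𝓕.Phi x v w = (1 / (2 * ((n : ℝ) + 1))) *
      LinearMap.trace ℝ (Tan E M x) (firstSlot (𝓕.R x) v w) := rfl

/-- The tensor `V_{ab}{}^c{}_d` defined by the decomposition
`R_{ab}{}^c{}_d = V_{ab}{}^c{}_d + δ_a^c Φ_{bd} - δ_b^c Φ_{ad} + J_{ad} Φ_{be} J^{ce}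
  - J_{bd} Φ_{ae} J^{ce} + 2 J_{ab} Φ_{de} J^{ce}`. -/
def V (x : M) : HomBundle (Tan E M) (HomBundle (Tan E M) (HomBundle (Tan E M) (Tan E M))) x :=
  .ofLinear
    { toFun u := .ofLinear
        { toFun v := .ofLinear
            { toFun w := 𝓕.R x u v w - ((𝓕.Phi x v w : ℝ) • u - (𝓕.Phi x u w : ℝ) • v
                + (𝓕.form x u w : ℝ) • 𝓕.raise x (𝓕.Phi x v)
                - (𝓕.form x v w : ℝ) • 𝓕.raise x (𝓕.Phi x u)
                + (2 * (𝓕.form x u v : ℝ)) • 𝓕.raise x (𝓕.Phi x w))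
              map_add' w w' := by
                simp only [map_add, add_smul, smul_add]
                module
              map_smul' c w := by
                simp only [map_smul, smul_eq_mul, RingHom.id_apply]
                module }
          map_add' v v' := by
            ext w
            simp only [map_add, HomBundle.ofLinear_apply, LinearMap.coe_mk, AddHom.coe_mk,
              HomBundle.add_apply]
            module
          map_smul' c v := by
            ext w
            simp only [map_smul, HomBundle.ofLinear_apply, LinearMap.coe_mk, AddHom.coe_mk,
              HomBundle.smul_apply, RingHom.id_apply, smul_eq_mul]
            module }
      map_add' u u' := by
        ext v w
        simp only [map_add, HomBundle.ofLinear_apply, LinearMap.coe_mk, AddHom.coe_mk,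
          HomBundle.add_apply]
        module
      map_smul' c u := by
        ext v w
        simp only [map_smul, HomBundle.ofLinear_apply, LinearMap.coe_mk, AddHom.coe_mk,
          HomBundle.smul_apply, RingHom.id_apply, smul_eq_mul]
        module }

theorem R_eq (x : M) (u v w : Tan E M x) :
    𝓕.R x u v w = 𝓕.V x u v w + ((𝓕.Phi x v w : ℝ) • u - (𝓕.Phi x u w : ℝ) • v
      + (𝓕.form x u w : ℝ) • 𝓕.raise x (𝓕.Phi x v)
      - (𝓕.form x v w : ℝ) • 𝓕.raise x (𝓕.Phi x u)
      + (2 * (𝓕.form x u v : ℝ)) • 𝓕.raise x (𝓕.Phi x w)) := by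
  simp only [V, HomBundle.ofLinear_apply, LinearMap.coe_mk, AddHom.coe_mk]
  module

/-- The connection on `T^*M` induced by `∇`. -/
abbrev cotanConn : CovariantDerivative 𝓘(ℝ, E) (HomFiber E ℝ) (Cotan E M) :=
  𝓕.conn.hom (CovariantDerivative.trivialLine 𝓘(ℝ, E) M)

/-- `∇_c Φ_{ab}`, as `gradPhi w u v = w^c u^a v^b ∇_c Φ_{ab}`. -/
def gradPhi (x : M) : HomBundle (Tan E M) (HomBundle (Tan E M) (Cotan E M)) x :=
  derivSection (𝓕.conn.hom 𝓕.cotanConn) 𝓕.Phi x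

/-- `∇_e V_{ab}{}^c{}_d`, the index `e` being the first argument. -/
def gradV (x : M) : HomBundle (Tan E M)
    (HomBundle (Tan E M) (HomBundle (Tan E M) (HomBundle (Tan E M) (Tan E M)))) x :=
  derivSection (𝓕.conn.hom (𝓕.conn.hom (𝓕.conn.hom 𝓕.conn))) 𝓕.V x

/-- The bilinear form `(p, q) ↦ q^c u^a p^b ∇_c Φ_{ab}`. -/
def gradPhiAux (x : M) (u : Tan E M x) : HomBundle (Tan E M) (Cotan E M) x :=
  .ofLinear
    { toFun p := .ofLinear
        { toFun q := 𝓕.gradPhi x q u p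
          map_add' q q' := by simp
          map_smul' c q := by simp }
      map_add' p p' := by ext q; simp
      map_smul' c p := by ext q; simp }

/-- `S_a = (1 / (2 n + 1)) J^{bc} ∇_c Φ_{ab}`. -/
def S (x : M) : Cotan E M x :=
  .ofLinear
    { toFun u := (1 / (2 * (n : ℝ) + 1)) * 𝓕.contract x (𝓕.gradPhiAux x u)
      map_add' u u' := by
        rw [← mul_add, contract, contract, contract, ← map_add]
        congr 2
        ext p
        simp only [LinearMap.add_apply, LinearMap.comp_apply, ← map_add]
        congr 1
        ext q
        simp [gradPhiAux]
      map_smul' c u := by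
        rw [RingHom.id_apply, smul_eq_mul, mul_left_comm, ← smul_eq_mul c, contract, contract,
          ← map_smul]
        congr 2
        ext p
        simp only [LinearMap.smul_apply, LinearMap.comp_apply, ← map_smul]
        congr 1
        ext q
        simp [gradPhiAux] }

/-- The endomorphism `z^e ↦ z^e u^a v^b w^d ∇_e V_{ab}{}^c{}_d`. -/
def gradVAux (x : M) (u v w : Tan E M x) : Tan E M x →ₗ[ℝ] Tan E M x where
  toFun z := 𝓕.gradV x z u v w
  map_add' z z' := by simp
  map_smul' c z := by simp

/-- `Y_{abd} = (1 / (2 n + 1)) ∇_c V_{ab}{}^c{}_d`. -/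
def Y (x : M) : HomBundle (Tan E M) (HomBundle (Tan E M) (Cotan E M)) x :=
  .ofLinear
    { toFun u := .ofLinear
        { toFun v := .ofLinear
            { toFun w := (1 / (2 * (n : ℝ) + 1)) *
                LinearMap.trace ℝ (Tan E M x) (𝓕.gradVAux x u v w)
              map_add' w w' := by
                rw [← mul_add, ← map_add]
                congr 2
                ext z
                simp [gradVAux]
              map_smul' c w := by
                rw [RingHom.id_apply, smul_eq_mul, mul_left_comm, ← smul_eq_mul c, ← map_smul]
                congr 2
                ext z
                simp [gradVAux] }
          map_add' v v' := by
            ext w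
            change (_ * _ : ℝ) = (_ * _ : ℝ) + (_ * _ : ℝ)
            rw [← mul_add, ← map_add]
            congr 2
            ext z
            simp [gradVAux]
          map_smul' c v := by
            ext w
            change (_ * _ : ℝ) = c * (_ * _ : ℝ)
            rw [mul_left_comm, ← smul_eq_mul c, ← map_smul]
            congr 2
            ext z
            simp [gradVAux] }
      map_add' u u' := by
        ext v w
        change (_ * _ : ℝ) = (_ * _ : ℝ) + (_ * _ : ℝ)
        rw [← mul_add, ← map_add]
        congr 2
        ext z
        simp [gradVAux]
      map_smul' c u := by
        ext v w
        change (_ * _ : ℝ) = c * (_ * _ : ℝ)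
        rw [mul_left_comm, ← smul_eq_mul c, ← map_smul]
        congr 2
        ext z
        simp [gradVAux] }

/-- `∇_c S_d`, as `gradS p q = p^c q^d ∇_c S_d`. -/
def gradS (x : M) : HomBundle (Tan E M) (Cotan E M) x :=
  derivSection 𝓕.cotanConn 𝓕.S x

/-- `∇_c Y_{abd}`, the index `c` being the first argument. -/
def gradY (x : M) :
    HomBundle (Tan E M) (HomBundle (Tan E M) (HomBundle (Tan E M) (Cotan E M))) x :=
  derivSection (𝓕.conn.hom (𝓕.conn.hom 𝓕.cotanConn)) 𝓕.Y x

end Tensors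

section Tractors

variable (E M) in
/-- The standard tractor bundle `Λ⁰ ⊕ Λ¹ ⊕ Λ⁰`, whose elements are triples `(σ, μ, ρ)`. -/
abbrev Tractor : M → Type _ := Line M ×ᵇ (Cotan E M ×ᵇ Line M)

variable (E) in
/-- The model fibre of the standard tractor bundle. -/
abbrev TractorFiber : Type _ := ℝ × (HomFiber E ℝ × ℝ)

variable [T2Space M] (𝓕 : FedosovStructure E M n)

/-- The form `⟨(σ, μ, ρ), (σ', μ', ρ')⟩ = σ ρ' + J^{bc} μ_b μ'_c - ρ σ'` on tractors. -/
def pairing (x : M) (s t : Tractor E M x) : ℝ :=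
  s.1 * t.2.2 + s.2.1 (𝓕.raise x t.2.1) - s.2.2 * t.1

/-- The algebraic part `(σ, μ, ρ) ↦ (-μ_a, J_{ab} ρ + Φ_{ab} σ, -Φ_{ab} J^{bc} μ_c + S_a σ)`
of the tractor connection. -/
def tractorForm (x : M) : Tractor E M x →L[ℝ] Tan E M x →L[ℝ] Tractor E M x :=
  LinearMap.toContinuousBilinearMap <| LinearMap.mk₂ ℝ
    (fun (s : Tractor E M x) (u : Tan E M x) ↦
      ((-(s.2.1 u), s.2.2 • 𝓕.form x u + s.1 • 𝓕.Phi x u,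
        -(𝓕.Phi x u (𝓕.raise x s.2.1)) + 𝓕.S x u * s.1) : Tractor E M x))
    (by
      intro s s' u
      refine Prod.ext ?_ (Prod.ext ?_ ?_)
      · change -((s.2.1 + s'.2.1) u : ℝ) = -(s.2.1 u : ℝ) + -(s'.2.1 u : ℝ)
        rw [HomBundle.add_apply]
        ring
      · change (s.2.2 + s'.2.2 : ℝ) • 𝓕.form x u + (s.1 + s'.1 : ℝ) • 𝓕.Phi x u =
          (s.2.2 • 𝓕.form x u + s.1 • 𝓕.Phi x u) + (s'.2.2 • 𝓕.form x u + s'.1 • 𝓕.Phi x u)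
        module
      · change -(𝓕.Phi x u (𝓕.raise x (s.2.1 + s'.2.1)) : ℝ) + 𝓕.S x u * (s.1 + s'.1 : ℝ) =
          (-(𝓕.Phi x u (𝓕.raise x s.2.1)) + 𝓕.S x u * s.1 : ℝ) +
            (-(𝓕.Phi x u (𝓕.raise x s'.2.1)) + 𝓕.S x u * s'.1 : ℝ)
        simp only [map_add]
        ring)
    (by
      intro c s u
      refine Prod.ext ?_ (Prod.ext ?_ ?_)
      · change -((c • s.2.1) u : ℝ) = c * (-(s.2.1 u : ℝ))
        rw [HomBundle.smul_apply, smul_eq_mul]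
        ring
      · change (c * s.2.2 : ℝ) • 𝓕.form x u + (c * s.1 : ℝ) • 𝓕.Phi x u =
          c • (s.2.2 • 𝓕.form x u + s.1 • 𝓕.Phi x u)
        module
      · change -(𝓕.Phi x u (𝓕.raise x (c • s.2.1)) : ℝ) + 𝓕.S x u * (c * s.1 : ℝ) =
          c * (-(𝓕.Phi x u (𝓕.raise x s.2.1)) + 𝓕.S x u * s.1 : ℝ)
        simp only [map_smul, smul_eq_mul]
        ring)
    (by
      intro s u u'
      refine Prod.ext ?_ (Prod.ext ?_ ?_)
      · change -(s.2.1 (u + u') : ℝ) = -(s.2.1 u : ℝ) + -(s.2.1 u' : ℝ)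
        rw [map_add]
        ring
      · change s.2.2 • 𝓕.form x (u + u') + s.1 • 𝓕.Phi x (u + u') =
          (s.2.2 • 𝓕.form x u + s.1 • 𝓕.Phi x u) + (s.2.2 • 𝓕.form x u' + s.1 • 𝓕.Phi x u')
        simp only [map_add]
        module
      · change -(𝓕.Phi x (u + u') (𝓕.raise x s.2.1) : ℝ) + 𝓕.S x (u + u') * s.1 =
          (-(𝓕.Phi x u (𝓕.raise x s.2.1)) + 𝓕.S x u * s.1 : ℝ) +
            (-(𝓕.Phi x u' (𝓕.raise x s.2.1)) + 𝓕.S x u' * s.1 : ℝ)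
        simp only [map_add, HomBundle.add_apply]
        ring)
    (by
      intro c s u
      refine Prod.ext ?_ (Prod.ext ?_ ?_)
      · change -(s.2.1 (c • u) : ℝ) = c * (-(s.2.1 u : ℝ))
        rw [map_smul, smul_eq_mul]
        ring
      · change s.2.2 • 𝓕.form x (c • u) + s.1 • 𝓕.Phi x (c • u) =
          c • (s.2.2 • 𝓕.form x u + s.1 • 𝓕.Phi x u)
        simp only [map_smul]
        module
      · change -(𝓕.Phi x (c • u) (𝓕.raise x s.2.1) : ℝ) + 𝓕.S x (c • u) * s.1 =
          c * (-(𝓕.Phi x u (𝓕.raise x s.2.1)) + 𝓕.S x u * s.1 : ℝ)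
        simp only [map_smul, HomBundle.smul_apply, smul_eq_mul]
        ring)

/-- The tractor connection
`∇_a (σ, μ_b, ρ) = (∇_a σ - μ_a, ∇_a μ_b + J_{ab} ρ + Φ_{ab} σ, ∇_a ρ - Φ_{ab} J^{bc} μ_c + S_a σ)`;
see `tractorConnection_apply`. -/
def tractorConnection : CovariantDerivative 𝓘(ℝ, E) (TractorFiber E) (Tractor E M) :=
  ((CovariantDerivative.trivialLine 𝓘(ℝ, E) M).directSum
    (𝓕.cotanConn.directSum (CovariantDerivative.trivialLine 𝓘(ℝ, E) M))).addOneForm 𝓕.tractorForm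

theorem tractorConnection_apply (s : Π x, Tractor E M x) (x : M) (u : Tan E M x) :
    𝓕.tractorConnection s x u =
      (mvfderiv 𝓘(ℝ, E) (fun y ↦ (s y).1 : M → ℝ) x u - (s x).2.1 u,
        𝓕.cotanConn (fun y ↦ (s y).2.1) x u
          + ((s x).2.2 • 𝓕.form x u + (s x).1 • 𝓕.Phi x u),
        mvfderiv 𝓘(ℝ, E) (fun y ↦ (s y).2.2 : M → ℝ) x u
          + (-(𝓕.Phi x u (𝓕.raise x (s x).2.1)) + 𝓕.S x u * (s x).1)) := by
  refine Prod.ext ?_ rfl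
  exact (sub_eq_add_neg (G := ℝ) _ _).symm

/-- The tensor `V_{bc}{}^e{}_p Φ_{eq}` evaluated on `u^b v^c`, as a bilinear form in `p` and `q`. -/
def VPhi (x : M) (u v : Tan E M x) : HomBundle (Tan E M) (Cotan E M) x :=
  .ofLinear
    { toFun p := .ofLinear
        { toFun q := 𝓕.Phi x q (𝓕.V x u v p)
          map_add' q q' := by simp
          map_smul' c q := by simp }
      map_add' p p' := by ext q; simp
      map_smul' c p := by ext q; simp }

/-- The bilinear form `(p, q) ↦ p^c q^d u^a v^b ∇_c Y_{abd}`. -/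
def gradYAux (x : M) (u v : Tan E M x) : HomBundle (Tan E M) (Cotan E M) x :=
  .ofLinear
    { toFun p := 𝓕.gradY x p u v
      map_add' p p' := by ext q; simp
      map_smul' c p := by ext q; simp }

/-- The bilinear form `(p, q) ↦ p^c q^d J^{ef} Φ_{ce} Φ_{df}`. -/
def PhiPhi (x : M) : HomBundle (Tan E M) (Cotan E M) x :=
  .ofLinear
    { toFun p := .ofLinear
        { toFun q := 𝓕.Phi x p (𝓕.raise x (𝓕.Phi x q))
          map_add' q q' := by simp
          map_smul' c q := by simp }
      map_add' p p' := by ext q; simp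
      map_smul' c p := by ext q; simp }

/-- The part of the tractor curvature built from `V` and `Y`, contracted with `u^a v^b`:
`(0, -V_{ab}{}^c{}_d μ_c + Y_{abd} σ,
  -Y_{abc} J^{cd} μ_d + (1 / (2 n)) (J^{cd} V_{ab}{}^e{}_c Φ_{de} - J^{cd} ∇_c Y_{abd}) σ)`. -/
def curvatureVY (x : M) (u v : Tan E M x) (s : Tractor E M x) : Tractor E M x :=
  (0,
    -(.ofLinear (s.2.1.toLinear ∘ₗ (𝓕.V x u v).toLinear)) + s.1 • 𝓕.Y x u v,
    -(𝓕.Y x u v (𝓕.raise x s.2.1)) + (1 / (2 * (n : ℝ))) *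
      (𝓕.contract x (𝓕.VPhi x u v) - 𝓕.contract x (𝓕.gradYAux x u v)) * s.1)

/-- The endomorphism
`(σ, μ_d, ρ) ↦ (ρ, J^{ce} Φ_{cd} μ_e - S_d σ,
  S_c J^{cd} μ_d + (1 / (2 n)) J^{cd} (∇_c S_d - J^{ef} Φ_{ce} Φ_{df}) σ)`
of the standard tractor bundle. -/
def Theta (x : M) : Tractor E M x →ₗ[ℝ] Tractor E M x where
  toFun s :=
    (s.2.2,
      𝓕.Phi x (𝓕.raise x s.2.1) - s.1 • 𝓕.S x,
      𝓕.S x (𝓕.raise x s.2.1) + (1 / (2 * (n : ℝ))) *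
        𝓕.contract x (𝓕.gradS x - 𝓕.PhiPhi x) * s.1)
  map_add' s t := by
    refine Prod.ext rfl (Prod.ext ?_ ?_)
    · change 𝓕.Phi x (𝓕.raise x (s.2.1 + t.2.1)) - (s.1 + t.1 : ℝ) • 𝓕.S x =
        (𝓕.Phi x (𝓕.raise x s.2.1) - s.1 • 𝓕.S x) + (𝓕.Phi x (𝓕.raise x t.2.1) - t.1 • 𝓕.S x)
      simp only [map_add]
      module
    · change (𝓕.S x (𝓕.raise x (s.2.1 + t.2.1)) : ℝ) + (1 / (2 * (n : ℝ))) *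
        𝓕.contract x (𝓕.gradS x - 𝓕.PhiPhi x) * (s.1 + t.1 : ℝ) = (_ + _ : ℝ) + (_ + _ : ℝ)
      simp only [map_add]
      ring
  map_smul' c s := by
    refine Prod.ext rfl (Prod.ext ?_ ?_)
    · change 𝓕.Phi x (𝓕.raise x (c • s.2.1)) - (c * s.1 : ℝ) • 𝓕.S x =
        c • (𝓕.Phi x (𝓕.raise x s.2.1) - s.1 • 𝓕.S x)
      simp only [map_smul]
      module
    · change (𝓕.S x (𝓕.raise x (c • s.2.1)) : ℝ) + (1 / (2 * (n : ℝ))) *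
        𝓕.contract x (𝓕.gradS x - 𝓕.PhiPhi x) * (c * s.1 : ℝ) = c * (_ + _ : ℝ)
      simp only [map_smul, smul_eq_mul]
      ring

end Tractors
end FedosovStructure

end

/-! The tractor connection is the direct sum of the induced connections on Λ⁰ ⊕ Λ¹ ⊕ Λ⁰ plus an
algebraic one-form. The direct sum preserves the pairing because J^{bc} is parallel, and the
one-form is skew for the pairing because J^{bc} is skew; together these give `mvfderiv_pairing`.

For the curvature, second covariant derivatives are evaluated on vector fields that are parallel at
the given point (`exists_parallel`), where they become iterated derivatives. On alternating, the
Hessians of σ and ρ cancel because ∇ is torsion-free, all terms with one derivative of (σ, μ, ρ)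
cancel because they are symmetric, and the second derivatives of μ give -μ∘R by the Ricci identity.
What is left is algebraic in (σ, μ, ρ), and three facts identify it with the stated formula.

Φ is symmetric (`Phi_symm`). Since ∇J = 0, each R(u,v) is skew for J, hence trace-free, and a trace
of the first Bianchi identity gives the symmetry.

Y is the alternation of ∇Φ corrected by S ⊗ J terms (`Y_eq`). This is a trace of the second Bianchi
identity with R replaced by its decomposition into V, Φ and J.

The coefficient of σ in the last slot, ∇_aS_b - ∇_bS_a plus a quadratic term in Φ, is found by
differentiating `Y_eq`, contracting with J^{cd} and commuting the derivatives of Φ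
(`contract_gradYAux`). The result carries a factor 2n, which explains the 1/(2n) of the statement;
in dimension zero the coefficient vanishes anyway (`gradS_sub`).

The analytic groundwork consists of cutting off local sections to global ones, so that tensor
identities can be tested on smooth sections, and of showing that ∇ commutes with traces and with
raising indices. -/

noncomputable section

/-! ### Global smooth sections, smoothness tests and local frames -/

section SmoothSections

variable {E : Type*} [NormedAddCommGroup E] [NormedSpace ℝ E] [FiniteDimensional ℝ E]
  {M : Type*} [TopologicalSpace M] [T2Space M] [ChartedSpace E M] [IsManifold 𝓘(ℝ, E) ∞ M]
  {F : Type*} [NormedAddCommGroup F] [NormedSpace ℝ F]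
  {V : M → Type*} [TopologicalSpace (TotalSpace F V)]
  [∀ x, AddCommGroup (V x)] [∀ x, Module ℝ (V x)] [∀ x, TopologicalSpace (V x)]
  [∀ x, IsTopologicalAddGroup (V x)] [∀ x, ContinuousSMul ℝ (V x)]
  [FiberBundle F V] [VectorBundle ℝ F V] [ContMDiffVectorBundle ∞ F V 𝓘(ℝ, E)]
  {F' : Type*} [NormedAddCommGroup F'] [NormedSpace ℝ F']
  {V' : M → Type*} [TopologicalSpace (TotalSpace F' V')]
  [∀ x, AddCommGroup (V' x)] [∀ x, Module ℝ (V' x)] [∀ x, TopologicalSpace (V' x)]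
  [∀ x, IsTopologicalAddGroup (V' x)] [∀ x, ContinuousSMul ℝ (V' x)]
  [FiberBundle F' V'] [VectorBundle ℝ F' V'] [ContMDiffVectorBundle ∞ F' V' 𝓘(ℝ, E)]

/-- The continuous linear map underlying an element of `Hom(V_x, V'_x)`. -/
def HomBundle.toCLM {x : M} (A : HomBundle V V' x) : V x →L[ℝ] V' x := A

theorem SmoothSection.diffSectionAt {σ : Π x, V x} (h : SmoothSection 𝓘(ℝ, E) F σ) (x : M) :
    DiffSectionAt 𝓘(ℝ, E) F σ x :=
  (h x).mdifferentiableAt (by simp)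

/-- A section which is smooth near `x` agrees near `x` with a global smooth section. -/
theorem exists_smoothSection_eventuallyEq {σ : Π x, V x} {x : M} {s : Set M} (hs : s ∈ 𝓝 x)
    (hσ : ContMDiffOn 𝓘(ℝ, E) (𝓘(ℝ, E).prod 𝓘(ℝ, F)) ∞ (fun y ↦ TotalSpace.mk' F y (σ y)) s) :
    ∃ τ : Π x, V x, SmoothSection 𝓘(ℝ, E) F τ ∧ ∀ᶠ y in 𝓝 x, τ y = σ y := by
  obtain ⟨f, hf, -⟩ := ((SmoothBumpFunction.nhds_basis_support (I := 𝓘(ℝ, E))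
    (interior_mem_nhds.2 hs)).mem_iff).1 (Filter.univ_mem (f := 𝓝 x))
  refine ⟨(f : M → ℝ) • σ, ContMDiffOn.smul_section_of_tsupport f.contMDiff.contMDiffOn
    isOpen_interior hf (hσ.mono interior_subset), ?_⟩
  filter_upwards [f.eventuallyEq_one] with y hy
  simp [hy]

/-- The local extension of a vector is cut off by a bump function. Tensor identities at a point can
thereby be tested on global smooth sections. -/
theorem exists_smoothSection_eq {x : M} (v : V x) :
    ∃ τ : Π x, V x, SmoothSection 𝓘(ℝ, E) F τ ∧ τ x = v := by
  obtain ⟨s, hs, h⟩ := FiberBundle.exists_contMDiffOn_extend 𝓘(ℝ, E) F v (k := ∞)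
  obtain ⟨τ, hτ, he⟩ := exists_smoothSection_eventuallyEq hs h
  exact ⟨τ, hτ, by rw [he.self_of_nhds]; simp⟩

theorem smoothSection_line_iff {f : Π x, Line M x} :
    SmoothSection 𝓘(ℝ, E) ℝ f ↔ ContMDiff 𝓘(ℝ, E) 𝓘(ℝ, ℝ) ∞ (f : M → ℝ) :=
  forall_congr' fun x ↦ contMDiffAt_section x

theorem SmoothSection.hom_apply {A : Π x, HomBundle V V' x} {σ : Π x, V x}
    (hA : SmoothSection 𝓘(ℝ, E) (HomFiber F F') A) (hσ : SmoothSection 𝓘(ℝ, E) F σ) :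
    SmoothSection 𝓘(ℝ, E) F' (fun y ↦ A y (σ y)) :=
  ContMDiff.clm_bundle_apply hA hσ

/-- A family of homomorphisms between vector bundles is smooth if it maps smooth sections to
smooth sections. -/
theorem smoothSection_hom [FiniteDimensional ℝ F] {A : Π x, HomBundle V V' x}
    (h : ∀ σ : Π x, V x, SmoothSection 𝓘(ℝ, E) F σ →
      SmoothSection 𝓘(ℝ, E) F' (fun y ↦ A y (σ y))) :
    SmoothSection 𝓘(ℝ, E) (HomFiber F F') A := by
  intro x
  let b := Module.finBasis ℝ F
  have h1 : ContMDiffAt 𝓘(ℝ, E) 𝓘(ℝ, F →L[ℝ] F') ∞ (fun y ↦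
      ContinuousLinearMap.inCoordinates F V F' V' x y x y (A y).toCLM) x := by
    -- The columns of the coordinate matrix of `A` are the coordinates of `A` applied to a local
    -- frame. The frame is replaced by global sections agreeing with it near `x`, so that `h`
    -- applies.
    have key : ∀ i, ContMDiffAt 𝓘(ℝ, E) 𝓘(ℝ, F') ∞ (fun y ↦
        ContinuousLinearMap.inCoordinates F V F' V' x y x y (A y).toCLM (b i)) x := by
      intro i
      let e := trivializationAt F V x
      obtain ⟨τ, hτ, he⟩ := exists_smoothSection_eventuallyEq
        (e.open_baseSet.mem_nhds (FiberBundle.mem_baseSet_trivializationAt' x))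
        (e.contMDiffOn_localFrame_baseSet (I := 𝓘(ℝ, E)) ∞ b i)
      have h2 := (contMDiffAt_section x).1 (h τ hτ x)
      refine h2.congr_of_eventuallyEq ?_
      filter_upwards [he, e.open_baseSet.mem_nhds (FiberBundle.mem_baseSet_trivializationAt' x),
        (trivializationAt F' V' x).open_baseSet.mem_nhds
          (FiberBundle.mem_baseSet_trivializationAt' x)] with y hy hb hb'
      rw [ContinuousLinearMap.inCoordinates_eq hb hb', hy,
        e.localFrame_apply_of_mem_baseSet b hb]
      simp [Bundle.Trivialization.basisAt]
      rfl
    have h3 : (fun y ↦ ContinuousLinearMap.inCoordinates F V F' V' x y x y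
        (A y).toCLM) = fun y ↦ ∑ i, ContinuousLinearMap.smulRightL ℝ F F'
          (LinearMap.toContinuousLinearMap (b.coord i))
          (ContinuousLinearMap.inCoordinates F V F' V' x y x y (A y).toCLM (b i)) := by
      funext y
      generalize ContinuousLinearMap.inCoordinates F V F' V' x y x y (A y).toCLM = T
      ext v
      conv_lhs => rw [← b.sum_repr v, map_sum]
      simp
    rw [h3]
    refine ContMDiffAt.sum fun i _ ↦ ?_
    exact (ContinuousLinearMap.contMDiff _).contMDiffAt.comp x (key i)
  exact (contMDiffAt_hom_bundle _).2 ⟨contMDiffAt_id, h1⟩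

/-- The inverse of a smooth family of isomorphisms between vector bundles is smooth. -/
theorem smoothSection_of_inverse [FiniteDimensional ℝ F] [FiniteDimensional ℝ F']
    {A : Π x, HomBundle V V' x}
    {B : Π x, HomBundle V' V x} (hA : SmoothSection 𝓘(ℝ, E) (HomFiber F F') A)
    (hAB : ∀ x v, A x (B x v) = v) (hBA : ∀ x v, B x (A x v) = v) :
    SmoothSection 𝓘(ℝ, E) (HomFiber F' F) B := by
  intro x
  let a (y : M) := ContinuousLinearMap.inCoordinates F V F' V' x y x y (A y).toCLM
  let b (y : M) := ContinuousLinearMap.inCoordinates F' V' F V x y x y (B y).toCLM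
  have ha : ContMDiffAt 𝓘(ℝ, E) 𝓘(ℝ, F →L[ℝ] F') ∞ a x :=
    ((contMDiffAt_hom_bundle _).1 (hA x)).2
  have hab : ∀ᶠ y in 𝓝 x, (∀ v, a y (b y v) = v) ∧ ∀ v, b y (a y v) = v := by
    filter_upwards [(trivializationAt F V x).open_baseSet.mem_nhds
        (FiberBundle.mem_baseSet_trivializationAt' x),
        (trivializationAt F' V' x).open_baseSet.mem_nhds
          (FiberBundle.mem_baseSet_trivializationAt' x)] with y hb hb'
    have hA' : ∀ v, (A y).toCLM ((B y).toCLM v) = v := hAB y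
    have hB' : ∀ v, (B y).toCLM ((A y).toCLM v) = v := hBA y
    constructor <;> intro v <;>
    · simp only [a, b]
      rw [ContinuousLinearMap.inCoordinates_eq hb hb', ContinuousLinearMap.inCoordinates_eq hb' hb]
      simp [hA', hB', hb, hb']
  let e (y : M) (h : (∀ v, a y (b y v) = v) ∧ ∀ v, b y (a y v) = v) : F ≃L[ℝ] F' :=
    ContinuousLinearEquiv.equivOfInverse (a y) (b y) h.2 h.1
  -- In coordinates `B` is the operator inverse of `A` near `x`, and inversion is smooth at an
  -- invertible operator on a complete space.
  have he : ∀ᶠ y in 𝓝 x, b y = ContinuousLinearMap.inverse (a y) := by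
    filter_upwards [hab] with y hy
    have : a y = (e y hy : F →L[ℝ] F') := by ext v; rfl
    rw [this, ContinuousLinearMap.inverse_equiv]
    ext v
    rfl
  have h0 := hab.self_of_nhds
  have hinv : ContMDiffAt 𝓘(ℝ, F →L[ℝ] F') 𝓘(ℝ, F' →L[ℝ] F) ∞
      (ContinuousLinearMap.inverse : (F →L[ℝ] F') → F' →L[ℝ] F) (a x) := by
    rw [contMDiffAt_iff_contDiffAt]
    have : FiniteDimensional ℝ F := inferInstance
    have : CompleteSpace F := FiniteDimensional.complete ℝ F
    exact contDiffAt_map_inverse (e x h0)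
  have hb : ContMDiffAt 𝓘(ℝ, E) 𝓘(ℝ, F' →L[ℝ] F) ∞ b x :=
    (hinv.comp x ha).congr_of_eventuallyEq he
  exact (contMDiffAt_hom_bundle _).2 ⟨contMDiffAt_id, hb⟩

/-- Existence of a local frame of the tangent bundle near `x` and of its dual coframe, both made
of global smooth sections. -/
theorem exists_frame (x : M) : ∃ (X : Fin (Module.finrank ℝ E) → Π y, Tan E M y)
    (ε : Fin (Module.finrank ℝ E) → Π y, Cotan E M y),
    (∀ i, SmoothSection 𝓘(ℝ, E) E (X i)) ∧ (∀ i, SmoothSection 𝓘(ℝ, E) (HomFiber E ℝ) (ε i)) ∧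
    ∀ᶠ y in 𝓝 x, ∀ v : Tan E M y, ∑ i, (ε i y v : ℝ) • X i y = v := by
  let e := trivializationAt E (Tan E M) x
  let b := Module.finBasis ℝ E
  have hx := e.open_baseSet.mem_nhds (FiberBundle.mem_baseSet_trivializationAt' x)
  choose X hX hXe using fun i ↦ exists_smoothSection_eventuallyEq hx
    (e.contMDiffOn_localFrame_baseSet (I := 𝓘(ℝ, E)) ∞ b i)
  obtain ⟨f, hf, -⟩ := ((SmoothBumpFunction.nhds_basis_support (I := 𝓘(ℝ, E))
    hx).mem_iff).1 (Filter.univ_mem (f := 𝓝 x))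
  -- The bump function makes the local coefficient functionals global; duality with `X` survives
  -- where it equals one.
  let ε (i : Fin (Module.finrank ℝ E)) (y : M) : Cotan E M y :=
    HomBundle.ofLinear (V' := Line M) (f y • e.localFrameCoeff 𝓘(ℝ, E) b i y)
  refine ⟨X, ε, hX, fun i ↦ smoothSection_hom fun σ hσ ↦ smoothSection_line_iff.2 ?_, ?_⟩
  · have : ContMDiffOn 𝓘(ℝ, E) 𝓘(ℝ, ℝ) ∞ (fun y ↦ e.localFrameCoeff 𝓘(ℝ, E) b i y (σ y))
        e.baseSet := contMDiffOn_baseSet_localFrameCoeff b hσ.contMDiffOn i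
    refine contMDiff_of_tsupport fun y hy ↦ ?_
    have hy' : y ∈ e.baseSet := hf (closure_mono (Function.support_subset_iff'.2 fun z hz ↦ by
      simp only [Function.mem_support, not_not] at hz
      simp [ε, hz]) hy)
    exact f.contMDiff.contMDiffAt.mul (this.contMDiffAt (e.open_baseSet.mem_nhds hy'))
  · filter_upwards [hx, Filter.eventually_all.2 hXe, f.eventuallyEq_one] with y hy hXy hfy v
    have := e.eq_sum_localFrameCoeff_smul (I := 𝓘(ℝ, E)) (b := b)
      (s := fun z ↦ (FiberBundle.extend E v : Π z, Tan E M z) z) hy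
    simp only [FiberBundle.extend_apply_self] at this
    conv_rhs => rw [this]
    refine Finset.sum_congr rfl fun i _ ↦ ?_
    rw [hXy]
    congr 1
    simp [ε, hfy]

/-- In the chart at `x` the covector is a linear function; it is shifted to vanish at `x` and cut
off. The result serves both to correct a field to one parallel at `x` and as the test function for
the first Bianchi identity. -/
theorem exists_smooth_mvfderiv_eq (x : M) (φ : Tan E M x →L[ℝ] ℝ) :
    ∃ f : M → ℝ, ContMDiff 𝓘(ℝ, E) 𝓘(ℝ, ℝ) ∞ f ∧ f x = 0 ∧ mvfderiv 𝓘(ℝ, E) f x = φ := by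
  have hinv := isInvertible_mfderiv_extChartAt (I := 𝓘(ℝ, E))
    (mem_extChartAt_source (I := 𝓘(ℝ, E)) x)
  obtain ⟨L, hL⟩ := hinv
  let ψ : E →L[ℝ] ℝ := φ ∘L L.symm.toContinuousLinearMap
  let z₀ := extChartAt 𝓘(ℝ, E) x x
  let g : M → ℝ := fun y ↦ ψ (extChartAt 𝓘(ℝ, E) x y) - ψ z₀
  have h1 : HasMFDerivAt 𝓘(ℝ, E) 𝓘(ℝ, E) (extChartAt 𝓘(ℝ, E) x) x
      (mfderiv 𝓘(ℝ, E) 𝓘(ℝ, E) (extChartAt 𝓘(ℝ, E) x) x) :=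
    (mdifferentiableAt_extChartAt (mem_chart_source E x)).hasMFDerivAt
  have h2 : HasMFDerivAt 𝓘(ℝ, E) 𝓘(ℝ, ℝ) (fun z ↦ ψ z - ψ z₀) z₀ ψ :=
    (ψ.hasFDerivAt.sub_const (ψ z₀)).hasMFDerivAt
  have h3 := h2.comp x h1
  obtain ⟨f, hf, -⟩ := ((SmoothBumpFunction.nhds_basis_support (I := 𝓘(ℝ, E))
    ((chartAt E x).open_source.mem_nhds (mem_chart_source E x))).mem_iff).1
      (Filter.univ_mem (f := 𝓝 x))
  refine ⟨fun y ↦ f y * g y, ?_, ?_, ?_⟩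
  · refine contMDiff_of_tsupport fun y hy ↦ ?_
    have hy' : y ∈ (chartAt E x).source := hf (closure_mono
      (Function.support_subset_iff'.2 fun z hz ↦ by
        simp only [Function.mem_support, not_not] at hz
        simp [hz]) hy)
    have h4 : ContMDiffAt 𝓘(ℝ, E) 𝓘(ℝ, E) ∞ (extChartAt 𝓘(ℝ, E) x) y := contMDiffAt_extChartAt' hy'
    have h5 : ContMDiffAt 𝓘(ℝ, E) 𝓘(ℝ, ℝ) ∞ g y :=
      (ψ.contMDiff.contMDiffAt.comp y h4).sub contMDiffAt_const
    exact f.contMDiff.contMDiffAt.mul h5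
  · simp [g, z₀]
  · have h6 : HasMFDerivAt 𝓘(ℝ, E) 𝓘(ℝ, ℝ) (fun y ↦ f y * g y) x
        (ψ ∘L mfderiv 𝓘(ℝ, E) 𝓘(ℝ, E) (extChartAt 𝓘(ℝ, E) x) x) :=
      h3.congr_of_eventuallyEq (by
        filter_upwards [f.eventuallyEq_one] with y hy
        simp [hy, g])
    ext u
    rw [mvfderiv, h6.mfderiv, ← hL]
    change φ (L.symm (L u)) = φ u
    rw [L.symm_apply_apply]

end SmoothSections

/-! ### Smooth connections and fields parallel at a point -/

section SmoothConnections

variable {E : Type*} [NormedAddCommGroup E] [NormedSpace ℝ E] [FiniteDimensional ℝ E]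
  {M : Type*} [TopologicalSpace M] [T2Space M] [ChartedSpace E M] [IsManifold 𝓘(ℝ, E) ∞ M]
  {F : Type*} [NormedAddCommGroup F] [NormedSpace ℝ F]
  {V : M → Type*} [TopologicalSpace (TotalSpace F V)]
  [∀ x, AddCommGroup (V x)] [∀ x, Module ℝ (V x)] [∀ x, TopologicalSpace (V x)]
  [∀ x, IsTopologicalAddGroup (V x)] [∀ x, ContinuousSMul ℝ (V x)]
  [FiberBundle F V] [VectorBundle ℝ F V] [ContMDiffVectorBundle ∞ F V 𝓘(ℝ, E)]
  {F' : Type*} [NormedAddCommGroup F'] [NormedSpace ℝ F']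
  {V' : M → Type*} [TopologicalSpace (TotalSpace F' V')]
  [∀ x, AddCommGroup (V' x)] [∀ x, Module ℝ (V' x)] [∀ x, TopologicalSpace (V' x)]
  [∀ x, IsTopologicalAddGroup (V' x)] [∀ x, ContinuousSMul ℝ (V' x)]
  [FiberBundle F' V'] [VectorBundle ℝ F' V'] [ContMDiffVectorBundle ∞ F' V' 𝓘(ℝ, E)]

open FedosovStructure

/-- This function is the fibre component of the tangent map of `f` composed with `U`. -/
theorem ContMDiff.mvfderiv_apply {f : M → ℝ} (hf : ContMDiff 𝓘(ℝ, E) 𝓘(ℝ, ℝ) ∞ f)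
    {U : Π x, Tan E M x} (hU : SmoothSection 𝓘(ℝ, E) E U) :
    ContMDiff 𝓘(ℝ, E) 𝓘(ℝ, ℝ) ∞ (fun y ↦ mvfderiv 𝓘(ℝ, E) f y (U y)) :=
  (contMDiff_snd_tangentBundle_modelSpace ℝ 𝓘(ℝ, ℝ)).comp
    ((hf.contMDiff_tangentMap (m := ∞) (by simp)).comp hU)

theorem ContMDiff.mdiffAt {f : M → ℝ} (hf : ContMDiff 𝓘(ℝ, E) 𝓘(ℝ, ℝ) ∞ f) (x : M) :
    MDifferentiableAt 𝓘(ℝ, E) 𝓘(ℝ, ℝ) f x :=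
  (hf x).mdifferentiableAt (by simp)

theorem SmoothSection.add {σ τ : Π x, V x} (hσ : SmoothSection 𝓘(ℝ, E) F σ)
    (hτ : SmoothSection 𝓘(ℝ, E) F τ) : SmoothSection 𝓘(ℝ, E) F (fun y ↦ σ y + τ y) :=
  hσ.add_section hτ

theorem SmoothSection.sub {σ τ : Π x, V x} (hσ : SmoothSection 𝓘(ℝ, E) F σ)
    (hτ : SmoothSection 𝓘(ℝ, E) F τ) : SmoothSection 𝓘(ℝ, E) F (fun y ↦ σ y - τ y) :=
  hσ.sub_section hτ

theorem SmoothSection.smul {f : M → ℝ} (hf : ContMDiff 𝓘(ℝ, E) 𝓘(ℝ, ℝ) ∞ f) {σ : Π x, V x}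
    (hσ : SmoothSection 𝓘(ℝ, E) F σ) : SmoothSection 𝓘(ℝ, E) F (fun y ↦ f y • σ y) :=
  hf.smul_section hσ

theorem SmoothSection.const_smul (c : ℝ) {σ : Π x, V x}
    (hσ : SmoothSection 𝓘(ℝ, E) F σ) : SmoothSection 𝓘(ℝ, E) F (fun y ↦ c • σ y) :=
  hσ.const_smul_section

namespace CovariantDerivative

/-- A connection is smooth if the covariant derivatives of smooth sections are smooth. -/
def IsSmooth (D : CovariantDerivative 𝓘(ℝ, E) F V) : Prop :=
  ∀ σ : Π x, V x, SmoothSection 𝓘(ℝ, E) F σ →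
    SmoothSection 𝓘(ℝ, E) (HomFiber E F) (derivSection D σ)

theorem IsSmooth.apply {D : CovariantDerivative 𝓘(ℝ, E) F V} (hD : D.IsSmooth) {σ : Π x, V x}
    (hσ : SmoothSection 𝓘(ℝ, E) F σ) {U : Π x, Tan E M x} (hU : SmoothSection 𝓘(ℝ, E) E U) :
    SmoothSection 𝓘(ℝ, E) F (fun y ↦ D σ y (U y)) :=
  (hD σ hσ).hom_apply hU

theorem isSmooth_of_apply {D : CovariantDerivative 𝓘(ℝ, E) F V}
    (h : ∀ σ : Π x, V x, SmoothSection 𝓘(ℝ, E) F σ → ∀ U : Π x, Tan E M x,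
      SmoothSection 𝓘(ℝ, E) E U → SmoothSection 𝓘(ℝ, E) F (fun y ↦ D σ y (U y))) :
    D.IsSmooth :=
  fun σ hσ ↦ smoothSection_hom fun U hU ↦ h σ hσ U hU

theorem isSmooth_trivialLine : (trivialLine 𝓘(ℝ, E) M).IsSmooth :=
  isSmooth_of_apply fun _ hσ _ hU ↦
    smoothSection_line_iff.2 ((smoothSection_line_iff.1 hσ).mvfderiv_apply hU)

theorem add_apply (D : CovariantDerivative 𝓘(ℝ, E) F V) {σ τ : Π x, V x} {x : M}
    (hσ : DiffSectionAt 𝓘(ℝ, E) F σ x) (hτ : DiffSectionAt 𝓘(ℝ, E) F τ x) (u : Tan E M x) :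
    D (fun y ↦ σ y + τ y) x u = D σ x u + D τ x u :=
  congr($(D.isCovariantDerivativeOnUniv.add hσ hτ) u)

theorem const_smul_apply (D : CovariantDerivative 𝓘(ℝ, E) F V) {σ : Π x, V x} {x : M} (c : ℝ)
    (hσ : DiffSectionAt 𝓘(ℝ, E) F σ x) (u : Tan E M x) :
    D (fun y ↦ c • σ y) x u = c • D σ x u :=
  congr($(D.isCovariantDerivativeOnUniv.smul_const c hσ) u)

theorem sub_apply (D : CovariantDerivative 𝓘(ℝ, E) F V) {σ τ : Π x, V x} {x : M}
    (hσ : DiffSectionAt 𝓘(ℝ, E) F σ x) (hτ : DiffSectionAt 𝓘(ℝ, E) F τ x) (u : Tan E M x) :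
    D (fun y ↦ σ y - τ y) x u = D σ x u - D τ x u := by
  have h1 := D.const_smul_apply (-1) hτ u
  have h2 : D (fun y ↦ σ y + (-1 : ℝ) • τ y) x u = D σ x u + D (fun y ↦ (-1 : ℝ) • τ y) x u :=
    D.add_apply hσ (mdifferentiableAt_const.smul_section hτ) u
  rw [h1] at h2
  simpa only [neg_smul, one_smul, ← sub_eq_add_neg] using h2

theorem smul_apply (D : CovariantDerivative 𝓘(ℝ, E) F V) {f : M → ℝ} {σ : Π x, V x} {x : M}
    (hf : MDifferentiableAt 𝓘(ℝ, E) 𝓘(ℝ, ℝ) f x) (hσ : DiffSectionAt 𝓘(ℝ, E) F σ x)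
    (u : Tan E M x) :
    D (fun y ↦ f y • σ y) x u = f x • D σ x u + (mvfderiv 𝓘(ℝ, E) f x u) • σ x :=
  congr($(D.isCovariantDerivativeOnUniv.leibniz hσ hf) u)

theorem congr_apply (D : CovariantDerivative 𝓘(ℝ, E) F V) {σ τ : Π x, V x} {x : M}
    (hσ : DiffSectionAt 𝓘(ℝ, E) F σ x) (hτ : DiffSectionAt 𝓘(ℝ, E) F τ x)
    (h : ∀ᶠ y in 𝓝 x, σ y = τ y) : D σ x = D τ x :=
  D.isCovariantDerivativeOnUniv.congr_of_eventuallyEq hσ hτ Filter.univ_mem h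

variable [FiniteDimensional ℝ F]

/-- The Leibniz rule `∇_u (A σ) = (∇_u A) σ + A (∇_u σ)`. -/
theorem apply_hom_apply (D : CovariantDerivative 𝓘(ℝ, E) F V)
    (D' : CovariantDerivative 𝓘(ℝ, E) F' V') {A : Π x, HomBundle V V' x} {σ : Π x, V x}
    (hA : SmoothSection 𝓘(ℝ, E) (HomFiber F F') A) (hσ : SmoothSection 𝓘(ℝ, E) F σ)
    (x : M) (u : Tan E M x) :
    D' (fun y ↦ A y (σ y)) x u = (hom D D' A x u : HomBundle V V' x) (σ x) + A x (D σ x u) := by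
  rw [hom_apply D D' (hA.diffSectionAt x) (hσ.diffSectionAt x) u, sub_add_cancel]

theorem IsSmooth.hom {D : CovariantDerivative 𝓘(ℝ, E) F V}
    {D' : CovariantDerivative 𝓘(ℝ, E) F' V'} (hD : D.IsSmooth) (hD' : D'.IsSmooth) :
    (hom D D').IsSmooth := by
  refine isSmooth_of_apply fun A hA U hU ↦ smoothSection_hom fun σ hσ ↦ ?_
  have h := ContMDiff.sub_section (hD'.apply (hA.hom_apply hσ) hU) (hA.hom_apply (hD.apply hσ hU))
  convert h using 3 with y
  exact hom_apply D D' (hA.diffSectionAt y) (hσ.diffSectionAt y) (U y)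

end CovariantDerivative

/-- Every tangent vector extends to a smooth vector field which is parallel at the base point. -/
theorem exists_parallel (D : CovariantDerivative 𝓘(ℝ, E) E (Tan E M)) (x : M) (v : Tan E M x) :
    ∃ X : Π y, Tan E M y, SmoothSection 𝓘(ℝ, E) E X ∧ X x = v ∧ D X x = 0 := by
  obtain ⟨Y, hY, hYx⟩ := exists_smoothSection_eq (E := E) (F := E) v
  obtain ⟨X, ε, hX, hε, hXε⟩ := exists_frame (E := E) x
  -- An arbitrary extension `Y` is corrected by Z = Σ fᵢ Xᵢ with fᵢ(x) = 0 and dfᵢ = εᵢ(∇Y) at x.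
  -- Then Z vanishes at x while ∇Z = ∇Y there, so Y - Z keeps the value and loses the derivative.
  choose f hf hfx hfd using fun i ↦
    exists_smooth_mvfderiv_eq x ((ε i x).toCLM ∘L (D Y x : Tan E M x →L[ℝ] Tan E M x))
  let Z : Π y, Tan E M y := fun y ↦ ∑ i, f i y • X i y
  have hZi (i) : SmoothSection 𝓘(ℝ, E) E (fun y ↦ f i y • X i y) := (hf i).smul_section (hX i)
  have hZ (s : Finset (Fin (Module.finrank ℝ E))) :
      SmoothSection 𝓘(ℝ, E) E (fun y ↦ ∑ i ∈ s, f i y • X i y) := by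
    exact ContMDiff.sum_section fun i _ ↦ hZi i
  have hDZ (s : Finset (Fin (Module.finrank ℝ E))) (u : Tan E M x) :
      D (fun y ↦ ∑ i ∈ s, f i y • X i y) x u = ∑ i ∈ s, (ε i x (D Y x u) : ℝ) • X i x := by
    classical
    induction s using Finset.induction_on with
    | empty =>
      have : D (fun y ↦ 0) x = 0 := congr($(D.zero) x)
      simp [this]
    | insert i s hi ih =>
      simp only [Finset.sum_insert hi]
      rw [D.add_apply ((hZi i).diffSectionAt x) ((hZ s).diffSectionAt x), ih,
        D.smul_apply ((hf i).mdiffAt x) ((hX i).diffSectionAt x), hfx, hfd, zero_smul, zero_add]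
      rfl
  refine ⟨fun y ↦ Y y - Z y, hY.sub_section (hZ _), ?_, ?_⟩
  · simp [Z, hYx, hfx]
  · ext u
    rw [D.sub_apply (hY.diffSectionAt x) ((hZ _).diffSectionAt x), hDZ, hXε.self_of_nhds]
    simp

end SmoothConnections

namespace FedosovStructure

/-! ### Curvature as a tensor and the Ricci identity -/

section Curvature

variable {E : Type*} [NormedAddCommGroup E] [NormedSpace ℝ E] [FiniteDimensional ℝ E]
  {M : Type*} [TopologicalSpace M] [T2Space M] [ChartedSpace E M] [IsManifold 𝓘(ℝ, E) ∞ M] {n : ℕ}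
  {F : Type*} [NormedAddCommGroup F] [NormedSpace ℝ F]
  {V : M → Type*} [TopologicalSpace (TotalSpace F V)]
  [∀ x, AddCommGroup (V x)] [∀ x, Module ℝ (V x)] [∀ x, TopologicalSpace (V x)]
  [∀ x, IsTopologicalAddGroup (V x)] [∀ x, ContinuousSMul ℝ (V x)]
  [FiberBundle F V] [VectorBundle ℝ F V] [ContMDiffVectorBundle ∞ F V 𝓘(ℝ, E)]
  {F' : Type*} [NormedAddCommGroup F'] [NormedSpace ℝ F']
  {V' : M → Type*} [TopologicalSpace (TotalSpace F' V')]
  [∀ x, AddCommGroup (V' x)] [∀ x, Module ℝ (V' x)] [∀ x, TopologicalSpace (V' x)]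
  [∀ x, IsTopologicalAddGroup (V' x)] [∀ x, ContinuousSMul ℝ (V' x)]
  [FiberBundle F' V'] [VectorBundle ℝ F' V'] [ContMDiffVectorBundle ∞ F' V' 𝓘(ℝ, E)]
  (𝓕 : FedosovStructure E M n)

open CovariantDerivative

theorem conn_isSmooth : 𝓕.conn.IsSmooth := by
  intro σ hσ x
  have h := (𝓕.conn_smooth.contMDiff.contMDiff (σ := σ) (by simpa using hσ.contMDiffOn)) x
    (Set.mem_univ _)
  exact contMDiffWithinAt_univ.1 h

theorem mlieBracket_eq {U W : Π x, Tan E M x} (hU : SmoothSection 𝓘(ℝ, E) E U)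
    (hW : SmoothSection 𝓘(ℝ, E) E W) :
    VectorField.mlieBracket 𝓘(ℝ, E) U W = fun y ↦ 𝓕.conn W y (U y) - 𝓕.conn U y (W y) := by
  funext y
  exact ((𝓕.conn.torsion_eq_zero_iff.1 𝓕.torsion_eq_zero) (hU.diffSectionAt y)
    (hW.diffSectionAt y)).symm

theorem smooth_mlieBracket (𝓕 : FedosovStructure E M n)
    {U W : Π x, Tan E M x} (hU : SmoothSection 𝓘(ℝ, E) E U)
    (hW : SmoothSection 𝓘(ℝ, E) E W) :
    SmoothSection 𝓘(ℝ, E) E (VectorField.mlieBracket 𝓘(ℝ, E) U W) := by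
  rw [𝓕.mlieBracket_eq hU hW]
  exact ContMDiff.sub_section (𝓕.conn_isSmooth.apply hW hU) (𝓕.conn_isSmooth.apply hU hW)

open VectorField in
-- Compare the Jacobi identity for U, W, fZ with f times the one for U, W, Z. The terms with one
-- derivative of f cancel, leaving ([U,W]f - UWf + WUf) Z = 0.
theorem mvfderiv_mlieBracket (𝓕 : FedosovStructure E M n)
    {U W : Π x, Tan E M x} (hU : SmoothSection 𝓘(ℝ, E) E U)
    (hW : SmoothSection 𝓘(ℝ, E) E W) {f : M → ℝ} (hf : ContMDiff 𝓘(ℝ, E) 𝓘(ℝ, ℝ) ∞ f) (x : M) :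
    mvfderiv 𝓘(ℝ, E) f x (mlieBracket 𝓘(ℝ, E) U W x) =
      mvfderiv 𝓘(ℝ, E) (fun y ↦ mvfderiv 𝓘(ℝ, E) f y (W y)) x (U x) -
        mvfderiv 𝓘(ℝ, E) (fun y ↦ mvfderiv 𝓘(ℝ, E) f y (U y)) x (W x) := by
  have hUf := hf.mvfderiv_apply hU
  have hWf := hf.mvfderiv_apply hW
  have key : ∀ z : Tan E M x, (mvfderiv 𝓘(ℝ, E) (fun y ↦ mvfderiv 𝓘(ℝ, E) f y (W y)) x (U x) -
      mvfderiv 𝓘(ℝ, E) (fun y ↦ mvfderiv 𝓘(ℝ, E) f y (U y)) x (W x) -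
      mvfderiv 𝓘(ℝ, E) f x (mlieBracket 𝓘(ℝ, E) U W x)) • z = 0 := by
    intro z
    obtain ⟨Z, hZ, hZx⟩ := exists_smoothSection_eq (E := E) (F := E) z
    have hfZ : SmoothSection 𝓘(ℝ, E) E (f • Z) := hf.smul_section hZ
    have e : ∀ {A B : Π x, Tan E M x}, SmoothSection 𝓘(ℝ, E) E A → SmoothSection 𝓘(ℝ, E) E B →
        mlieBracket 𝓘(ℝ, E) A (mlieBracket 𝓘(ℝ, E) B (f • Z)) x =
          (mvfderiv 𝓘(ℝ, E) (fun y ↦ mvfderiv 𝓘(ℝ, E) f y (B y)) x (A x)) • Z x +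
          (mvfderiv 𝓘(ℝ, E) f x (B x)) • mlieBracket 𝓘(ℝ, E) A Z x +
          ((mvfderiv 𝓘(ℝ, E) f x (A x)) • mlieBracket 𝓘(ℝ, E) B Z x +
            f x • mlieBracket 𝓘(ℝ, E) A (mlieBracket 𝓘(ℝ, E) B Z) x) := by
      intro A B hA hB
      have hBf := hf.mvfderiv_apply hB
      have hBZ := 𝓕.smooth_mlieBracket hB hZ
      have h1 : mlieBracket 𝓘(ℝ, E) B (f • Z) =
          (fun y ↦ mvfderiv 𝓘(ℝ, E) f y (B y)) • Z + f • mlieBracket 𝓘(ℝ, E) B Z := by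
        funext y
        exact mlieBracket_smul_right (hf.mdiffAt y) (hZ.diffSectionAt y)
      rw [h1, mlieBracket_add_right
        (SmoothSection.diffSectionAt (hBf.smul_section hZ : SmoothSection 𝓘(ℝ, E) E _) x)
        (SmoothSection.diffSectionAt (hf.smul_section hBZ : SmoothSection 𝓘(ℝ, E) E _) x),
        mlieBracket_smul_right (hBf.mdiffAt x) (hZ.diffSectionAt x),
        mlieBracket_smul_right (hf.mdiffAt x) (hBZ.diffSectionAt x)]
    have jac : ∀ {Y : Π x, Tan E M x}, SmoothSection 𝓘(ℝ, E) E Y →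
        mlieBracket 𝓘(ℝ, E) U (mlieBracket 𝓘(ℝ, E) W Y) x =
          mlieBracket 𝓘(ℝ, E) (mlieBracket 𝓘(ℝ, E) U W) Y x +
            mlieBracket 𝓘(ℝ, E) W (mlieBracket 𝓘(ℝ, E) U Y) x := by
      intro Y hY
      have : IsManifold 𝓘(ℝ, E) (minSmoothness ℝ 3) M := by
        rw [minSmoothness_of_isRCLikeNormedField]
        infer_instance
      have h2 : (2 : WithTop ℕ∞) ≤ ∞ := ENat.LEInfty.out
      refine leibniz_identity_mlieBracket_apply ?_ ?_ ?_
      · exact (hU x).of_le (by simpa using h2)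
      · exact (hW x).of_le (by simpa using h2)
      · exact (hY x).of_le (by simpa using h2)
    have j1 := jac hZ
    have j2 := jac hfZ
    rw [e hU hW, e hW hU, mlieBracket_smul_right (hf.mdiffAt x) (hZ.diffSectionAt x), j1] at j2
    rw [← hZx]
    rw [← sub_eq_zero] at j2
    rw [← j2]
    module
  -- A nonzero tangent vector is needed to cancel Z; if there is none, every derivative at x is
  -- zero.
  by_cases hsub : ∃ z : Tan E M x, z ≠ 0
  · obtain ⟨z, hz⟩ := hsub
    have := (smul_eq_zero.1 (key z)).resolve_right hz
    linarith
  · push Not at hsub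
    rw [hsub (U x), hsub (W x), hsub (mlieBracket 𝓘(ℝ, E) U W x)]
    simp

theorem secondDeriv_apply {D : CovariantDerivative 𝓘(ℝ, E) F V} (hD : D.IsSmooth)
    {σ : Π x, V x} (hσ : SmoothSection 𝓘(ℝ, E) F σ) {W : Π x, Tan E M x}
    (hW : SmoothSection 𝓘(ℝ, E) E W) (x : M) (u : Tan E M x) :
    𝓕.secondDeriv D σ x u (W x) = D (fun y ↦ D σ y (W y)) x u - D σ x (𝓕.conn W x u) :=
  hom_apply 𝓕.conn D ((hD σ hσ).diffSectionAt x) (hW.diffSectionAt x) u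

theorem secondDeriv_apply_parallel {D : CovariantDerivative 𝓘(ℝ, E) F V} (hD : D.IsSmooth)
    {σ : Π x, V x} (hσ : SmoothSection 𝓘(ℝ, E) F σ) {W : Π x, Tan E M x}
    (hW : SmoothSection 𝓘(ℝ, E) E W) {x : M} (hWx : 𝓕.conn W x = 0) (u : Tan E M x) :
    𝓕.secondDeriv D σ x u (W x) = D (fun y ↦ D σ y (W y)) x u := by
  rw [𝓕.secondDeriv_apply hD hσ hW, hWx]
  simp

/-- Torsion-freeness makes the two correction terms combine to the derivative of f along [U,W],
which cancels UWf - WUf. -/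
theorem curv_trivialLine {f : M → ℝ} (hf : ContMDiff 𝓘(ℝ, E) 𝓘(ℝ, ℝ) ∞ f) (x : M)
    (u v : Tan E M x) : 𝓕.curv (trivialLine 𝓘(ℝ, E) M) f x u v = 0 := by
  obtain ⟨U, hU, rfl⟩ := exists_smoothSection_eq (E := E) (F := E) u
  obtain ⟨W, hW, rfl⟩ := exists_smoothSection_eq (E := E) (F := E) v
  have hf' : SmoothSection 𝓘(ℝ, E) ℝ (V := Line M) f := smoothSection_line_iff.2 hf
  rw [curv, 𝓕.secondDeriv_apply isSmooth_trivialLine hf' hU,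
    𝓕.secondDeriv_apply isSmooth_trivialLine hf' hW]
  have h := 𝓕.mvfderiv_mlieBracket hU hW hf x
  rw [𝓕.mlieBracket_eq hU hW, map_sub] at h
  change (mvfderiv 𝓘(ℝ, E) (fun y ↦ mvfderiv 𝓘(ℝ, E) f y (W y)) x (U x) -
    mvfderiv 𝓘(ℝ, E) f x (𝓕.conn W x (U x))) -
    (mvfderiv 𝓘(ℝ, E) (fun y ↦ mvfderiv 𝓘(ℝ, E) f y (U y)) x (W x) -
    mvfderiv 𝓘(ℝ, E) f x (𝓕.conn U x (W x))) = (0 : ℝ)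
  linarith

/-- The bracket is ∇_U W - ∇_W U, which vanishes at x for fields parallel there. -/
theorem mvfderiv_comm (𝓕 : FedosovStructure E M n)
    {f : M → ℝ} (hf : ContMDiff 𝓘(ℝ, E) 𝓘(ℝ, ℝ) ∞ f) {U W : Π x, Tan E M x}
    (hU : SmoothSection 𝓘(ℝ, E) E U) (hW : SmoothSection 𝓘(ℝ, E) E W) {x : M}
    (hUx : 𝓕.conn U x = 0) (hWx : 𝓕.conn W x = 0) :
    mvfderiv 𝓘(ℝ, E) (fun y ↦ mvfderiv 𝓘(ℝ, E) f y (W y)) x (U x) =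
      mvfderiv 𝓘(ℝ, E) (fun y ↦ mvfderiv 𝓘(ℝ, E) f y (U y)) x (W x) := by
  have h := 𝓕.mvfderiv_mlieBracket hU hW hf x
  rw [𝓕.mlieBracket_eq hU hW] at h
  simp only [hUx, hWx, zero_apply, sub_self, map_zero] at h
  exact (sub_eq_zero.1 h.symm)

theorem curv_parallel {D : CovariantDerivative 𝓘(ℝ, E) F V} (hD : D.IsSmooth)
    {σ : Π x, V x} (hσ : SmoothSection 𝓘(ℝ, E) F σ) {U W : Π x, Tan E M x}
    (hU : SmoothSection 𝓘(ℝ, E) E U) (hW : SmoothSection 𝓘(ℝ, E) E W) {x : M}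
    (hUx : 𝓕.conn U x = 0) (hWx : 𝓕.conn W x = 0) :
    𝓕.curv D σ x (U x) (W x) =
      D (fun y ↦ D σ y (W y)) x (U x) - D (fun y ↦ D σ y (U y)) x (W x) := by
  rw [curv, 𝓕.secondDeriv_apply_parallel hD hσ hU hUx,
    𝓕.secondDeriv_apply_parallel hD hσ hW hWx]

theorem curv_add {D : CovariantDerivative 𝓘(ℝ, E) F V} (hD : D.IsSmooth)
    {σ τ : Π x, V x} (hσ : SmoothSection 𝓘(ℝ, E) F σ) (hτ : SmoothSection 𝓘(ℝ, E) F τ)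
    (x : M) (u v : Tan E M x) :
    𝓕.curv D (fun y ↦ σ y + τ y) x u v = 𝓕.curv D σ x u v + 𝓕.curv D τ x u v := by
  obtain ⟨U, hU, rfl, hUx⟩ := exists_parallel 𝓕.conn x u
  obtain ⟨W, hW, rfl, hWx⟩ := exists_parallel 𝓕.conn x v
  rw [𝓕.curv_parallel hD hσ hU hW hUx hWx, 𝓕.curv_parallel hD hτ hU hW hUx hWx,
    𝓕.curv_parallel hD (hσ.add hτ) hU hW hUx hWx]
  have e {A : Π x, Tan E M x} (hA : SmoothSection 𝓘(ℝ, E) E A) (u : Tan E M x) :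
      D (fun y ↦ D (fun z ↦ σ z + τ z) y (A y)) x u =
        D (fun y ↦ D σ y (A y)) x u + D (fun y ↦ D τ y (A y)) x u := by
    rw [← D.add_apply ((hD.apply hσ hA).diffSectionAt x) ((hD.apply hτ hA).diffSectionAt x)]
    congr 3
    funext y
    exact D.add_apply (hσ.diffSectionAt y) (hτ.diffSectionAt y) (A y)
  rw [e hU, e hW]
  abel

/-- The mixed terms df ⊗ Dσ and the Hessian of f are symmetric in the two directions, so alternation
removes them. This is the tensoriality of curvature. -/
theorem curv_smul {D : CovariantDerivative 𝓘(ℝ, E) F V} (hD : D.IsSmooth)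
    {f : M → ℝ} (hf : ContMDiff 𝓘(ℝ, E) 𝓘(ℝ, ℝ) ∞ f)
    {σ : Π x, V x} (hσ : SmoothSection 𝓘(ℝ, E) F σ) (x : M) (u v : Tan E M x) :
    𝓕.curv D (fun y ↦ f y • σ y) x u v = f x • 𝓕.curv D σ x u v := by
  obtain ⟨U, hU, rfl, hUx⟩ := exists_parallel 𝓕.conn x u
  obtain ⟨W, hW, rfl, hWx⟩ := exists_parallel 𝓕.conn x v
  rw [𝓕.curv_parallel hD hσ hU hW hUx hWx,
    𝓕.curv_parallel hD (.smul hf hσ) hU hW hUx hWx]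
  have e {A : Π x, Tan E M x} (hA : SmoothSection 𝓘(ℝ, E) E A) (u : Tan E M x) :
      D (fun y ↦ D (fun z ↦ f z • σ z) y (A y)) x u =
        (f x • D (fun y ↦ D σ y (A y)) x u + mvfderiv 𝓘(ℝ, E) f x u • D σ x (A x)) +
        (mvfderiv 𝓘(ℝ, E) f x (A x) • D σ x u +
          mvfderiv 𝓘(ℝ, E) (fun y ↦ mvfderiv 𝓘(ℝ, E) f y (A y)) x u • σ x) := by
    have h1 := hD.apply hσ hA
    have h2 := hf.mvfderiv_apply hA
    rw [← D.smul_apply (hf.mdiffAt x) (h1.diffSectionAt x),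
      ← D.smul_apply (h2.mdiffAt x) (hσ.diffSectionAt x),
      ← D.add_apply
        ((SmoothSection.smul hf h1).diffSectionAt x) ((SmoothSection.smul h2 hσ).diffSectionAt x)]
    congr 3
    funext y
    exact D.smul_apply (hf.mdiffAt y) (hσ.diffSectionAt y) (A y)
  rw [e hU, e hW, 𝓕.mvfderiv_comm hf hU hW hUx hWx]
  module

theorem curv_congr {D : CovariantDerivative 𝓘(ℝ, E) F V} (hD : D.IsSmooth)
    {σ τ : Π x, V x} (hσ : SmoothSection 𝓘(ℝ, E) F σ) (hτ : SmoothSection 𝓘(ℝ, E) F τ)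
    {x : M} (h : ∀ᶠ y in 𝓝 x, σ y = τ y) (u v : Tan E M x) :
    𝓕.curv D σ x u v = 𝓕.curv D τ x u v := by
  have key : (𝓕.conn.hom D) (derivSection D σ) x = (𝓕.conn.hom D) (derivSection D τ) x := by
    refine (𝓕.conn.hom D).congr_apply ((hD σ hσ).diffSectionAt x) ((hD τ hτ).diffSectionAt x) ?_
    filter_upwards [h.eventually_nhds] with y hy
    exact D.congr_apply (hσ.diffSectionAt y) (hτ.diffSectionAt y) hy
  rw [curv, secondDeriv, secondDeriv, key]
  rfl

/-- Expanding in a local frame, linearity over functions and locality show that the curvature sees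
only the value of the field at x. -/
theorem curv_conn_eq_of_eq {W Z : Π x, Tan E M x} (hW : SmoothSection 𝓘(ℝ, E) E W)
    (hZ : SmoothSection 𝓘(ℝ, E) E Z) {x : M} (h : W x = Z x) (u v : Tan E M x) :
    𝓕.curv 𝓕.conn W x u v = 𝓕.curv 𝓕.conn Z x u v := by
  obtain ⟨X, ε, hX, hε, hXε⟩ := exists_frame (E := E) x
  suffices key : ∀ {W : Π x, Tan E M x}, SmoothSection 𝓘(ℝ, E) E W →
      𝓕.curv 𝓕.conn W x u v = ∑ i, (ε i x (W x) : ℝ) • 𝓕.curv 𝓕.conn (X i) x u v by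
    rw [key hW, key hZ, h]
  intro W hW
  have hf (i) : ContMDiff 𝓘(ℝ, E) 𝓘(ℝ, ℝ) ∞ (fun y ↦ (ε i y (W y) : ℝ)) :=
    smoothSection_line_iff.1 ((hε i).hom_apply hW)
  have hi (i) : SmoothSection 𝓘(ℝ, E) E (fun y ↦ (ε i y (W y) : ℝ) • X i y) :=
    (hf i).smul_section (hX i)
  have hs (s : Finset (Fin (Module.finrank ℝ E))) :
      SmoothSection 𝓘(ℝ, E) E (fun y ↦ ∑ i ∈ s, (ε i y (W y) : ℝ) • X i y) :=
    ContMDiff.sum_section fun i _ ↦ hi i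
  have h1 (s : Finset (Fin (Module.finrank ℝ E))) :
      𝓕.curv 𝓕.conn (fun y ↦ ∑ i ∈ s, (ε i y (W y) : ℝ) • X i y) x u v =
        ∑ i ∈ s, (ε i x (W x) : ℝ) • 𝓕.curv 𝓕.conn (X i) x u v := by
    classical
    induction s using Finset.induction_on with
    | empty =>
      have h0 := 𝓕.curv_smul 𝓕.conn_isSmooth (f := fun _ ↦ 0) contMDiff_const hW x u v
      simpa using h0
    | insert i s his ih =>
      simp only [Finset.sum_insert his]
      rw [𝓕.curv_add 𝓕.conn_isSmooth (hi i) (hs s), ih,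
        𝓕.curv_smul 𝓕.conn_isSmooth (hf i) (hX i)]
  rw [← h1]
  refine 𝓕.curv_congr 𝓕.conn_isSmooth hW (hs _) ?_ u v
  filter_upwards [hXε] with y hy
  exact (hy _).symm

/-- `R` is defined through `FiberBundle.extend`, which is known to be smooth only near the point. A
global section with the same germ has the same curvature, and then only its value at the point
matters. -/
theorem R_apply_section {W : Π x, Tan E M x} (hW : SmoothSection 𝓘(ℝ, E) E W) (x : M)
    (u v : Tan E M x) : 𝓕.R x u v (W x) = 𝓕.curv 𝓕.conn W x u v := by
  obtain ⟨s, hs, h⟩ := contMDiffOn_extend (W x)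
  obtain ⟨Z, hZ, hZe⟩ := exists_smoothSection_eventuallyEq hs h
  have h1 : 𝓕.curv 𝓕.conn (FiberBundle.extend E (W x)) x u v = 𝓕.curv 𝓕.conn Z x u v := by
    have key : (𝓕.conn.hom 𝓕.conn) (derivSection 𝓕.conn (FiberBundle.extend E (W x))) x =
        (𝓕.conn.hom 𝓕.conn) (derivSection 𝓕.conn Z) x := by
      refine (𝓕.conn.hom 𝓕.conn).congr_apply (𝓕.diffSectionAt_conn hs h)
        ((𝓕.conn_isSmooth Z hZ).diffSectionAt x) ?_
      filter_upwards [hZe.eventually_nhds, eventually_mem_nhds_iff.2 hs] with y hy hys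
      exact 𝓕.conn.congr_apply
        (((h y (mem_of_mem_nhds hys)).contMDiffAt hys).mdifferentiableAt (by simp))
        (hZ.diffSectionAt y) (by filter_upwards [hy] with z hz using hz.symm)
    rw [curv, secondDeriv, secondDeriv, key]
    rfl
  rw [R_apply, h1]
  refine 𝓕.curv_conn_eq_of_eq hZ hW ?_ u v
  rw [hZe.self_of_nhds]
  simp

theorem smooth_secondDeriv {D : CovariantDerivative 𝓘(ℝ, E) F V} (hD : D.IsSmooth)
    {σ : Π x, V x} (hσ : SmoothSection 𝓘(ℝ, E) F σ) {U W : Π x, Tan E M x}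
    (hU : SmoothSection 𝓘(ℝ, E) E U) (hW : SmoothSection 𝓘(ℝ, E) E W) :
    SmoothSection 𝓘(ℝ, E) F (fun y ↦ 𝓕.secondDeriv D σ y (U y) (W y)) :=
  SmoothSection.hom_apply ((𝓕.conn_isSmooth.hom hD).apply (hD σ hσ) hU) hW

theorem smooth_R : SmoothSection 𝓘(ℝ, E)
    (HomFiber E (HomFiber E (HomFiber E E))) 𝓕.R := by
  refine smoothSection_hom fun U hU ↦ smoothSection_hom fun W hW ↦ smoothSection_hom fun Z hZ ↦ ?_
  simp only [𝓕.R_apply_section hZ]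
  exact ContMDiff.sub_section (𝓕.smooth_secondDeriv 𝓕.conn_isSmooth hZ hU hW)
    (𝓕.smooth_secondDeriv 𝓕.conn_isSmooth hZ hW hU)

/-- The Ricci identity for a section of a bundle of homomorphisms. -/
theorem curv_hom_apply [FiniteDimensional ℝ F] {D : CovariantDerivative 𝓘(ℝ, E) F V}
    (hD : D.IsSmooth) {D' : CovariantDerivative 𝓘(ℝ, E) F' V'} (hD' : D'.IsSmooth)
    {A : Π x, HomBundle V V' x} (hA : SmoothSection 𝓘(ℝ, E) (HomFiber F F') A)
    {σ : Π x, V x} (hσ : SmoothSection 𝓘(ℝ, E) F σ) (x : M) (u v : Tan E M x) :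
    (𝓕.curv (D.hom D') A x u v : HomBundle V V' x) (σ x) =
      𝓕.curv D' (fun y ↦ A y (σ y)) x u v - A x (𝓕.curv D σ x u v) := by
  obtain ⟨U, hU, rfl, hUx⟩ := exists_parallel 𝓕.conn x u
  obtain ⟨W, hW, rfl, hWx⟩ := exists_parallel 𝓕.conn x v
  have hH := hD.hom hD'
  rw [𝓕.curv_parallel hH hA hU hW hUx hWx, 𝓕.curv_parallel hD hσ hU hW hUx hWx,
    𝓕.curv_parallel hD' (hA.hom_apply hσ) hU hW hUx hWx]
  -- Leibniz applied twice. The two middle terms are exchanged when P and Q are swapped, so they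
  -- drop out of the commutator.
  have e {P Q : Π x, Tan E M x} (hP : SmoothSection 𝓘(ℝ, E) E P)
      (hQ : SmoothSection 𝓘(ℝ, E) E Q) :
      D' (fun y ↦ D' (fun z ↦ A z (σ z)) y (Q y)) x (P x) =
        ((D.hom D') (fun y ↦ (D.hom D') A y (Q y)) x (P x) : HomBundle V V' x) (σ x) +
          ((D.hom D') A x (Q x) : HomBundle V V' x) (D σ x (P x)) +
          (((D.hom D') A x (P x) : HomBundle V V' x) (D σ x (Q x)) +
            A x (D (fun y ↦ D σ y (Q y)) x (P x))) := by
    have h1 := hH.apply hA hQ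
    have h2 := hD.apply hσ hQ
    rw [← apply_hom_apply D D' h1 hσ, ← apply_hom_apply D D' hA h2,
      ← D'.add_apply ((h1.hom_apply hσ).diffSectionAt x) ((hA.hom_apply h2).diffSectionAt x)]
    congr 3
    funext y
    exact apply_hom_apply D D' hA hσ y (Q y)
  rw [e hU hW, e hW hU, map_sub, HomBundle.sub_apply]
  abel

end Curvature

end FedosovStructure

/-! ### Traces of adjoint endomorphisms -/

section TraceAdjoint

variable {W : Type*} [AddCommGroup W] [Module ℝ W] [FiniteDimensional ℝ W]

/-- The form identifies W with its dual and carries `L'` to the transpose of `L`; conjugation and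
transposition preserve traces. -/
theorem trace_eq_of_adjoint {B : W →ₗ[ℝ] Module.Dual ℝ W} (hB : Function.Injective B)
    {L L' : W →ₗ[ℝ] W} (h : ∀ a b, B (L' a) b = B a (L b)) :
    LinearMap.trace ℝ W L' = LinearMap.trace ℝ W L := by
  let e : W ≃ₗ[ℝ] Module.Dual ℝ W :=
    LinearMap.linearEquivOfInjective B hB Subspace.dual_finrank_eq.symm
  have h1 : e.conj L' = Module.Dual.transpose (R := ℝ) L := by
    ext φ b
    obtain ⟨a, rfl⟩ := e.surjective φ
    simp only [LinearEquiv.conj_apply, LinearMap.comp_apply, LinearEquiv.coe_coe,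
      LinearEquiv.symm_apply_apply, Module.Dual.transpose_apply]
    exact h a b
  rw [← LinearMap.trace_conj' L' e, h1, LinearMap.trace_transpose']

end TraceAdjoint

namespace FedosovStructure

/-! ### Symmetries of the curvature and the Bianchi identities -/

section Bianchi

variable {E : Type*} [NormedAddCommGroup E] [NormedSpace ℝ E] [FiniteDimensional ℝ E]
  {M : Type*} [TopologicalSpace M] [T2Space M] [ChartedSpace E M] [IsManifold 𝓘(ℝ, E) ∞ M] {n : ℕ}
  {F' : Type*} [NormedAddCommGroup F'] [NormedSpace ℝ F']
  {V' : M → Type*} [TopologicalSpace (TotalSpace F' V')]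
  [∀ x, AddCommGroup (V' x)] [∀ x, Module ℝ (V' x)] [∀ x, TopologicalSpace (V' x)]
  [∀ x, IsTopologicalAddGroup (V' x)] [∀ x, ContinuousSMul ℝ (V' x)]
  [FiberBundle F' V'] [VectorBundle ℝ F' V'] [ContMDiffVectorBundle ∞ F' V' 𝓘(ℝ, E)]
  (𝓕 : FedosovStructure E M n)

open CovariantDerivative

theorem cotanConn_isSmooth : 𝓕.cotanConn.IsSmooth := 𝓕.conn_isSmooth.hom isSmooth_trivialLine

/-- On a field which is parallel at `x`, the derivative of a section of a bundle of homomorphisms is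
computed by differentiating its value. -/
theorem hom_apply_parallel (D' : CovariantDerivative 𝓘(ℝ, E) F' V')
    {A : Π x, HomBundle (Tan E M) V' x} (hA : SmoothSection 𝓘(ℝ, E) (HomFiber E F') A)
    {W : Π x, Tan E M x} (hW : SmoothSection 𝓘(ℝ, E) E W) {x : M} (hWx : 𝓕.conn W x = 0)
    (u : Tan E M x) :
    (𝓕.conn.hom D' A x u : HomBundle (Tan E M) V' x) (W x) = D' (fun y ↦ A y (W y)) x u := by
  rw [apply_hom_apply 𝓕.conn D' hA hW, hWx]
  simp

theorem derivSection_apply_parallel (D' : CovariantDerivative 𝓘(ℝ, E) F' V')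
    {A : Π x, HomBundle (Tan E M) V' x} (hA : SmoothSection 𝓘(ℝ, E) (HomFiber E F') A)
    {W : Π x, Tan E M x} (hW : SmoothSection 𝓘(ℝ, E) E W) {x : M} (hWx : 𝓕.conn W x = 0)
    (u : Tan E M x) :
    derivSection (𝓕.conn.hom D') A x u (W x) = D' (fun y ↦ A y (W y)) x u :=
  𝓕.hom_apply_parallel D' hA hW hWx u

/-- Ricci identity for Hom(TM, ℝ): the trivial line is flat, so only the curvature of the source
contributes. -/
theorem curv_cotanConn {μ : Π x, Cotan E M x} (hμ : SmoothSection 𝓘(ℝ, E) (HomFiber E ℝ) μ)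
    (x : M) (u v w : Tan E M x) :
    (𝓕.curv 𝓕.cotanConn μ x u v : Cotan E M x) w = -(μ x (𝓕.R x u v w) : ℝ) := by
  obtain ⟨W, hW, rfl⟩ := exists_smoothSection_eq (E := E) (F := E) w
  have h := 𝓕.curv_hom_apply 𝓕.conn_isSmooth isSmooth_trivialLine hμ hW x u v
  rw [𝓕.curv_trivialLine (smoothSection_line_iff.1 (hμ.hom_apply hW)),
    ← 𝓕.R_apply_section hW] at h
  exact h.trans (zero_sub _)

theorem curv_form (x : M) (u v : Tan E M x) :
    𝓕.curv (𝓕.conn.hom 𝓕.cotanConn) 𝓕.form x u v = 0 := by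
  have h : derivSection (𝓕.conn.hom 𝓕.cotanConn) 𝓕.form = 0 := 𝓕.parallel
  have h' : (𝓕.conn.hom (𝓕.conn.hom 𝓕.cotanConn))
      (derivSection (𝓕.conn.hom 𝓕.cotanConn) 𝓕.form) x = 0 := by
    rw [h, CovariantDerivative.zero]
    rfl
  rw [curv, secondDeriv, secondDeriv, h']
  exact sub_self _

/-- The Ricci identity for J, whose left side vanishes since ∇J = 0. Thus each R(u,v) lies in the
symplectic Lie algebra of J. -/
theorem form_R (x : M) (u v w z : Tan E M x) :
    (𝓕.form x (𝓕.R x u v w) z : ℝ) = -(𝓕.form x w (𝓕.R x u v z) : ℝ) := by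
  obtain ⟨W, hW, rfl⟩ := exists_smoothSection_eq (E := E) (F := E) w
  have h := 𝓕.curv_hom_apply 𝓕.conn_isSmooth 𝓕.cotanConn_isSmooth 𝓕.smooth hW x u v
  rw [𝓕.curv_form, ← 𝓕.R_apply_section hW] at h
  have h2 := congr($h z)
  rw [HomBundle.sub_apply, 𝓕.curv_cotanConn (𝓕.smooth.hom_apply hW)] at h2
  exact (sub_eq_zero.1 h2.symm).symm

theorem form_left_cancel {x : M} {a b : Tan E M x}
    (h : ∀ z, (𝓕.form x z a : ℝ) = 𝓕.form x z b) : a = b := by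
  rw [← sub_eq_zero]
  refine 𝓕.nondegenerate x _ fun z ↦ ?_
  rw [𝓕.skew, map_sub, h z]
  simp

theorem hessian_symm {f : M → ℝ} (hf : ContMDiff 𝓘(ℝ, E) 𝓘(ℝ, ℝ) ∞ f) (x : M)
    (u v : Tan E M x) :
    (𝓕.cotanConn (derivSection (trivialLine 𝓘(ℝ, E) M) f) x u : Cotan E M x) v =
      (𝓕.cotanConn (derivSection (trivialLine 𝓘(ℝ, E) M) f) x v : Cotan E M x) u :=
  sub_eq_zero.1 (𝓕.curv_trivialLine hf x u v)

/-- Choose f with df = J(z,·) at x. The Hessian of f is symmetric everywhere, so ∇∇df is symmetric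
in its last two arguments, and alternating its first two gives -df∘R. The cyclic sum therefore
telescopes to zero, and nondegeneracy removes z. -/
theorem bianchi_first (x : M) (u v w : Tan E M x) :
    𝓕.R x u v w + 𝓕.R x v w u + 𝓕.R x w u v = 0 := by
  refine 𝓕.form_left_cancel fun z ↦ ?_
  obtain ⟨f, hf, -, hfx⟩ := exists_smooth_mvfderiv_eq x (𝓕.form x z).toCLM
  have hμ : SmoothSection 𝓘(ℝ, E) (HomFiber E ℝ) (derivSection (trivialLine 𝓘(ℝ, E) M) f) :=
    isSmooth_trivialLine _ (smoothSection_line_iff.2 hf)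
  set μ := derivSection (trivialLine 𝓘(ℝ, E) M) f with hμ_def
  have hμx : μ x = 𝓕.form x z := hfx
  have sym (u v w : Tan E M x) : (𝓕.secondDeriv 𝓕.cotanConn μ x u v : Cotan E M x) w =
      (𝓕.secondDeriv 𝓕.cotanConn μ x u w : Cotan E M x) v := by
    obtain ⟨V, hV, rfl, hVx⟩ := exists_parallel 𝓕.conn x v
    obtain ⟨W, hW, rfl, hWx⟩ := exists_parallel 𝓕.conn x w
    rw [𝓕.secondDeriv_apply_parallel 𝓕.cotanConn_isSmooth hμ hV hVx,
      𝓕.secondDeriv_apply_parallel 𝓕.cotanConn_isSmooth hμ hW hWx,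
      𝓕.hom_apply_parallel _ (𝓕.cotanConn_isSmooth.apply hμ hV) hW hWx,
      𝓕.hom_apply_parallel _ (𝓕.cotanConn_isSmooth.apply hμ hW) hV hVx]
    congr 3
    funext y
    exact 𝓕.hessian_symm hf y (V y) (W y)
  have ric (u v w : Tan E M x) : (𝓕.secondDeriv 𝓕.cotanConn μ x u v : Cotan E M x) w -
      (𝓕.secondDeriv 𝓕.cotanConn μ x v u : Cotan E M x) w = -(μ x (𝓕.R x u v w) : ℝ) := by
    rw [← 𝓕.curv_cotanConn hμ]
    rfl
  have h1 := ric u v w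
  have h2 := ric v w u
  have h3 := ric w u v
  rw [hμx] at h1 h2 h3
  have s1 := sym u v w
  have s2 := sym v w u
  have s3 := sym w u v
  rw [map_add, map_add, map_zero]
  change (_ + _ + _ : ℝ) = 0
  change (_ - _ : ℝ) = _ at h1 h2 h3
  linarith

/-- `∇_e R_{ab}{}^c{}_d`, the index `e` being the first argument. -/
def gradR (x : M) : HomBundle (Tan E M)
    (HomBundle (Tan E M) (HomBundle (Tan E M) (HomBundle (Tan E M) (Tan E M)))) x :=
  derivSection (𝓕.conn.hom (𝓕.conn.hom (𝓕.conn.hom 𝓕.conn))) 𝓕.R x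

/-- Take Z parallel at x. Then ∇R applied to Z is the alternation of ∇³Z in its last two arguments,
while alternation in the first two is curvature acting on ∇Z, which vanishes at x. The cyclic sum
cancels in pairs. -/
theorem bianchi_second (x : M) (u v w z : Tan E M x) :
    𝓕.gradR x u v w z + 𝓕.gradR x v w u z + 𝓕.gradR x w u v z = 0 := by
  obtain ⟨U, hU, rfl, hUx⟩ := exists_parallel 𝓕.conn x u
  obtain ⟨V, hV, rfl, hVx⟩ := exists_parallel 𝓕.conn x v
  obtain ⟨W, hW, rfl, hWx⟩ := exists_parallel 𝓕.conn x w
  obtain ⟨Z, hZ, rfl, hZx⟩ := exists_parallel 𝓕.conn x z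
  have hc := 𝓕.conn_isSmooth
  have hZ' := hc Z hZ
  have third {P Q : Π x, Tan E M x} (hP : SmoothSection 𝓘(ℝ, E) E P)
      (hQ : SmoothSection 𝓘(ℝ, E) E Q) (hPx : 𝓕.conn P x = 0) (hQx : 𝓕.conn Q x = 0)
      (u : Tan E M x) : 𝓕.conn (fun y ↦ 𝓕.secondDeriv 𝓕.conn Z y (P y) (Q y)) x u =
        (𝓕.secondDeriv (𝓕.conn.hom 𝓕.conn) (derivSection 𝓕.conn Z) x u (P x) :
          HomBundle (Tan E M) (Tan E M) x) (Q x) := by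
    rw [𝓕.secondDeriv_apply_parallel (hc.hom hc) hZ' hP hPx,
      𝓕.hom_apply_parallel _ ((hc.hom hc).apply hZ' hP) hQ hQx]
    rfl
  have grad {P Q : Π x, Tan E M x} (hP : SmoothSection 𝓘(ℝ, E) E P)
      (hQ : SmoothSection 𝓘(ℝ, E) E Q) (hPx : 𝓕.conn P x = 0) (hQx : 𝓕.conn Q x = 0)
      (u : Tan E M x) : 𝓕.gradR x u (P x) (Q x) (Z x) =
        (𝓕.secondDeriv (𝓕.conn.hom 𝓕.conn) (derivSection 𝓕.conn Z) x u (P x) :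
          HomBundle (Tan E M) (Tan E M) x) (Q x) -
        (𝓕.secondDeriv (𝓕.conn.hom 𝓕.conn) (derivSection 𝓕.conn Z) x u (Q x) :
          HomBundle (Tan E M) (Tan E M) x) (P x) := by
    have h1 := 𝓕.smooth_R
    have h2 := h1.hom_apply hP
    have h3 := h2.hom_apply hQ
    rw [gradR, 𝓕.derivSection_apply_parallel _ h1 hP hPx, 𝓕.hom_apply_parallel _ h2 hQ hQx,
      𝓕.hom_apply_parallel _ h3 hZ hZx]
    simp only [𝓕.R_apply_section hZ]
    rw [← third hP hQ hPx hQx, ← third hQ hP hQx hPx, ← 𝓕.conn.sub_apply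
      ((𝓕.smooth_secondDeriv hc hZ hP hQ).diffSectionAt x)
      ((𝓕.smooth_secondDeriv hc hZ hQ hP).diffSectionAt x)]
    rfl
  have ric {Q : Π x, Tan E M x} (hQ : SmoothSection 𝓘(ℝ, E) E Q) (u v : Tan E M x) :
      (𝓕.secondDeriv (𝓕.conn.hom 𝓕.conn) (derivSection 𝓕.conn Z) x u v :
          HomBundle (Tan E M) (Tan E M) x) (Q x) -
        (𝓕.secondDeriv (𝓕.conn.hom 𝓕.conn) (derivSection 𝓕.conn Z) x v u :
          HomBundle (Tan E M) (Tan E M) x) (Q x) = 0 := by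
    have h := 𝓕.curv_hom_apply hc hc hZ' hQ x u v
    rw [← 𝓕.R_apply_section (hZ'.hom_apply hQ)] at h
    simp only [derivSection, hZx] at h
    refine h.trans ?_
    change 𝓕.R x u v 0 - 0 = 0
    rw [map_zero, sub_zero]
  rw [grad hV hW hVx hWx, grad hW hU hWx hUx, grad hU hV hUx hVx]
  have h1 := ric hW (U x) (V x)
  have h2 := ric hU (V x) (W x)
  have h3 := ric hV (W x) (U x)
  rw [sub_eq_zero] at h1 h2 h3
  rw [h1, h2, h3]
  abel

/-- The symplectic form at a point, as a map to the algebraic dual. -/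
def formDual (x : M) : Tan E M x →ₗ[ℝ] Module.Dual ℝ (Tan E M x) where
  toFun u := (𝓕.form x u).toLinear
  map_add' u v := by ext; simp
  map_smul' c u := by ext; simp

theorem formDual_injective (x : M) : Function.Injective (𝓕.formDual x) :=
  (injective_iff_map_eq_zero _).2 fun u hu ↦ 𝓕.nondegenerate x u fun v ↦ congr($hu v)

theorem R_skew (x : M) (u v w : Tan E M x) : 𝓕.R x u v w = -𝓕.R x v u w := by
  rw [R_apply, R_apply, curv, curv]
  abel

/-- R(u,v) is skew-adjoint for J, so its trace equals its own negative. -/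
theorem trace_R (x : M) (u v : Tan E M x) :
    LinearMap.trace ℝ (Tan E M x) (𝓕.R x u v).toLinear = 0 := by
  have h := trace_eq_of_adjoint (𝓕.formDual_injective x) (L := (𝓕.R x u v).toLinear)
    (L' := -(𝓕.R x u v).toLinear) fun a b ↦ by
      rw [LinearMap.neg_apply, map_neg, LinearMap.neg_apply, neg_eq_iff_eq_neg]
      exact 𝓕.form_R x u v a b
  rw [map_neg] at h
  linarith

/-- By the first Bianchi identity R(u,v)w - R(u,w)v = -R(v,w)u. Taking the trace over u, the right
side vanishes by `trace_R`. -/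
theorem Phi_symm (x : M) (v w : Tan E M x) : (𝓕.Phi x v w : ℝ) = 𝓕.Phi x w v := by
  have h : firstSlot (𝓕.R x) v w - firstSlot (𝓕.R x) w v = -(𝓕.R x v w).toLinear := by
    ext u
    change 𝓕.R x u v w - 𝓕.R x u w v = -𝓕.R x v w u
    rw [𝓕.R_skew x u w v, eq_neg_iff_add_eq_zero, ← 𝓕.bianchi_first x u v w]
    abel
  have h' := congr(LinearMap.trace ℝ (Tan E M x) $h)
  rw [map_sub, map_neg, 𝓕.trace_R, neg_zero, sub_eq_zero] at h'
  rw [Phi_apply, Phi_apply, h']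

end Bianchi

end FedosovStructure

/-! ### Traces in a frame and finite sums of sections -/

theorem trace_eq_sum_frame {W ι : Type*} [AddCommGroup W] [Module ℝ W] [FiniteDimensional ℝ W]
    [Fintype ι] {φ : ι → W →ₗ[ℝ] ℝ} {X : ι → W} (h : ∀ v, ∑ i, φ i v • X i = v)
    (L : W →ₗ[ℝ] W) : LinearMap.trace ℝ W L = ∑ i, φ i (L (X i)) := by
  have : L = ∑ i, (φ i).smulRight (L (X i)) := by
    ext v
    conv_lhs => rw [← h v]
    simp
  conv_lhs => rw [this]
  simp

section SumSections

variable {E : Type*} [NormedAddCommGroup E] [NormedSpace ℝ E] [FiniteDimensional ℝ E]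
  {M : Type*} [TopologicalSpace M] [T2Space M] [ChartedSpace E M] [IsManifold 𝓘(ℝ, E) ∞ M]
  {F : Type*} [NormedAddCommGroup F] [NormedSpace ℝ F]
  {V : M → Type*} [TopologicalSpace (TotalSpace F V)]
  [∀ x, AddCommGroup (V x)] [∀ x, Module ℝ (V x)] [∀ x, TopologicalSpace (V x)]
  [∀ x, IsTopologicalAddGroup (V x)] [∀ x, ContinuousSMul ℝ (V x)]
  [FiberBundle F V] [VectorBundle ℝ F V] [ContMDiffVectorBundle ∞ F V 𝓘(ℝ, E)]

theorem SmoothSection.sum {ι : Type*} (s : Finset ι) {σ : ι → Π x, V x}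
    (hσ : ∀ i, SmoothSection 𝓘(ℝ, E) F (σ i)) :
    SmoothSection 𝓘(ℝ, E) F (fun y ↦ ∑ i ∈ s, σ i y) :=
  ContMDiff.sum_section fun i _ ↦ hσ i

theorem CovariantDerivative.sum_apply (D : CovariantDerivative 𝓘(ℝ, E) F V) {ι : Type*}
    (s : Finset ι) {σ : ι → Π x, V x} (hσ : ∀ i, SmoothSection 𝓘(ℝ, E) F (σ i)) (x : M)
    (u : Tan E M x) : D (fun y ↦ ∑ i ∈ s, σ i y) x u = ∑ i ∈ s, D (σ i) x u := by
  classical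
  induction s using Finset.induction_on with
  | empty =>
    have : D (fun y ↦ 0) x = 0 := congr($(D.zero) x)
    simp [this]
  | insert i s hi ih =>
    simp only [Finset.sum_insert hi]
    rw [D.add_apply ((hσ i).diffSectionAt x) ((SmoothSection.sum s hσ).diffSectionAt x), ih]

end SumSections

namespace FedosovStructure

/-! ### Compatibility of ∇ with traces and raising; smoothness of the tensors -/

section Smoothness

variable {E : Type*} [NormedAddCommGroup E] [NormedSpace ℝ E] [FiniteDimensional ℝ E]
  {M : Type*} [TopologicalSpace M] [T2Space M] [ChartedSpace E M] [IsManifold 𝓘(ℝ, E) ∞ M] {n : ℕ}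
  (𝓕 : FedosovStructure E M n)

open CovariantDerivative

theorem smooth_trace {T : Π x, HomBundle (Tan E M) (Tan E M) x}
    (hT : SmoothSection 𝓘(ℝ, E) (HomFiber E E) T) :
    ContMDiff 𝓘(ℝ, E) 𝓘(ℝ, ℝ) ∞ (fun y ↦ LinearMap.trace ℝ (Tan E M y) (T y).toLinear) := by
  intro x
  obtain ⟨X, ε, hX, hε, hXε⟩ := exists_frame (E := E) x
  have h : SmoothSection 𝓘(ℝ, E) ℝ (V := Line M) (fun y ↦ ∑ i, (ε i y (T y (X i y)) : ℝ)) :=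
    SmoothSection.sum _ fun i ↦ (hε i).hom_apply (hT.hom_apply (hX i))
  refine (smoothSection_line_iff.1 h x).congr_of_eventuallyEq ?_
  filter_upwards [hXε] with y hy
  exact trace_eq_sum_frame (φ := fun i ↦ (ε i y).toLinear) hy (T y).toLinear

/-- The covariant derivative commutes with the trace. -/
theorem mvfderiv_trace {T : Π x, HomBundle (Tan E M) (Tan E M) x}
    (hT : SmoothSection 𝓘(ℝ, E) (HomFiber E E) T) (x : M) (u : Tan E M x) :
    mvfderiv 𝓘(ℝ, E) (fun y ↦ LinearMap.trace ℝ (Tan E M y) (T y).toLinear) x u =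
      LinearMap.trace ℝ (Tan E M x)
        (𝓕.conn.hom 𝓕.conn T x u : HomBundle (Tan E M) (Tan E M) x).toLinear := by
  obtain ⟨X, ε, hX, hε, hXε⟩ := exists_frame (E := E) x
  let d := trivialLine 𝓘(ℝ, E) M
  have hs : SmoothSection 𝓘(ℝ, E) ℝ (V := Line M) (fun y ↦ ∑ i, (ε i y (T y (X i y)) : ℝ)) :=
    SmoothSection.sum _ fun i ↦ (hε i).hom_apply (hT.hom_apply (hX i))
  have h1 : mvfderiv 𝓘(ℝ, E) (fun y ↦ LinearMap.trace ℝ (Tan E M y) (T y).toLinear) x =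
      d (fun y ↦ ∑ i, (ε i y (T y (X i y)) : ℝ)) x := by
    refine d.congr_apply ((smoothSection_line_iff.2 (smooth_trace hT)).diffSectionAt x)
      (hs.diffSectionAt x) ?_
    filter_upwards [hXε] with y hy
    exact trace_eq_sum_frame (φ := fun i ↦ (ε i y).toLinear) hy (T y).toLinear
  have h2 (i) : d (fun y ↦ (ε i y (T y (X i y)) : ℝ)) x u =
      ((𝓕.cotanConn (ε i) x u : Cotan E M x) (T x (X i x)) +
        ε i x (T x (𝓕.conn (X i) x u)) : ℝ) +
      (ε i x ((𝓕.conn.hom 𝓕.conn T x u : HomBundle (Tan E M) (Tan E M) x) (X i x)) : ℝ) := by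
    rw [apply_hom_apply 𝓕.conn d (hε i) (hT.hom_apply (hX i)),
      apply_hom_apply 𝓕.conn 𝓕.conn hT (hX i), map_add]
    have (a b c : ℝ) : a + (b + c) = a + c + b := by ring
    exact this _ _ _
  -- Differentiating W = Σ εᵢ(W) Xᵢ shows that the identity endomorphism Σ εᵢ ⊗ Xᵢ is parallel.
  have key (w : Tan E M x) : ∑ i, (((𝓕.cotanConn (ε i) x u : Cotan E M x) w : ℝ) • X i x +
      (ε i x w : ℝ) • 𝓕.conn (X i) x u) = 0 := by
    obtain ⟨W, hW, rfl⟩ := exists_smoothSection_eq (E := E) (F := E) w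
    have hf (i) : ContMDiff 𝓘(ℝ, E) 𝓘(ℝ, ℝ) ∞ (fun y ↦ (ε i y (W y) : ℝ)) :=
      smoothSection_line_iff.1 ((hε i).hom_apply hW)
    have hi (i) : SmoothSection 𝓘(ℝ, E) E (fun y ↦ (ε i y (W y) : ℝ) • X i y) :=
      .smul (hf i) (hX i)
    have e1 : 𝓕.conn W x = 𝓕.conn (fun y ↦ ∑ i, (ε i y (W y) : ℝ) • X i y) x := by
      refine 𝓕.conn.congr_apply (hW.diffSectionAt x) ((SmoothSection.sum _ hi).diffSectionAt x) ?_
      filter_upwards [hXε] with y hy using (hy _).symm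
    have e2 := congr($e1 u)
    rw [𝓕.conn.sum_apply _ hi] at e2
    have e3 (i) : 𝓕.conn (fun y ↦ (ε i y (W y) : ℝ) • X i y) x u =
        (((𝓕.cotanConn (ε i) x u : Cotan E M x) (W x) : ℝ) • X i x +
          (ε i x (W x) : ℝ) • 𝓕.conn (X i) x u) + (ε i x (𝓕.conn W x u) : ℝ) • X i x := by
      rw [𝓕.conn.smul_apply ((hf i).mdiffAt x) ((hX i).diffSectionAt x)]
      have : mvfderiv 𝓘(ℝ, E) (fun y ↦ (ε i y (W y) : ℝ)) x u =
          ((𝓕.cotanConn (ε i) x u : Cotan E M x) (W x) : ℝ) + (ε i x (𝓕.conn W x u) : ℝ) :=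
        apply_hom_apply 𝓕.conn d (hε i) hW x u
      rw [this]
      module
    simp only [e3] at e2
    rw [Finset.sum_add_distrib, hXε.self_of_nhds] at e2
    exact left_eq_add.1 ((add_comm _ _).trans e2.symm).symm
  -- The trace of T composed with the vanishing derivative of Σ εᵢ ⊗ Xᵢ is precisely the part of Σ
  -- `h2 i` that does not contain ∇T.
  let N : Tan E M x →ₗ[ℝ] Tan E M x :=
    ∑ i, ((𝓕.cotanConn (ε i) x u : Cotan E M x).toLinear.smulRight (T x (X i x)) +
      (ε i x).toLinear.smulRight (T x (𝓕.conn (X i) x u)))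
  have hN : N = 0 := by
    ext w
    have := congr(T x $(key w))
    rw [map_sum, map_zero] at this
    rw [LinearMap.zero_apply, ← this]
    simp [N]
  have hN' := congr(LinearMap.trace ℝ (Tan E M x) $hN)
  simp only [N, map_sum, map_add, LinearMap.trace_smulRight, map_zero] at hN'
  rw [h1, d.sum_apply _ (fun i ↦ (hε i).hom_apply (hT.hom_apply (hX i))),
    trace_eq_sum_frame (φ := fun i ↦ (ε i x).toLinear) hXε.self_of_nhds]
  simp only [h2]
  refine (Finset.sum_add_distrib (M := ℝ)).trans ?_
  refine (congrArg (· + _) hN').trans (zero_add _)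

theorem raise_form (x : M) (v : Tan E M x) : 𝓕.raise x (𝓕.form x v) = v :=
  (LinearMap.linearEquivOfInjective (𝓕.lower x) (𝓕.lower_injective x)
    (finrank_cotan x)).symm_apply_apply v

theorem smooth_raise {μ : Π x, Cotan E M x} (hμ : SmoothSection 𝓘(ℝ, E) (HomFiber E ℝ) μ) :
    SmoothSection 𝓘(ℝ, E) E (fun y ↦ 𝓕.raise y (μ y)) := by
  have h : SmoothSection 𝓘(ℝ, E) (HomFiber (HomFiber E ℝ) E)
      (fun y ↦ HomBundle.ofLinear (V := Cotan E M) (V' := Tan E M) (𝓕.raise y)) :=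
    smoothSection_of_inverse 𝓕.smooth 𝓕.form_raise 𝓕.raise_form
  exact h.hom_apply hμ

/-- Differentiate J(raise μ) = μ: since ∇J = 0, lowering commutes with ∇, and hence so does its
inverse. -/
theorem conn_raise {μ : Π x, Cotan E M x} (hμ : SmoothSection 𝓘(ℝ, E) (HomFiber E ℝ) μ) (x : M)
    (u : Tan E M x) :
    𝓕.conn (fun y ↦ 𝓕.raise y (μ y)) x u = 𝓕.raise x (𝓕.cotanConn μ x u) := by
  have h := apply_hom_apply 𝓕.conn 𝓕.cotanConn 𝓕.smooth (𝓕.smooth_raise hμ) x u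
  simp only [𝓕.form_raise, 𝓕.parallel] at h
  rw [h]
  change _ = 𝓕.raise x (0 + _)
  rw [zero_add, 𝓕.raise_form]

theorem cotanConn_form {U : Π x, Tan E M x} (hU : SmoothSection 𝓘(ℝ, E) E U) (x : M)
    (u : Tan E M x) :
    𝓕.cotanConn (fun y ↦ 𝓕.form y (U y)) x u = 𝓕.form x (𝓕.conn U x u) := by
  rw [apply_hom_apply 𝓕.conn 𝓕.cotanConn 𝓕.smooth hU, 𝓕.parallel]
  exact zero_add _

theorem mvfderiv_form_parallel {U W : Π x, Tan E M x} (hU : SmoothSection 𝓘(ℝ, E) E U)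
    (hW : SmoothSection 𝓘(ℝ, E) E W) {x : M} (hUx : 𝓕.conn U x = 0) (hWx : 𝓕.conn W x = 0)
    (z : Tan E M x) : mvfderiv 𝓘(ℝ, E) (fun y ↦ (𝓕.form y (U y) (W y) : ℝ)) x z = 0 := by
  have h := 𝓕.hom_apply_parallel (trivialLine 𝓘(ℝ, E) M) (𝓕.smooth.hom_apply hU) hW hWx z
  refine h.symm.trans ?_
  change 𝓕.cotanConn (fun y ↦ 𝓕.form y (U y)) x z (W x) = 0
  rw [𝓕.cotanConn_form hU, hUx]
  change 𝓕.form x 0 (W x) = 0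
  rw [map_zero]
  rfl

/-- The endomorphism `p^a ↦ J^{cb} T_{ab} p^a` obtained by raising the last index. -/
def raiseEnd {x : M} (T : HomBundle (Tan E M) (Cotan E M) x) :
    HomBundle (Tan E M) (Tan E M) x :=
  .ofLinear (𝓕.raise x ∘ₗ T.toLinear)

theorem smooth_raiseEnd {T : Π x, HomBundle (Tan E M) (Cotan E M) x}
    (hT : SmoothSection 𝓘(ℝ, E) (HomFiber E (HomFiber E ℝ)) T) :
    SmoothSection 𝓘(ℝ, E) (HomFiber E E) (fun y ↦ 𝓕.raiseEnd (T y)) :=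
  smoothSection_hom fun _ hU ↦ 𝓕.smooth_raise (hT.hom_apply hU)

theorem smooth_contract {T : Π x, HomBundle (Tan E M) (Cotan E M) x}
    (hT : SmoothSection 𝓘(ℝ, E) (HomFiber E (HomFiber E ℝ)) T) :
    ContMDiff 𝓘(ℝ, E) 𝓘(ℝ, ℝ) ∞ (fun y ↦ 𝓕.contract y (T y)) :=
  smooth_trace (𝓕.smooth_raiseEnd hT)

/-- The contraction is a trace after raising an index, and ∇ commutes with both operations. -/
theorem mvfderiv_contract {T : Π x, HomBundle (Tan E M) (Cotan E M) x}
    (hT : SmoothSection 𝓘(ℝ, E) (HomFiber E (HomFiber E ℝ)) T) (x : M) (u : Tan E M x) :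
    mvfderiv 𝓘(ℝ, E) (fun y ↦ 𝓕.contract y (T y)) x u =
      𝓕.contract x (𝓕.conn.hom 𝓕.cotanConn T x u : HomBundle (Tan E M) (Cotan E M) x) := by
  refine (𝓕.mvfderiv_trace (𝓕.smooth_raiseEnd hT) x u).trans ?_
  refine congrArg (LinearMap.trace ℝ (Tan E M x)) (LinearMap.ext fun w ↦ ?_)
  obtain ⟨W, hW, rfl, hWx⟩ := exists_parallel 𝓕.conn x w
  change (𝓕.conn.hom 𝓕.conn (fun y ↦ 𝓕.raiseEnd (T y)) x u : HomBundle (Tan E M) (Tan E M) x)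
    (W x) = 𝓕.raise x ((𝓕.conn.hom 𝓕.cotanConn T x u : HomBundle (Tan E M) (Cotan E M) x) (W x))
  rw [𝓕.hom_apply_parallel _ (𝓕.smooth_raiseEnd hT) hW hWx, 𝓕.hom_apply_parallel _ hT hW hWx,
    ← 𝓕.conn_raise (hT.hom_apply hW)]
  rfl

/-- `firstSlot`, as an element of the fibre of a bundle of homomorphisms. -/
def firstSlotHom {x : M}
    (A : HomBundle (Tan E M) (HomBundle (Tan E M) (HomBundle (Tan E M) (Tan E M))) x)
    (v w : Tan E M x) : HomBundle (Tan E M) (Tan E M) x :=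
  .ofLinear (firstSlot A v w)

theorem smooth_firstSlotHom
    {A : Π x, HomBundle (Tan E M) (HomBundle (Tan E M) (HomBundle (Tan E M) (Tan E M))) x}
    (hA : SmoothSection 𝓘(ℝ, E) (HomFiber E (HomFiber E (HomFiber E E))) A)
    {V W : Π x, Tan E M x} (hV : SmoothSection 𝓘(ℝ, E) E V) (hW : SmoothSection 𝓘(ℝ, E) E W) :
    SmoothSection 𝓘(ℝ, E) (HomFiber E E) (fun y ↦ firstSlotHom (A y) (V y) (W y)) :=
  smoothSection_hom fun _ hU ↦ ((hA.hom_apply hU).hom_apply hV).hom_apply hW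

theorem smooth_Phi : SmoothSection 𝓘(ℝ, E) (HomFiber E (HomFiber E ℝ)) 𝓕.Phi :=
  smoothSection_hom fun _ hV ↦ smoothSection_hom fun _ hW ↦
    SmoothSection.const_smul (1 / (2 * ((n : ℝ) + 1)))
    (smoothSection_line_iff.2 (smooth_trace (smooth_firstSlotHom 𝓕.smooth_R hV hW)))

theorem smooth_V : SmoothSection 𝓘(ℝ, E) (HomFiber E (HomFiber E (HomFiber E E))) 𝓕.V := by
  refine smoothSection_hom fun U hU ↦ smoothSection_hom fun V hV ↦ smoothSection_hom fun W hW ↦ ?_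
  have fΦ {P Q : Π x, Tan E M x} (hP : SmoothSection 𝓘(ℝ, E) E P)
      (hQ : SmoothSection 𝓘(ℝ, E) E Q) := smoothSection_line_iff.1
        ((𝓕.smooth_Phi.hom_apply hP).hom_apply hQ)
  have fJ {P Q : Π x, Tan E M x} (hP : SmoothSection 𝓘(ℝ, E) E P)
      (hQ : SmoothSection 𝓘(ℝ, E) E Q) := smoothSection_line_iff.1
        ((𝓕.smooth.hom_apply hP).hom_apply hQ)
  have r {P : Π x, Tan E M x} (hP : SmoothSection 𝓘(ℝ, E) E P) :=
    𝓕.smooth_raise (𝓕.smooth_Phi.hom_apply hP)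
  exact (((𝓕.smooth_R.hom_apply hU).hom_apply hV).hom_apply hW).sub
    ((((SmoothSection.smul (fΦ hV hW) hU).sub (.smul (fΦ hU hW) hV)).add
      (.smul (fJ hU hW) (r hV))).sub (.smul (fJ hV hW) (r hU)) |>.add
      (.smul (contMDiff_const.mul (fJ hU hV)) (r hW)))

theorem smooth_gradPhi :
    SmoothSection 𝓘(ℝ, E) (HomFiber E (HomFiber E (HomFiber E ℝ))) 𝓕.gradPhi :=
  𝓕.conn_isSmooth.hom 𝓕.cotanConn_isSmooth _ 𝓕.smooth_Phi

theorem smooth_gradPhiAux {U : Π x, Tan E M x} (hU : SmoothSection 𝓘(ℝ, E) E U) :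
    SmoothSection 𝓘(ℝ, E) (HomFiber E (HomFiber E ℝ)) (fun y ↦ 𝓕.gradPhiAux y (U y)) :=
  smoothSection_hom fun _ hP ↦ smoothSection_hom fun _ hQ ↦
    ((𝓕.smooth_gradPhi.hom_apply hQ).hom_apply hU).hom_apply hP

theorem smooth_S : SmoothSection 𝓘(ℝ, E) (HomFiber E ℝ) 𝓕.S :=
  smoothSection_hom fun _ hU ↦ SmoothSection.const_smul (1 / (2 * (n : ℝ) + 1))
    (smoothSection_line_iff.2 (𝓕.smooth_contract (𝓕.smooth_gradPhiAux hU)))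

theorem smooth_Y : SmoothSection 𝓘(ℝ, E) (HomFiber E (HomFiber E (HomFiber E ℝ))) 𝓕.Y := by
  refine smoothSection_hom fun U hU ↦ smoothSection_hom fun V hV ↦ smoothSection_hom fun W hW ↦ ?_
  have hc := 𝓕.conn_isSmooth
  have h : SmoothSection 𝓘(ℝ, E) _ 𝓕.gradV := hc.hom (hc.hom (hc.hom hc)) _ 𝓕.smooth_V
  have h' : SmoothSection 𝓘(ℝ, E) (HomFiber E E) (fun y ↦ HomBundle.ofLinear (V := Tan E M)
      (V' := Tan E M) (𝓕.gradVAux y (U y) (V y) (W y))) :=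
    smoothSection_hom fun Z hZ ↦
      (((h.hom_apply hZ).hom_apply hU).hom_apply hV).hom_apply hW
  exact SmoothSection.const_smul (1 / (2 * (n : ℝ) + 1))
    (smoothSection_line_iff.2 (smooth_trace h'))

end Smoothness

end FedosovStructure

namespace FedosovStructure

/-! ### The contracted second Bianchi identity -/

section CottonYork

variable {E : Type*} [NormedAddCommGroup E] [NormedSpace ℝ E] [FiniteDimensional ℝ E]
  {M : Type*} [TopologicalSpace M] [T2Space M] [ChartedSpace E M] [IsManifold 𝓘(ℝ, E) ∞ M] {n : ℕ}
  (𝓕 : FedosovStructure E M n)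

open CovariantDerivative

theorem form_apply_raise (x : M) (v : Tan E M x) (φ : Cotan E M x) :
    (𝓕.form x v (𝓕.raise x φ) : ℝ) = -(φ v : ℝ) := by
  rw [𝓕.skew, 𝓕.form_raise]

/-- Skewness of the inverse form J^{ab}. -/
theorem apply_raise_comm (x : M) (φ ψ : Cotan E M x) :
    (φ (𝓕.raise x ψ) : ℝ) = -(ψ (𝓕.raise x φ) : ℝ) := by
  rw [← 𝓕.form_apply_raise, 𝓕.form_raise]

/-- The endomorphism obtained by raising `T'` is the J-adjoint of minus the one obtained from `T`;
the sign is the skewness of J. -/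
theorem contract_transpose {x : M} {T T' : HomBundle (Tan E M) (Cotan E M) x}
    (h : ∀ p q, (T' p q : ℝ) = T q p) : 𝓕.contract x T' = -𝓕.contract x T := by
  rw [contract, contract, ← map_neg]
  refine trace_eq_of_adjoint (𝓕.formDual_injective x) fun a b ↦ ?_
  change (𝓕.form x (𝓕.raise x (T' a)) b : ℝ) = 𝓕.form x a (-𝓕.raise x (T b))
  rw [𝓕.form_raise, map_neg]
  refine (h a b).trans ?_
  refine (neg_eq_iff_eq_neg.2 ?_).symm
  exact 𝓕.form_apply_raise x a (T b)

theorem contract_sub {x : M} (T T' : HomBundle (Tan E M) (Cotan E M) x) :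
    𝓕.contract x (T - T') = 𝓕.contract x T - 𝓕.contract x T' := by
  rw [contract, contract, contract, ← map_sub]
  congr 1
  ext p
  exact map_sub (𝓕.raise x) _ _

theorem mvfderiv_apply_parallel {A : Π x, HomBundle (Tan E M) (Cotan E M) x}
    (hA : SmoothSection 𝓘(ℝ, E) (HomFiber E (HomFiber E ℝ)) A) {V W : Π x, Tan E M x}
    (hV : SmoothSection 𝓘(ℝ, E) E V) (hW : SmoothSection 𝓘(ℝ, E) E W) {x : M}
    (hVx : 𝓕.conn V x = 0) (hWx : 𝓕.conn W x = 0) (z : Tan E M x) :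
    mvfderiv 𝓘(ℝ, E) (fun y ↦ (A y (V y) (W y) : ℝ)) x z =
      derivSection (𝓕.conn.hom 𝓕.cotanConn) A x z (V x) (W x) := by
  rw [𝓕.derivSection_apply_parallel _ hA hV hVx,
    𝓕.hom_apply_parallel _ (hA.hom_apply hV) hW hWx]
  rfl

theorem gradR_parallel {U V W : Π x, Tan E M x}
    (hU : SmoothSection 𝓘(ℝ, E) E U) (hV : SmoothSection 𝓘(ℝ, E) E V)
    (hW : SmoothSection 𝓘(ℝ, E) E W) {x : M} (hUx : 𝓕.conn U x = 0)
    (hVx : 𝓕.conn V x = 0) (hWx : 𝓕.conn W x = 0) (z : Tan E M x) :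
    𝓕.gradR x z (U x) (V x) (W x) = 𝓕.conn (fun y ↦ 𝓕.R y (U y) (V y) (W y)) x z := by
  have h1 := 𝓕.smooth_R.hom_apply hU
  rw [gradR, 𝓕.derivSection_apply_parallel _ 𝓕.smooth_R hU hUx,
    𝓕.hom_apply_parallel _ h1 hV hVx, 𝓕.hom_apply_parallel _ (h1.hom_apply hV) hW hWx]

theorem gradV_parallel {U V W : Π x, Tan E M x}
    (hU : SmoothSection 𝓘(ℝ, E) E U) (hV : SmoothSection 𝓘(ℝ, E) E V)
    (hW : SmoothSection 𝓘(ℝ, E) E W) {x : M} (hUx : 𝓕.conn U x = 0)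
    (hVx : 𝓕.conn V x = 0) (hWx : 𝓕.conn W x = 0) (z : Tan E M x) :
    𝓕.gradV x z (U x) (V x) (W x) = 𝓕.conn (fun y ↦ 𝓕.V y (U y) (V y) (W y)) x z := by
  have h1 := 𝓕.smooth_V.hom_apply hU
  rw [gradV, 𝓕.derivSection_apply_parallel _ 𝓕.smooth_V hU hUx,
    𝓕.hom_apply_parallel _ h1 hV hVx, 𝓕.hom_apply_parallel _ (h1.hom_apply hV) hW hWx]

theorem gradPhi_eq (x : M) (z v w : Tan E M x) :
    (𝓕.gradPhi x z v w : ℝ) = (1 / (2 * ((n : ℝ) + 1))) *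
      LinearMap.trace ℝ (Tan E M x) (firstSlot (𝓕.gradR x z) v w) := by
  obtain ⟨V, hV, rfl, hVx⟩ := exists_parallel 𝓕.conn x v
  obtain ⟨W, hW, rfl, hWx⟩ := exists_parallel 𝓕.conn x w
  have hT := smooth_firstSlotHom 𝓕.smooth_R hV hW
  rw [gradPhi, ← 𝓕.mvfderiv_apply_parallel 𝓕.smooth_Phi hV hW hVx hWx]
  have h2 := (trivialLine 𝓘(ℝ, E) M).const_smul_apply (1 / (2 * ((n : ℝ) + 1)))
    ((smoothSection_line_iff.2 (smooth_trace hT)).diffSectionAt x) z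
  refine h2.trans (congrArg (fun t : ℝ ↦ (1 / (2 * ((n : ℝ) + 1))) * t) ?_)
  refine (𝓕.mvfderiv_trace hT x z).trans ?_
  refine congrArg (LinearMap.trace ℝ (Tan E M x)) (LinearMap.ext fun u ↦ ?_)
  obtain ⟨U, hU, rfl, hUx⟩ := exists_parallel 𝓕.conn x u
  refine (𝓕.hom_apply_parallel 𝓕.conn hT hU hUx z).trans ?_
  exact (𝓕.gradR_parallel hU hV hW hUx hVx hWx z).symm

theorem gradR_skew (x : M) (z u v w : Tan E M x) :
    𝓕.gradR x z u v w = -𝓕.gradR x z v u w := by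
  obtain ⟨U, hU, rfl, hUx⟩ := exists_parallel 𝓕.conn x u
  obtain ⟨V, hV, rfl, hVx⟩ := exists_parallel 𝓕.conn x v
  obtain ⟨W, hW, rfl, hWx⟩ := exists_parallel 𝓕.conn x w
  have h := ((𝓕.smooth_R.hom_apply hV).hom_apply hU).hom_apply hW
  rw [𝓕.gradR_parallel hU hV hW hUx hVx hWx, 𝓕.gradR_parallel hV hU hW hVx hUx hWx,
    ← neg_one_smul ℝ, ← 𝓕.conn.const_smul_apply _ (h.diffSectionAt x)]
  congr 3
  funext y
  rw [𝓕.R_skew y (U y), neg_one_smul]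

/-- Differentiate the decomposition of R. Since J and the raising of indices are parallel, the
derivative falls only on V and Φ. -/
theorem gradR_eq (x : M) (z u v w : Tan E M x) :
    𝓕.gradR x z u v w = 𝓕.gradV x z u v w +
      ((𝓕.gradPhi x z v w : ℝ) • u - (𝓕.gradPhi x z u w : ℝ) • v
        + (𝓕.form x u w : ℝ) • 𝓕.raise x (𝓕.gradPhi x z v)
        - (𝓕.form x v w : ℝ) • 𝓕.raise x (𝓕.gradPhi x z u)
        + (2 * (𝓕.form x u v : ℝ)) • 𝓕.raise x (𝓕.gradPhi x z w)) := by
  obtain ⟨U, hU, rfl, hUx⟩ := exists_parallel 𝓕.conn x u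
  obtain ⟨V, hV, rfl, hVx⟩ := exists_parallel 𝓕.conn x v
  obtain ⟨W, hW, rfl, hWx⟩ := exists_parallel 𝓕.conn x w
  have fΦ {P Q : Π x, Tan E M x} (hP : SmoothSection 𝓘(ℝ, E) E P)
      (hQ : SmoothSection 𝓘(ℝ, E) E Q) := smoothSection_line_iff.1
        ((𝓕.smooth_Phi.hom_apply hP).hom_apply hQ)
  have fJ {P Q : Π x, Tan E M x} (hP : SmoothSection 𝓘(ℝ, E) E P)
      (hQ : SmoothSection 𝓘(ℝ, E) E Q) := smoothSection_line_iff.1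
        ((𝓕.smooth.hom_apply hP).hom_apply hQ)
  have cJ {P Q : Π x, Tan E M x} (c : ℝ) (hP : SmoothSection 𝓘(ℝ, E) E P)
      (hQ : SmoothSection 𝓘(ℝ, E) E Q) : ContMDiff 𝓘(ℝ, E) 𝓘(ℝ, ℝ) ∞
        (fun y ↦ c * (𝓕.form y (P y) (Q y) : ℝ)) := contMDiff_const.mul (fJ hP hQ)
  have r {P : Π x, Tan E M x} (hP : SmoothSection 𝓘(ℝ, E) E P) :=
    𝓕.smooth_raise (𝓕.smooth_Phi.hom_apply hP)
  have dΦ {P Q A : Π x, Tan E M x} (hP : SmoothSection 𝓘(ℝ, E) E P)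
      (hQ : SmoothSection 𝓘(ℝ, E) E Q) (hA : SmoothSection 𝓘(ℝ, E) E A) (hPx : 𝓕.conn P x = 0)
      (hQx : 𝓕.conn Q x = 0) (hAx : 𝓕.conn A x = 0) :
      𝓕.conn (fun y ↦ (𝓕.Phi y (P y) (Q y) : ℝ) • A y) x z =
        (𝓕.gradPhi x z (P x) (Q x) : ℝ) • A x := by
    rw [𝓕.conn.smul_apply ((fΦ hP hQ).mdiffAt x) (hA.diffSectionAt x), hAx,
      𝓕.mvfderiv_apply_parallel 𝓕.smooth_Phi hP hQ hPx hQx, ← gradPhi]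
    simp
  -- The constant `c` covers the terms of the decomposition with coefficient 1 and the one with
  -- coefficient 2.
  have dJ {P Q A : Π x, Tan E M x} (c : ℝ) (hP : SmoothSection 𝓘(ℝ, E) E P)
      (hQ : SmoothSection 𝓘(ℝ, E) E Q) (hA : SmoothSection 𝓘(ℝ, E) E A) (hPx : 𝓕.conn P x = 0)
      (hQx : 𝓕.conn Q x = 0) (hAx : 𝓕.conn A x = 0) :
      𝓕.conn (fun y ↦ (c * (𝓕.form y (P y) (Q y) : ℝ)) • 𝓕.raise y (𝓕.Phi y (A y))) x z =
        (c * (𝓕.form x (P x) (Q x) : ℝ)) • 𝓕.raise x (𝓕.gradPhi x z (A x)) := by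
    have h0 : mvfderiv 𝓘(ℝ, E) (fun y ↦ c * (𝓕.form y (P y) (Q y) : ℝ)) x z = 0 := by
      have h2 := (trivialLine 𝓘(ℝ, E) M).const_smul_apply c
        ((smoothSection_line_iff.2 (fJ hP hQ)).diffSectionAt x) z
      refine h2.trans ?_
      refine (congrArg (c * ·) (𝓕.mvfderiv_form_parallel hP hQ hPx hQx z)).trans (mul_zero c)
    rw [𝓕.conn.smul_apply ((cJ c hP hQ).mdiffAt x) ((r hA).diffSectionAt x),
      h0, zero_smul, add_zero, 𝓕.conn_raise (𝓕.smooth_Phi.hom_apply hA), gradPhi,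
      𝓕.derivSection_apply_parallel _ 𝓕.smooth_Phi hA hAx]
  have s0 := ((𝓕.smooth_V.hom_apply hU).hom_apply hV).hom_apply hW
  have s1 := SmoothSection.smul (fΦ hV hW) hU
  have s2 := SmoothSection.smul (fΦ hU hW) hV
  have s3 := SmoothSection.smul (cJ 1 hU hW) (r hV)
  have s4 := SmoothSection.smul (cJ 1 hV hW) (r hU)
  have s5 := SmoothSection.smul (cJ 2 hU hV) (r hW)
  have d1 := dΦ hV hW hU hVx hWx hUx
  have d2 := dΦ hU hW hV hUx hWx hVx
  have d3 := dJ 1 hU hW hV hUx hWx hVx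
  have d4 := dJ 1 hV hW hU hVx hWx hUx
  have d5 := dJ 2 hU hV hW hUx hVx hWx
  have key : 𝓕.conn (fun y ↦ 𝓕.R y (U y) (V y) (W y)) x z =
      𝓕.conn (fun y ↦ 𝓕.V y (U y) (V y) (W y) +
        ((𝓕.Phi y (V y) (W y) : ℝ) • U y - (𝓕.Phi y (U y) (W y) : ℝ) • V y
      + (1 * (𝓕.form y (U y) (W y) : ℝ)) • 𝓕.raise y (𝓕.Phi y (V y))
      - (1 * (𝓕.form y (V y) (W y) : ℝ)) • 𝓕.raise y (𝓕.Phi y (U y))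
      + (2 * (𝓕.form y (U y) (V y) : ℝ)) • 𝓕.raise y (𝓕.Phi y (W y)))) x z := by
    congr 3
    funext y
    rw [one_mul, one_mul]
    exact 𝓕.R_eq y (U y) (V y) (W y)
  rw [𝓕.gradR_parallel hU hV hW hUx hVx hWx, 𝓕.gradV_parallel hU hV hW hUx hVx hWx, key,
    𝓕.conn.add_apply (s0.diffSectionAt x) (((((s1.sub s2).add s3).sub s4).add s5).diffSectionAt x),
    𝓕.conn.add_apply ((((s1.sub s2).add s3).sub s4).diffSectionAt x) (s5.diffSectionAt x),
    𝓕.conn.sub_apply (((s1.sub s2).add s3).diffSectionAt x) (s4.diffSectionAt x),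
    𝓕.conn.add_apply ((s1.sub s2).diffSectionAt x) (s3.diffSectionAt x),
    𝓕.conn.sub_apply (s1.diffSectionAt x) (s2.diffSectionAt x), d1, d2, d3, d4, d5, one_mul,
    one_mul]

/-- The linear form `z^e ↦ z^e v^a w^b ∇_e Φ_{ab}`. -/
def gradPhiForm (x : M) (v w : Tan E M x) : Tan E M x →ₗ[ℝ] ℝ where
  toFun z := 𝓕.gradPhi x z v w
  map_add' z z' := by
    rw [map_add]
    rfl
  map_smul' c z := by
    rw [map_smul]
    rfl

/-- The tensor `(z, q) ↦ z^e v^a q^b ∇_e Φ_{ab}`. -/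
def gradPhiAt (x : M) (v : Tan E M x) : HomBundle (Tan E M) (Cotan E M) x :=
  .ofLinear
    { toFun z := 𝓕.gradPhi x z v
      map_add' z z' := by simp
      map_smul' c z := by simp }

/-- `S` is defined by contracting `gradPhiAux`, the transpose of this tensor, whence the minus sign.
-/
theorem contract_gradPhiAt (x : M) (v : Tan E M x) :
    𝓕.contract x (𝓕.gradPhiAt x v) = -((2 * (n : ℝ) + 1) * (𝓕.S x v : ℝ)) := by
  have h : 𝓕.contract x (𝓕.gradPhiAux x v) = -𝓕.contract x (𝓕.gradPhiAt x v) :=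
    𝓕.contract_transpose fun _ _ ↦ rfl
  have hS : (𝓕.S x v : ℝ) = (1 / (2 * (n : ℝ) + 1)) * 𝓕.contract x (𝓕.gradPhiAux x v) := rfl
  have hn : (2 * (n : ℝ) + 1) ≠ 0 := by positivity
  rw [hS, h]
  field_simp

/-- By the second Bianchi identity the map is the difference of z ↦ ∇_uR(z,v)w and z ↦ ∇_vR(z,u)w.
Their traces are derivatives of 2(n+1)Φ. -/
theorem trace_gradR (x : M) (u v w : Tan E M x) {L : Tan E M x →ₗ[ℝ] Tan E M x}
    (hL : ∀ z, L z = 𝓕.gradR x z u v w) :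
    LinearMap.trace ℝ (Tan E M x) L =
      2 * ((n : ℝ) + 1) * ((𝓕.gradPhi x u v w : ℝ) - (𝓕.gradPhi x v u w : ℝ)) := by
  have h : L = firstSlot (𝓕.gradR x u) v w - firstSlot (𝓕.gradR x v) u w := by
    ext z
    change L z = 𝓕.gradR x u z v w - 𝓕.gradR x v z u w
    have := 𝓕.bianchi_second x z u v w
    rw [𝓕.gradR_skew x u v z w] at this
    rw [hL, ← sub_eq_zero, ← this]
    abel
  have hn : ((n : ℝ) + 1) ≠ 0 := by positivity
  rw [h, map_sub, 𝓕.gradPhi_eq, 𝓕.gradPhi_eq]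
  field_simp

/-- The contracted second Bianchi identity. -/
theorem Y_eq (x : M) (u v w : Tan E M x) :
    (𝓕.Y x u v w : ℝ) = (𝓕.gradPhi x u v w : ℝ) - (𝓕.gradPhi x v u w : ℝ) +
      (𝓕.S x v : ℝ) * (𝓕.form x u w : ℝ) - (𝓕.S x u : ℝ) * (𝓕.form x v w : ℝ) +
      2 * (𝓕.form x u v : ℝ) * (𝓕.S x w : ℝ) := by
  let B (v : Tan E M x) : Tan E M x →ₗ[ℝ] Tan E M x := 𝓕.raise x ∘ₗ (𝓕.gradPhiAt x v).toLinear
  -- This is z ↦ (∇_z R)(u,v)w written through ∇V and ∇Φ, in a form whose trace can be read off term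
  -- by term.
  let L : Tan E M x →ₗ[ℝ] Tan E M x := 𝓕.gradVAux x u v w +
    ((𝓕.gradPhiForm x v w).smulRight u - (𝓕.gradPhiForm x u w).smulRight v +
      (𝓕.form x u w : ℝ) • B v - (𝓕.form x v w : ℝ) • B u + (2 * (𝓕.form x u v : ℝ)) • B w)
  have h1 := 𝓕.trace_gradR x u v w (L := L) fun z ↦ (𝓕.gradR_eq x z u v w).symm
  have hB (v : Tan E M x) : LinearMap.trace ℝ (Tan E M x) (B v) =
      -((2 * (n : ℝ) + 1) * (𝓕.S x v : ℝ)) := 𝓕.contract_gradPhiAt x v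
  have hY : (𝓕.Y x u v w : ℝ) = (1 / (2 * (n : ℝ) + 1)) *
    LinearMap.trace ℝ (Tan E M x) (𝓕.gradVAux x u v w) := rfl
  have hA (v w u : Tan E M x) : 𝓕.gradPhiForm x v w u = (𝓕.gradPhi x u v w : ℝ) := rfl
  simp only [L, map_add, map_sub, map_smul, LinearMap.trace_smulRight, hB, hA, smul_eq_mul] at h1
  have hn : (2 * (n : ℝ) + 1) ≠ 0 := by positivity
  rw [hY, div_mul_eq_mul_div, one_mul, div_eq_iff hn]
  -- The rank-one terms have traces ∇_uΦ(v,w) and -∇_vΦ(u,w). Moving them to the other side turns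
  -- the factor 2(n+1) into 2n+1, which is the normalisation of both Y and S.
  linear_combination h1

end CottonYork

end FedosovStructure

namespace FedosovStructure

/-! ### The divergence of Y -/

section Ricci

variable {E : Type*} [NormedAddCommGroup E] [NormedSpace ℝ E] [FiniteDimensional ℝ E]
  {M : Type*} [TopologicalSpace M] [T2Space M] [ChartedSpace E M] [IsManifold 𝓘(ℝ, E) ∞ M] {n : ℕ}
  (𝓕 : FedosovStructure E M n)

open CovariantDerivative

/-- `∇_e ∇_c Φ_{ab}`, the indices `e` and `c` being the first two arguments. -/
def hessPhi (x : M) : HomBundle (Tan E M) (HomBundle (Tan E M)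
    (HomBundle (Tan E M) (Cotan E M))) x :=
  derivSection (𝓕.conn.hom (𝓕.conn.hom 𝓕.cotanConn)) 𝓕.gradPhi x

variable {𝓕} in
theorem mvfderiv_apply₃_parallel
    {A : Π x, HomBundle (Tan E M) (HomBundle (Tan E M) (Cotan E M)) x}
    (hA : SmoothSection 𝓘(ℝ, E) (HomFiber E (HomFiber E (HomFiber E ℝ))) A)
    {U V W : Π x, Tan E M x} (hU : SmoothSection 𝓘(ℝ, E) E U) (hV : SmoothSection 𝓘(ℝ, E) E V)
    (hW : SmoothSection 𝓘(ℝ, E) E W) {x : M} (hUx : 𝓕.conn U x = 0) (hVx : 𝓕.conn V x = 0)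
    (hWx : 𝓕.conn W x = 0) (z : Tan E M x) :
    mvfderiv 𝓘(ℝ, E) (fun y ↦ (A y (U y) (V y) (W y) : ℝ)) x z =
      derivSection (𝓕.conn.hom (𝓕.conn.hom 𝓕.cotanConn)) A x z (U x) (V x) (W x) := by
  rw [𝓕.mvfderiv_apply_parallel (hA.hom_apply hU) hV hW hVx hWx,
    𝓕.derivSection_apply_parallel _ hA hU hUx]
  rfl

theorem mvfderiv_S_parallel {V : Π x, Tan E M x} (hV : SmoothSection 𝓘(ℝ, E) E V) {x : M}
    (hVx : 𝓕.conn V x = 0) (z : Tan E M x) :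
    mvfderiv 𝓘(ℝ, E) (fun y ↦ (𝓕.S y (V y) : ℝ)) x z = 𝓕.gradS x z (V x) :=
  (𝓕.hom_apply_parallel (trivialLine 𝓘(ℝ, E) M) 𝓕.smooth_S hV hVx z).symm

/-- The Ricci identity for `Φ`. -/
theorem hessPhi_sub (x : M) (p u v w : Tan E M x) :
    (𝓕.hessPhi x p u v w : ℝ) - (𝓕.hessPhi x u p v w : ℝ) =
      -(𝓕.Phi x (𝓕.R x p u v) w : ℝ) - (𝓕.Phi x v (𝓕.R x p u w) : ℝ) := by
  obtain ⟨V, hV, rfl⟩ := exists_smoothSection_eq (E := E) (F := E) v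
  have h := 𝓕.curv_hom_apply 𝓕.conn_isSmooth 𝓕.cotanConn_isSmooth 𝓕.smooth_Phi hV x p u
  rw [← 𝓕.R_apply_section hV] at h
  have h2 := congr($h w)
  rw [HomBundle.sub_apply, 𝓕.curv_cotanConn (𝓕.smooth_Phi.hom_apply hV)] at h2
  refine (Eq.trans ?_ h2).trans ?_
  · rfl
  · change (-_ - _ : ℝ) = _
    ring

/-- The covariant derivative of the contracted second Bianchi identity. -/
theorem gradY_eq (x : M) (p u v w : Tan E M x) :
    (𝓕.gradY x p u v w : ℝ) = (𝓕.hessPhi x p u v w : ℝ) - (𝓕.hessPhi x p v u w : ℝ) +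
      (𝓕.gradS x p v : ℝ) * (𝓕.form x u w : ℝ) - (𝓕.gradS x p u : ℝ) * (𝓕.form x v w : ℝ) +
      2 * ((𝓕.gradS x p w : ℝ) * (𝓕.form x u v : ℝ)) := by
  obtain ⟨U, hU, rfl, hUx⟩ := exists_parallel 𝓕.conn x u
  obtain ⟨V, hV, rfl, hVx⟩ := exists_parallel 𝓕.conn x v
  obtain ⟨W, hW, rfl, hWx⟩ := exists_parallel 𝓕.conn x w
  let d := trivialLine 𝓘(ℝ, E) M
  have sΦ {A B C : Π x, Tan E M x} (hA : SmoothSection 𝓘(ℝ, E) E A)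
      (hB : SmoothSection 𝓘(ℝ, E) E B) (hC : SmoothSection 𝓘(ℝ, E) E C) :=
    ((𝓕.smooth_gradPhi.hom_apply hA).hom_apply hB).hom_apply hC
  have sS {A : Π x, Tan E M x} (hA : SmoothSection 𝓘(ℝ, E) E A) := 𝓕.smooth_S.hom_apply hA
  have sJ {A B : Π x, Tan E M x} (hA : SmoothSection 𝓘(ℝ, E) E A)
      (hB : SmoothSection 𝓘(ℝ, E) E B) := (𝓕.smooth.hom_apply hA).hom_apply hB
  have sSJ {A B C : Π x, Tan E M x} (hA : SmoothSection 𝓘(ℝ, E) E A)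
      (hB : SmoothSection 𝓘(ℝ, E) E B) (hC : SmoothSection 𝓘(ℝ, E) E C) :=
    SmoothSection.smul (smoothSection_line_iff.1 (sS hA)) (sJ hB hC)
  have dSJ {A B C : Π x, Tan E M x} (hA : SmoothSection 𝓘(ℝ, E) E A)
      (hB : SmoothSection 𝓘(ℝ, E) E B) (hC : SmoothSection 𝓘(ℝ, E) E C) (hAx : 𝓕.conn A x = 0)
      (hBx : 𝓕.conn B x = 0) (hCx : 𝓕.conn C x = 0) :
      d (fun y ↦ (𝓕.S y (A y) : ℝ) • 𝓕.form y (B y) (C y)) x p =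
        (𝓕.gradS x p (A x) : ℝ) * (𝓕.form x (B x) (C x) : ℝ) := by
    rw [d.smul_apply ((smoothSection_line_iff.1 (sS hA)).mdiffAt x) ((sJ hB hC).diffSectionAt x),
      𝓕.mvfderiv_S_parallel hA hAx]
    have h : d (fun y ↦ 𝓕.form y (B y) (C y)) x p = 0 := 𝓕.mvfderiv_form_parallel hB hC hBx hCx p
    rw [h, smul_zero]
    exact zero_add (M := ℝ) _
  have e1 := sΦ hU hV hW
  have e2 := sΦ hV hU hW
  have e3 := sSJ hV hU hW
  have e4 := sSJ hU hV hW
  have e5 := SmoothSection.const_smul 2 (sSJ hW hU hV)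
  -- `Y_eq` holds at every point and so may be differentiated. The factors are ordered so that each
  -- S ⊗ J term has the shape treated by `dSJ`, where J counts as constant.
  have key : (fun y ↦ (𝓕.Y y (U y) (V y) (W y) : ℝ)) = fun y ↦
      𝓕.gradPhi y (U y) (V y) (W y) - 𝓕.gradPhi y (V y) (U y) (W y) +
        (𝓕.S y (V y) : ℝ) • 𝓕.form y (U y) (W y) - (𝓕.S y (U y) : ℝ) • 𝓕.form y (V y) (W y) +
        (2 : ℝ) • (𝓕.S y (W y) : ℝ) • 𝓕.form y (U y) (V y) := by
    funext y
    refine (𝓕.Y_eq y (U y) (V y) (W y)).trans ?_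
    change (_ : ℝ) = _ + 2 * (_ * _)
    rw [mul_assoc, mul_comm (𝓕.form y (U y) (V y) : ℝ)]
    rfl
  rw [gradY, ← mvfderiv_apply₃_parallel 𝓕.smooth_Y hU hV hW hUx hVx hWx, key]
  change d _ x p = _
  rw [d.add_apply ((((e1.sub e2).add e3).sub e4).diffSectionAt x) (e5.diffSectionAt x),
    d.sub_apply (((e1.sub e2).add e3).diffSectionAt x) (e4.diffSectionAt x),
    d.add_apply ((e1.sub e2).diffSectionAt x) (e3.diffSectionAt x),
    d.sub_apply (e1.diffSectionAt x) (e2.diffSectionAt x),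
    d.const_smul_apply 2 ((sSJ hW hU hV).diffSectionAt x), dSJ hV hU hW hVx hUx hWx,
    dSJ hU hV hW hUx hVx hWx, dSJ hW hU hV hWx hUx hVx, hessPhi,
    ← mvfderiv_apply₃_parallel 𝓕.smooth_gradPhi hU hV hW hUx hVx hWx,
    ← mvfderiv_apply₃_parallel 𝓕.smooth_gradPhi hV hU hW hVx hUx hWx]
  rfl

theorem raise_eq {x : M} {φ : Cotan E M x} {a : Tan E M x}
    (h : ∀ w, (φ w : ℝ) = 𝓕.form x a w) : 𝓕.raise x φ = a := by
  rw [← 𝓕.raise_form x a]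
  congr 1
  ext w
  exact h w

/-- The trace of `p ↦ J^{cb} p^e u^f v^a ∇_f ∇_e Φ_{ab}`. -/
theorem trace_hessPhi (x : M) (u v : Tan E M x) {L : Tan E M x →ₗ[ℝ] Tan E M x}
    (hL : ∀ p, L p = 𝓕.raise x (𝓕.hessPhi x u p v)) :
    LinearMap.trace ℝ (Tan E M x) L = -((2 * (n : ℝ) + 1) * (𝓕.gradS x u v : ℝ)) := by
  obtain ⟨V, hV, rfl, hVx⟩ := exists_parallel 𝓕.conn x v
  have hT : SmoothSection 𝓘(ℝ, E) (HomFiber E (HomFiber E ℝ)) (fun y ↦ 𝓕.gradPhiAt y (V y)) :=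
    smoothSection_hom fun _ hP ↦ (𝓕.smooth_gradPhi.hom_apply hP).hom_apply hV
  -- Differentiating `contract_gradPhiAt` along u relates the contracted second derivative of Φ to
  -- ∇S.
  have h := 𝓕.mvfderiv_contract hT x u
  simp only [𝓕.contract_gradPhiAt] at h
  have h2 := (trivialLine 𝓘(ℝ, E) M).const_smul_apply (-(2 * (n : ℝ) + 1))
    ((𝓕.smooth_S.hom_apply hV).diffSectionAt x) u
  have h3 : (fun y ↦ -((2 * (n : ℝ) + 1) * (𝓕.S y (V y) : ℝ))) =
      fun y ↦ (-(2 * (n : ℝ) + 1)) • 𝓕.S y (V y) := by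
    funext y
    exact (neg_mul _ _).symm
  rw [h3] at h
  have h4 : (-(2 * (n : ℝ) + 1)) * (𝓕.gradS x u (V x) : ℝ) =
      𝓕.contract x (𝓕.conn.hom 𝓕.cotanConn (fun y ↦ 𝓕.gradPhiAt y (V y)) x u :
        HomBundle (Tan E M) (Cotan E M) x) := by
    rw [← h, ← 𝓕.mvfderiv_S_parallel hV hVx]
    exact h2.symm
  rw [← neg_mul, h4, contract]
  congr 1
  ext p
  rw [hL]
  obtain ⟨P, hP, rfl, hPx⟩ := exists_parallel 𝓕.conn x p
  refine congrArg (𝓕.raise x) ?_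
  refine Eq.trans ?_ (𝓕.hom_apply_parallel _ hT hP hPx u).symm
  rw [hessPhi, 𝓕.derivSection_apply_parallel _ 𝓕.smooth_gradPhi hP hPx,
    𝓕.hom_apply_parallel _ (𝓕.smooth_gradPhi.hom_apply hP) hV hVx]
  rfl

/-- The endomorphism `q^a ↦ J^{cb} Φ_{ab} q^a`. -/
def raisePhi (x : M) : Tan E M x →ₗ[ℝ] Tan E M x := 𝓕.raise x ∘ₗ (𝓕.Phi x).toLinear

theorem raisePhi_apply (x : M) (v : Tan E M x) : 𝓕.raisePhi x v = 𝓕.raise x (𝓕.Phi x v) := rfl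

theorem form_raisePhi (x : M) (v w : Tan E M x) :
    (𝓕.form x (𝓕.raisePhi x v) w : ℝ) = 𝓕.Phi x v w := by
  rw [raisePhi_apply, 𝓕.form_raise]

/-- Contraction of two copies of Φ with the skew J^{ab}. This is the quadratic term that appears
beside ∇_aS_b - ∇_bS_a. -/
theorem Phi_raisePhi_skew (x : M) (u v : Tan E M x) :
    (𝓕.Phi x u (𝓕.raisePhi x v) : ℝ) = -(𝓕.Phi x v (𝓕.raisePhi x u) : ℝ) :=
  𝓕.apply_raise_comm x _ _

theorem contract_VPhi (x : M) (u v : Tan E M x) : 𝓕.contract x (𝓕.VPhi x u v) =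
    LinearMap.trace ℝ (Tan E M x) (𝓕.raisePhi x ∘ₗ (𝓕.V x u v).toLinear) := by
  rw [contract]
  congr 1
  ext p
  refine 𝓕.raise_eq fun w ↦ ?_
  exact (𝓕.Phi_symm x w _).trans (𝓕.form_raisePhi x _ w).symm

theorem contract_PhiPhi (x : M) : 𝓕.contract x (𝓕.PhiPhi x) =
    -LinearMap.trace ℝ (Tan E M x) (𝓕.raisePhi x ∘ₗ 𝓕.raisePhi x) := by
  rw [contract, ← map_neg]
  congr 1
  ext p
  refine 𝓕.raise_eq fun w ↦ ?_
  change (𝓕.Phi x p (𝓕.raisePhi x w) : ℝ) = 𝓕.form x (-𝓕.raisePhi x (𝓕.raisePhi x p)) w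
  rw [map_neg, HomBundle.neg_apply]
  refine (𝓕.Phi_raisePhi_skew x p w).trans (congrArg (fun t : ℝ ↦ -t) ?_)
  exact (𝓕.Phi_symm x w _).trans (𝓕.form_raisePhi x _ w).symm

/-- Insert the decomposition of R. Each of its four rank-one terms contributes -Φ(u, raise Φ(v)),
hence the coefficient 4, and the remaining term gives the trace of the square of `raisePhi`. -/
theorem trace_raisePhi_R (x : M) (u v : Tan E M x) :
    LinearMap.trace ℝ (Tan E M x) (𝓕.raisePhi x ∘ₗ (𝓕.R x u v).toLinear) =
      𝓕.contract x (𝓕.VPhi x u v) - 4 * (𝓕.Phi x u (𝓕.raisePhi x v) : ℝ) -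
        2 * (𝓕.form x u v : ℝ) * 𝓕.contract x (𝓕.PhiPhi x) := by
  let Φ (v : Tan E M x) : Tan E M x →ₗ[ℝ] ℝ := (𝓕.Phi x v).toLinear
  let J (v : Tan E M x) : Tan E M x →ₗ[ℝ] ℝ := (𝓕.form x v).toLinear
  have h : 𝓕.raisePhi x ∘ₗ (𝓕.R x u v).toLinear = 𝓕.raisePhi x ∘ₗ (𝓕.V x u v).toLinear +
      ((Φ v).smulRight (𝓕.raisePhi x u) - (Φ u).smulRight (𝓕.raisePhi x v) +
        (J u).smulRight (𝓕.raisePhi x (𝓕.raisePhi x v)) -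
        (J v).smulRight (𝓕.raisePhi x (𝓕.raisePhi x u)) +
        (2 * (𝓕.form x u v : ℝ)) • (𝓕.raisePhi x ∘ₗ 𝓕.raisePhi x)) := by
    ext p
    change 𝓕.raisePhi x (𝓕.R x u v p) = _
    rw [𝓕.R_eq]
    simp only [map_add, map_sub, map_smul]
    rfl
  have hJ (a b : Tan E M x) : J a (𝓕.raisePhi x (𝓕.raisePhi x b)) =
      -(𝓕.Phi x a (𝓕.raisePhi x b) : ℝ) := by
    refine (𝓕.form_apply_raise x a _).trans (congrArg (fun t : ℝ ↦ -t) ?_)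
    exact 𝓕.Phi_symm x _ a
  have hΦ (a b : Tan E M x) : Φ a (𝓕.raisePhi x b) = (𝓕.Phi x a (𝓕.raisePhi x b) : ℝ) := rfl
  have hs := 𝓕.Phi_raisePhi_skew x v u
  rw [h, contract_VPhi, contract_PhiPhi]
  simp only [map_add, map_sub, map_smul, LinearMap.trace_smulRight, smul_eq_mul, hJ, hΦ]
  rw [hs]
  ring

/-- The trace of the second covariant derivative of `Φ`, computed with the Ricci identity. -/
theorem trace_hessPhi_swap (x : M) (u v : Tan E M x) {L A : Tan E M x →ₗ[ℝ] Tan E M x}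
    (hL : ∀ p, L p = 𝓕.raise x (𝓕.hessPhi x p u v)) (hA : ∀ p, A p = 𝓕.raisePhi x (𝓕.R x p u v)) :
    LinearMap.trace ℝ (Tan E M x) L = -((2 * (n : ℝ) + 1) * (𝓕.gradS x u v : ℝ)) -
      LinearMap.trace ℝ (Tan E M x) A + 2 * ((n : ℝ) + 1) * (𝓕.Phi x u (𝓕.raisePhi x v) : ℝ) := by
  let B : Tan E M x →ₗ[ℝ] Tan E M x := firstSlot (𝓕.R x) u (𝓕.raisePhi x v)
  -- By the Ricci identity L + A - B is p ↦ raise(∇_u∇_pΦ(v,·)), whose trace is known. The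
  -- J-skewness of R moves R off the second slot of Φ, so the trace of B is again a value of Φ.
  have h := 𝓕.trace_hessPhi x u v (L := L + A - B) fun p ↦ by
    refine Eq.symm (𝓕.raise_eq fun w ↦ ?_)
    have e1 : (𝓕.form x (L p) w : ℝ) = 𝓕.hessPhi x p u v w := by rw [hL, 𝓕.form_raise]
    have e2 : (𝓕.form x (A p) w : ℝ) = 𝓕.Phi x (𝓕.R x p u v) w := by rw [hA, 𝓕.form_raisePhi]
    have e3 : (𝓕.form x (B p) w : ℝ) = -(𝓕.Phi x v (𝓕.R x p u w) : ℝ) := by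
      rw [← 𝓕.form_raisePhi]
      exact 𝓕.form_R x p u _ w
    have e4 : (𝓕.form x ((L + A - B) p) w : ℝ) =
        (𝓕.form x (L p) w : ℝ) + (𝓕.form x (A p) w : ℝ) - (𝓕.form x (B p) w : ℝ) := by
      rw [LinearMap.sub_apply, LinearMap.add_apply, map_sub, map_add]
      rfl
    have e5 := 𝓕.hessPhi_sub x p u v w
    rw [e4, e1, e2, e3]
    linear_combination -e5
  have hB : (𝓕.Phi x u (𝓕.raisePhi x v) : ℝ) = (1 / (2 * ((n : ℝ) + 1))) *
    LinearMap.trace ℝ (Tan E M x) B := 𝓕.Phi_apply x u _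
  rw [map_sub, map_add] at h
  have hn : ((n : ℝ) + 1) ≠ 0 := by positivity
  have hB' : LinearMap.trace ℝ (Tan E M x) B =
      2 * ((n : ℝ) + 1) * (𝓕.Phi x u (𝓕.raisePhi x v) : ℝ) := by
    rw [hB]
    field_simp
  rw [← hB']
  linear_combination h

/-- The contraction `J^{cd} ∇_c Y_{abd}`. -/
theorem contract_gradYAux (x : M) (u v : Tan E M x) :
    𝓕.contract x (𝓕.gradYAux x u v) = 𝓕.contract x (𝓕.VPhi x u v) -
      2 * (n : ℝ) * ((𝓕.gradS x u v : ℝ) - (𝓕.gradS x v u : ℝ) -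
        2 * (𝓕.Phi x u (𝓕.raisePhi x v) : ℝ)) +
      2 * (𝓕.form x u v : ℝ) * 𝓕.contract x (𝓕.gradS x - 𝓕.PhiPhi x) := by
  let L (u v : Tan E M x) : Tan E M x →ₗ[ℝ] Tan E M x := 𝓕.raise x ∘ₗ
    { toFun p := 𝓕.hessPhi x p u v
      map_add' p p' := by simp
      map_smul' c p := by simp }
  let A (u v : Tan E M x) : Tan E M x →ₗ[ℝ] Tan E M x := 𝓕.raisePhi x ∘ₗ firstSlot (𝓕.R x) u v
  let s (v : Tan E M x) : Tan E M x →ₗ[ℝ] ℝ :=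
    { toFun p := 𝓕.gradS x p v
      map_add' p p' := by
        rw [map_add]
        rfl
      map_smul' c p := by
        rw [map_smul]
        rfl }
  have hL (u v) := 𝓕.trace_hessPhi_swap x u v (L := L u v) (A := A u v) (fun _ ↦ rfl) fun _ ↦ rfl
  -- The first Bianchi identity reduces the alternation of A to R(u,v), so that `trace_raisePhi_R`
  -- applies.
  have hA : A u v - A v u = -(𝓕.raisePhi x ∘ₗ (𝓕.R x u v).toLinear) := by
    ext p
    change 𝓕.raisePhi x (𝓕.R x p u v) - 𝓕.raisePhi x (𝓕.R x p v u) = -𝓕.raisePhi x (𝓕.R x u v p)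
    rw [← map_sub, ← map_neg, 𝓕.R_skew x p v u]
    congr 1
    rw [eq_neg_iff_add_eq_zero, ← 𝓕.bianchi_first x p u v]
    abel
  have hY : 𝓕.raise x ∘ₗ (𝓕.gradYAux x u v).toLinear = L u v - L v u +
      ((s v).smulRight u - (s u).smulRight v) +
      (2 * (𝓕.form x u v : ℝ)) • (𝓕.raise x ∘ₗ (𝓕.gradS x).toLinear) := by
    ext p
    refine 𝓕.raise_eq fun w ↦ ?_
    have e : (𝓕.form x ((L u v - L v u + ((s v).smulRight u - (s u).smulRight v) +
        (2 * (𝓕.form x u v : ℝ)) • (𝓕.raise x ∘ₗ (𝓕.gradS x).toLinear)) p) w : ℝ) =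
        𝓕.form x (𝓕.raise x (𝓕.hessPhi x p u v) - 𝓕.raise x (𝓕.hessPhi x p v u) +
          ((𝓕.gradS x p v : ℝ) • u - (𝓕.gradS x p u : ℝ) • v) +
          (2 * (𝓕.form x u v : ℝ)) • 𝓕.raise x (𝓕.gradS x p)) w := rfl
    rw [e]
    simp only [map_add, map_sub, map_smul, 𝓕.form_raise]
    refine (𝓕.gradY_eq x p u v w).trans ?_
    change _ = (((𝓕.hessPhi x p u v w : ℝ) - (𝓕.hessPhi x p v u w : ℝ)) +
      ((𝓕.gradS x p v : ℝ) * (𝓕.form x u w : ℝ) - (𝓕.gradS x p u : ℝ) * (𝓕.form x v w : ℝ)) +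
      (2 * (𝓕.form x u v : ℝ)) * (𝓕.gradS x p w : ℝ) : ℝ)
    ring
  have hA' := congr(LinearMap.trace ℝ (Tan E M x) $hA)
  rw [map_sub, map_neg, trace_raisePhi_R] at hA'
  have hs (v u) : s v u = (𝓕.gradS x u v : ℝ) := rfl
  have hskew := 𝓕.Phi_raisePhi_skew x v u
  have hc : 𝓕.contract x (𝓕.gradS x) =
    LinearMap.trace ℝ (Tan E M x) (𝓕.raise x ∘ₗ (𝓕.gradS x).toLinear) := rfl
  rw [contract, hY]
  simp only [map_add, map_sub, map_smul, LinearMap.trace_smulRight, smul_eq_mul, hs, hL,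
    contract_sub, hskew, ← hc]
  -- The derivatives of S enter with coefficient -(2n+1) from the second derivatives of Φ and +1
  -- from the rank-one terms, giving -2n. The terms quadratic in Φ that lack a factor J(u,v) enter
  -- with 4(n+1) - 4 = 4n.
  linear_combination -hA'

end Ricci

end FedosovStructure

/-! ### Smooth sections of a direct sum -/

section ProductSections

variable {E : Type*} [NormedAddCommGroup E] [NormedSpace ℝ E]
  {M : Type*} [TopologicalSpace M] [ChartedSpace E M]
  {F : Type*} [NormedAddCommGroup F] [NormedSpace ℝ F]
  {V : M → Type*} [TopologicalSpace (TotalSpace F V)]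
  [∀ x, AddCommGroup (V x)] [∀ x, Module ℝ (V x)] [∀ x, TopologicalSpace (V x)]
  [FiberBundle F V] [VectorBundle ℝ F V]
  {F' : Type*} [NormedAddCommGroup F'] [NormedSpace ℝ F']
  {V' : M → Type*} [TopologicalSpace (TotalSpace F' V')]
  [∀ x, AddCommGroup (V' x)] [∀ x, Module ℝ (V' x)] [∀ x, TopologicalSpace (V' x)]
  [FiberBundle F' V'] [VectorBundle ℝ F' V']

theorem smoothSection_prod_iff (s : Π x, (V ×ᵇ V') x) :
    SmoothSection 𝓘(ℝ, E) (F × F') s ↔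
      SmoothSection 𝓘(ℝ, E) F (fun y ↦ (s y).1) ∧ SmoothSection 𝓘(ℝ, E) F' (fun y ↦ (s y).2) := by
  refine Iff.trans (forall_congr' fun x ↦ ?_) forall_and
  rw [contMDiffAt_section, contMDiffAt_section, contMDiffAt_section]
  exact contMDiffAt_prod_module_iff _

end ProductSections

namespace FedosovStructure

/-! ### The tractor pairing and the tractor curvature -/

section TractorCurvature

variable {E : Type*} [NormedAddCommGroup E] [NormedSpace ℝ E] [FiniteDimensional ℝ E]
  {M : Type*} [TopologicalSpace M] [T2Space M] [ChartedSpace E M] [IsManifold 𝓘(ℝ, E) ∞ M] {n : ℕ}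
  (𝓕 : FedosovStructure E M n)

open CovariantDerivative

theorem smoothSection_tractor_iff (s : Π x, Tractor E M x) :
    SmoothSection 𝓘(ℝ, E) (TractorFiber E) s ↔
      SmoothSection 𝓘(ℝ, E) ℝ (V := Line M) (fun y ↦ (s y).1) ∧
      SmoothSection 𝓘(ℝ, E) (HomFiber E ℝ) (V := Cotan E M) (fun y ↦ (s y).2.1) ∧
      SmoothSection 𝓘(ℝ, E) ℝ (V := Line M) (fun y ↦ (s y).2.2) := by
  rw [smoothSection_prod_iff, smoothSection_prod_iff]

theorem pairing_skew (x : M) (s t : Tractor E M x) : 𝓕.pairing x s t = -𝓕.pairing x t s := by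
  have h := 𝓕.apply_raise_comm x s.2.1 t.2.1
  rw [pairing, pairing, h]
  ring

theorem pairing_nondegenerate (x : M) (s : Tractor E M x) (h : ∀ t, 𝓕.pairing x s t = 0) :
    s = 0 := by
  have h1 : (s.1 : ℝ) = 0 := by
    have := h (0, 0, (1 : ℝ))
    change (s.1 * (1 : ℝ) + (s.2.1 (𝓕.raise x 0) : ℝ) - s.2.2 * (0 : ℝ) : ℝ) = 0 at this
    rw [map_zero, map_zero] at this
    change (s.1 * (1 : ℝ) + 0 - s.2.2 * (0 : ℝ) : ℝ) = 0 at this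
    linarith
  have h2 : (s.2.2 : ℝ) = 0 := by
    have := h ((1 : ℝ), 0, 0)
    change (s.1 * (0 : ℝ) + (s.2.1 (𝓕.raise x 0) : ℝ) - s.2.2 * (1 : ℝ) : ℝ) = 0 at this
    rw [map_zero, map_zero] at this
    change (s.1 * (0 : ℝ) + 0 - s.2.2 * (1 : ℝ) : ℝ) = 0 at this
    linarith
  have h3 : s.2.1 = 0 := by
    ext w
    -- Lowering `w` undoes the raising in the pairing, so this tractor tests the value of the
    -- covector on `w`.
    have := h (0, 𝓕.form x w, 0)
    change (s.1 * (0 : ℝ) + (s.2.1 (𝓕.raise x (𝓕.form x w)) : ℝ) - s.2.2 * (0 : ℝ) : ℝ) = 0 at this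
    rw [𝓕.raise_form] at this
    change (s.2.1 w : ℝ) = 0
    linarith
  exact Prod.ext h1 (Prod.ext h3 h2)

/-- The product rule holds for the direct sum connection because raising commutes with ∇. The
contributions of the algebraic one-form cancel by the skewness of J^{bc}. -/
theorem mvfderiv_pairing {s t : Π x, Tractor E M x}
    (hs : SmoothSection 𝓘(ℝ, E) (TractorFiber E) s)
    (ht : SmoothSection 𝓘(ℝ, E) (TractorFiber E) t) (x : M) (u : Tan E M x) :
    mvfderiv 𝓘(ℝ, E) (fun y ↦ 𝓕.pairing y (s y) (t y)) x u =
      𝓕.pairing x (𝓕.tractorConnection s x u) (t x) +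
        𝓕.pairing x (s x) (𝓕.tractorConnection t x u) := by
  obtain ⟨hσ, hμ, hρ⟩ := (smoothSection_tractor_iff s).1 hs
  obtain ⟨hσ', hμ', hρ'⟩ := (smoothSection_tractor_iff t).1 ht
  let d := trivialLine 𝓘(ℝ, E) M
  have fσ := smoothSection_line_iff.1 hσ
  have fρ := smoothSection_line_iff.1 hρ
  have e1 := SmoothSection.smul fσ hρ'
  have e2 := hμ.hom_apply (𝓕.smooth_raise hμ')
  have e3 := SmoothSection.smul fρ hσ'
  have h : mvfderiv 𝓘(ℝ, E) (fun y ↦ 𝓕.pairing y (s y) (t y)) x u =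
      ((s x).1 * mvfderiv 𝓘(ℝ, E) (fun y ↦ (t y).2.2 : M → ℝ) x u +
        mvfderiv 𝓘(ℝ, E) (fun y ↦ (s y).1 : M → ℝ) x u * (t x).2.2) +
      (((𝓕.cotanConn (fun y ↦ (s y).2.1) x u : Cotan E M x) (𝓕.raise x (t x).2.1) : ℝ) +
        ((s x).2.1 (𝓕.raise x (𝓕.cotanConn (fun y ↦ (t y).2.1) x u)) : ℝ)) -
      ((s x).2.2 * mvfderiv 𝓘(ℝ, E) (fun y ↦ (t y).1 : M → ℝ) x u +
        mvfderiv 𝓘(ℝ, E) (fun y ↦ (s y).2.2 : M → ℝ) x u * (t x).1) := by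
    refine (d.sub_apply ((e1.add e2).diffSectionAt x) (e3.diffSectionAt x) u).trans ?_
    rw [d.add_apply (e1.diffSectionAt x) (e2.diffSectionAt x),
      d.smul_apply (fσ.mdiffAt x) (hρ'.diffSectionAt x),
      d.smul_apply (fρ.mdiffAt x) (hσ'.diffSectionAt x),
      apply_hom_apply 𝓕.conn d hμ (𝓕.smooth_raise hμ'), 𝓕.conn_raise hμ']
    rfl
  rw [h, tractorConnection_apply, tractorConnection_apply, pairing, pairing]
  have a1 : ((𝓕.cotanConn (fun y ↦ (s y).2.1) x u +
      ((s x).2.2 • 𝓕.form x u + (s x).1 • 𝓕.Phi x u) : Cotan E M x) (𝓕.raise x (t x).2.1) : ℝ) =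
      ((𝓕.cotanConn (fun y ↦ (s y).2.1) x u : Cotan E M x) (𝓕.raise x (t x).2.1) : ℝ) +
      ((s x).2.2 * (𝓕.form x u (𝓕.raise x (t x).2.1) : ℝ) +
        (s x).1 * (𝓕.Phi x u (𝓕.raise x (t x).2.1) : ℝ)) := rfl
  have a2 : ((s x).2.1 (𝓕.raise x (𝓕.cotanConn (fun y ↦ (t y).2.1) x u +
      ((t x).2.2 • 𝓕.form x u + (t x).1 • 𝓕.Phi x u) : Cotan E M x)) : ℝ) =
      ((s x).2.1 (𝓕.raise x (𝓕.cotanConn (fun y ↦ (t y).2.1) x u)) : ℝ) +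
      ((t x).2.2 * ((s x).2.1 u : ℝ) + (t x).1 * ((s x).2.1 (𝓕.raise x (𝓕.Phi x u)) : ℝ)) := by
    simp only [map_add, map_smul, 𝓕.raise_form]
    rfl
  rw [𝓕.form_apply_raise] at a1
  rw [𝓕.apply_raise_comm x (s x).2.1 (𝓕.Phi x u)] at a2
  dsimp only
  rw [a1, a2]
  ring

theorem tractorConnection_isSmooth : 𝓕.tractorConnection.IsSmooth := by
  refine isSmooth_of_apply fun s hs U hU ↦ ?_
  obtain ⟨hσ, hμ, hρ⟩ := (smoothSection_tractor_iff s).1 hs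
  have fσ := smoothSection_line_iff.1 hσ
  have fρ := smoothSection_line_iff.1 hρ
  have hd := isSmooth_trivialLine (E := E) (M := M)
  refine (smoothSection_tractor_iff _).2 ⟨?_, ?_, ?_⟩
  · simp only [tractorConnection_apply]
    exact (hd.apply hσ hU).sub (hμ.hom_apply hU)
  · simp only [tractorConnection_apply]
    exact (𝓕.cotanConn_isSmooth.apply hμ hU).add
      ((SmoothSection.smul fρ (𝓕.smooth.hom_apply hU)).add (.smul fσ (𝓕.smooth_Phi.hom_apply hU)))
  · simp only [tractorConnection_apply]
    have e1 := SmoothSection.const_smul (-1)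
      ((𝓕.smooth_Phi.hom_apply hU).hom_apply (𝓕.smooth_raise hμ))
    have e2 := SmoothSection.smul (smoothSection_line_iff.1 (𝓕.smooth_S.hom_apply hU)) hσ
    refine Eq.mp (congrArg (SmoothSection 𝓘(ℝ, E) ℝ (V := Line M)) (funext fun y ↦ ?_))
      ((hd.apply hρ hU).add (e1.add e2))
    have h (a b c : ℝ) : a + (-1 * b + c) = a + (-b + c) := by ring
    exact h _ _ _

/-- The antisymmetric part of `u^a v^b ∇_a ∇_b` in the last slot of the tractor curvature. -/
theorem gradS_sub (x : M) (u v : Tan E M x) :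
    (𝓕.gradS x u v : ℝ) - (𝓕.gradS x v u : ℝ) - 2 * (𝓕.Phi x u (𝓕.raisePhi x v) : ℝ) =
      (1 / (2 * (n : ℝ))) * (𝓕.contract x (𝓕.VPhi x u v) - 𝓕.contract x (𝓕.gradYAux x u v)) +
      2 * (𝓕.form x u v : ℝ) *
        ((1 / (2 * (n : ℝ))) * 𝓕.contract x (𝓕.gradS x - 𝓕.PhiPhi x)) := by
  rcases Nat.eq_zero_or_pos n with rfl | hn
  -- Division by zero makes the right side zero. The left side vanishes too, since u = v and a skew
  -- expression is zero on the diagonal.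
  · have hE : Subsingleton E := Module.finrank_zero_iff.1 (𝓕.finrank_eq.trans (by simp))
    have : Subsingleton (Tan E M x) := hE
    have h := 𝓕.Phi_raisePhi_skew x u v
    rw [Subsingleton.elim v u] at h ⊢
    simp only [Nat.cast_zero, mul_zero, div_zero, zero_mul, add_zero]
    linear_combination -h
  · have hn' : (n : ℝ) ≠ 0 := by positivity
    rw [𝓕.contract_gradYAux]
    field_simp
    ring

/-- As V is parallel at x, the iterated derivative is the second covariant derivative in the
directions u and V(x). This and the next two results list its slots, so that the curvature is their
alternation. -/
theorem tractor_secondDeriv_fst {s : Π x, Tractor E M x}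
    (hs : SmoothSection 𝓘(ℝ, E) (TractorFiber E) s) {V : Π x, Tan E M x}
    (hV : SmoothSection 𝓘(ℝ, E) E V) {x : M} (hVx : 𝓕.conn V x = 0) (u : Tan E M x) :
    ((𝓕.tractorConnection (fun y ↦ 𝓕.tractorConnection s y (V y)) x u).1 : ℝ) =
      mvfderiv 𝓘(ℝ, E) (fun y ↦ mvfderiv 𝓘(ℝ, E) (fun y ↦ (s y).1 : M → ℝ) y (V y)) x u
      - ((𝓕.cotanConn (fun y ↦ (s y).2.1) x u : Cotan E M x) (V x) : ℝ)
      - (((𝓕.cotanConn (fun y ↦ (s y).2.1) x (V x) : Cotan E M x) u : ℝ)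
        + ((s x).2.2 * (𝓕.form x (V x) u : ℝ) + (s x).1 * (𝓕.Phi x (V x) u : ℝ))) := by
  obtain ⟨hσ, hμ, hρ⟩ := (smoothSection_tractor_iff s).1 hs
  let d := trivialLine 𝓘(ℝ, E) M
  have hd := isSmooth_trivialLine (E := E) (M := M)
  rw [tractorConnection_apply]
  simp only [tractorConnection_apply]
  have h := d.sub_apply ((hd.apply hσ hV).diffSectionAt x) ((hμ.hom_apply hV).diffSectionAt x) u
  have h2 : d (fun y ↦ (s y).2.1 (V y)) x u =
    (𝓕.cotanConn (fun y ↦ (s y).2.1) x u : Cotan E M x) (V x) :=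
      (𝓕.hom_apply_parallel d hμ hV hVx u).symm
  rw [h2] at h
  exact congrArg (fun t : ℝ ↦ t - _) h

theorem tractor_secondDeriv_snd {s : Π x, Tractor E M x}
    (hs : SmoothSection 𝓘(ℝ, E) (TractorFiber E) s) {V : Π x, Tan E M x}
    (hV : SmoothSection 𝓘(ℝ, E) E V) {x : M} (hVx : 𝓕.conn V x = 0) (u w : Tan E M x) :
    ((𝓕.tractorConnection (fun y ↦ 𝓕.tractorConnection s y (V y)) x u).2.1 w : ℝ) =
      ((𝓕.cotanConn (fun y ↦ 𝓕.cotanConn (fun y ↦ (s y).2.1) y (V y)) x u : Cotan E M x) w : ℝ)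
      + (mvfderiv 𝓘(ℝ, E) (fun y ↦ (s y).2.2 : M → ℝ) x u * (𝓕.form x (V x) w : ℝ)
        + ((s x).1 * (𝓕.gradPhi x u (V x) w : ℝ) +
          mvfderiv 𝓘(ℝ, E) (fun y ↦ (s y).1 : M → ℝ) x u * (𝓕.Phi x (V x) w : ℝ)))
      + ((mvfderiv 𝓘(ℝ, E) (fun y ↦ (s y).2.2 : M → ℝ) x (V x)
          + (-(𝓕.Phi x (V x) (𝓕.raise x (s x).2.1) : ℝ) + (𝓕.S x (V x) : ℝ) * (s x).1))
          * (𝓕.form x u w : ℝ)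
        + (mvfderiv 𝓘(ℝ, E) (fun y ↦ (s y).1 : M → ℝ) x (V x) - ((s x).2.1 (V x) : ℝ))
          * (𝓕.Phi x u w : ℝ)) := by
  obtain ⟨hσ, hμ, hρ⟩ := (smoothSection_tractor_iff s).1 hs
  have fσ := smoothSection_line_iff.1 hσ
  have fρ := smoothSection_line_iff.1 hρ
  rw [tractorConnection_apply]
  simp only [tractorConnection_apply]
  have e0 := 𝓕.cotanConn_isSmooth.apply hμ hV
  have e1 := SmoothSection.smul fρ (𝓕.smooth.hom_apply hV)
  have e2 := SmoothSection.smul fσ (𝓕.smooth_Phi.hom_apply hV)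
  have hJ : 𝓕.cotanConn (fun y ↦ 𝓕.form y (V y)) x u = 0 := by
    rw [𝓕.cotanConn_form hV, hVx]
    exact map_zero (𝓕.form x)
  have hΦ : 𝓕.cotanConn (fun y ↦ 𝓕.Phi y (V y)) x u = 𝓕.gradPhi x u (V x) :=
    (𝓕.derivSection_apply_parallel _ 𝓕.smooth_Phi hV hVx u).symm
  rw [𝓕.cotanConn.add_apply (e0.diffSectionAt x) ((e1.add e2).diffSectionAt x),
    𝓕.cotanConn.add_apply (e1.diffSectionAt x) (e2.diffSectionAt x),
    𝓕.cotanConn.smul_apply (fρ.mdiffAt x) ((𝓕.smooth.hom_apply hV).diffSectionAt x),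
    𝓕.cotanConn.smul_apply (fσ.mdiffAt x) ((𝓕.smooth_Phi.hom_apply hV).diffSectionAt x), hJ, hΦ,
    smul_zero, zero_add]
  rfl

theorem tractor_secondDeriv_trd {s : Π x, Tractor E M x}
    (hs : SmoothSection 𝓘(ℝ, E) (TractorFiber E) s) {V : Π x, Tan E M x}
    (hV : SmoothSection 𝓘(ℝ, E) E V) {x : M} (hVx : 𝓕.conn V x = 0) (u : Tan E M x) :
    ((𝓕.tractorConnection (fun y ↦ 𝓕.tractorConnection s y (V y)) x u).2.2 : ℝ) =
      mvfderiv 𝓘(ℝ, E) (fun y ↦ mvfderiv 𝓘(ℝ, E) (fun y ↦ (s y).2.2 : M → ℝ) y (V y)) x u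
      + (-((𝓕.gradPhi x u (V x) (𝓕.raise x (s x).2.1) : ℝ) +
          (𝓕.Phi x (V x) (𝓕.raise x (𝓕.cotanConn (fun y ↦ (s y).2.1) x u)) : ℝ))
        + ((𝓕.S x (V x) : ℝ) * mvfderiv 𝓘(ℝ, E) (fun y ↦ (s y).1 : M → ℝ) x u +
          (𝓕.gradS x u (V x) : ℝ) * (s x).1))
      + (-((𝓕.Phi x u (𝓕.raise x (𝓕.cotanConn (fun y ↦ (s y).2.1) x (V x))) : ℝ)
          + ((s x).2.2 * (𝓕.Phi x u (V x) : ℝ)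
            + (s x).1 * (𝓕.Phi x u (𝓕.raisePhi x (V x)) : ℝ)))
        + (𝓕.S x u : ℝ) *
          (mvfderiv 𝓘(ℝ, E) (fun y ↦ (s y).1 : M → ℝ) x (V x) - ((s x).2.1 (V x) : ℝ))) := by
  obtain ⟨hσ, hμ, hρ⟩ := (smoothSection_tractor_iff s).1 hs
  let d := trivialLine 𝓘(ℝ, E) M
  have hd := isSmooth_trivialLine (E := E) (M := M)
  have hS := 𝓕.smooth_S.hom_apply hV
  have fS := smoothSection_line_iff.1 hS
  have e0 := hd.apply hρ hV
  have hΦμ := (𝓕.smooth_Phi.hom_apply hV).hom_apply (𝓕.smooth_raise hμ)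
  have e1 := SmoothSection.const_smul (-1) hΦμ
  have e2 := SmoothSection.smul fS hσ
  have hΦ : 𝓕.cotanConn (fun y ↦ 𝓕.Phi y (V y)) x u = 𝓕.gradPhi x u (V x) :=
    (𝓕.derivSection_apply_parallel _ 𝓕.smooth_Phi hV hVx u).symm
  have h0 : mvfderiv 𝓘(ℝ, E) (fun y ↦ ((𝓕.tractorConnection s y (V y)).2.2 : ℝ)) x u =
      mvfderiv 𝓘(ℝ, E) (fun y ↦ mvfderiv 𝓘(ℝ, E) (fun y ↦ (s y).2.2 : M → ℝ) y (V y)) x u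
      + (-((𝓕.gradPhi x u (V x) (𝓕.raise x (s x).2.1) : ℝ) +
          (𝓕.Phi x (V x) (𝓕.raise x (𝓕.cotanConn (fun y ↦ (s y).2.1) x u)) : ℝ))
        + ((𝓕.S x (V x) : ℝ) * mvfderiv 𝓘(ℝ, E) (fun y ↦ (s y).1 : M → ℝ) x u +
          (𝓕.gradS x u (V x) : ℝ) * (s x).1)) := by
    have h : (fun y ↦ ((𝓕.tractorConnection s y (V y)).2.2 : ℝ)) = fun y ↦
        d (fun y ↦ (s y).2.2) y (V y) + ((-1 : ℝ) • 𝓕.Phi y (V y) (𝓕.raise y (s y).2.1) +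
          (𝓕.S y (V y) : ℝ) • (s y).1) := by
      funext y
      rw [tractorConnection_apply]
      have h (a b c : ℝ) : a + (-b + c) = a + (-1 * b + c) := by ring
      exact h _ _ _
    rw [h]
    change d _ x u = _
    rw [d.add_apply (e0.diffSectionAt x) ((e1.add e2).diffSectionAt x),
      d.add_apply (e1.diffSectionAt x) (e2.diffSectionAt x),
      d.const_smul_apply _ (hΦμ.diffSectionAt x),
      d.smul_apply (fS.mdiffAt x) (hσ.diffSectionAt x), 𝓕.mvfderiv_S_parallel hV hVx,
      apply_hom_apply 𝓕.conn d (𝓕.smooth_Phi.hom_apply hV) (𝓕.smooth_raise hμ), hΦ,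
      𝓕.conn_raise hμ, neg_one_smul]
    rfl
  have h1 : (𝓕.Phi x u (𝓕.raise x (𝓕.tractorConnection s x (V x)).2.1) : ℝ) =
      (𝓕.Phi x u (𝓕.raise x (𝓕.cotanConn (fun y ↦ (s y).2.1) x (V x))) : ℝ)
          + ((s x).2.2 * (𝓕.Phi x u (V x) : ℝ)
            + (s x).1 * (𝓕.Phi x u (𝓕.raisePhi x (V x)) : ℝ)) := by
    rw [tractorConnection_apply]
    simp only [map_add, map_smul, 𝓕.raise_form]
    rfl
  rw [tractorConnection_apply]
  dsimp only
  rw [h0, h1]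
  congr 2

/-- The curvature of the tractor connection. -/
theorem curv_tractorConnection {s : Π x, Tractor E M x}
    (hs : SmoothSection 𝓘(ℝ, E) (TractorFiber E) s) (x : M) (u v : Tan E M x) :
    𝓕.curv 𝓕.tractorConnection s x u v =
      𝓕.curvatureVY x u v (s x) + (2 * (𝓕.form x u v : ℝ)) • 𝓕.Theta x (s x) := by
  obtain ⟨hσ, hμ, hρ⟩ := (smoothSection_tractor_iff s).1 hs
  have hR := 𝓕.curv_cotanConn hμ x u v
  have hD := 𝓕.gradS_sub x u v
  have hΦ := 𝓕.Phi_symm x u v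
  have hQ := 𝓕.Phi_raisePhi_skew x u v
  obtain ⟨U, hU, rfl, hUx⟩ := exists_parallel 𝓕.conn x u
  obtain ⟨V, hV, rfl, hVx⟩ := exists_parallel 𝓕.conn x v
  rw [𝓕.curv_parallel 𝓕.tractorConnection_isSmooth hs hU hV hUx hVx]
  rw [𝓕.curv_parallel 𝓕.cotanConn_isSmooth hμ hU hV hUx hVx] at hR
  have hσ2 := 𝓕.mvfderiv_comm (smoothSection_line_iff.1 hσ) hU hV hUx hVx
  have hρ2 := 𝓕.mvfderiv_comm (smoothSection_line_iff.1 hρ) hU hV hUx hVx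
  refine Prod.ext ?_ (Prod.ext ?_ ?_)
  · have hu := 𝓕.tractor_secondDeriv_fst hs hV hVx (U x)
    have hv := 𝓕.tractor_secondDeriv_fst hs hU hUx (V x)
    change (_ - _ : ℝ) = 0 + (2 * (𝓕.form x (U x) (V x) : ℝ)) * (s x).2.2
    refine (congrArg₂ (fun a b : ℝ ↦ a - b) hu hv).trans ?_
    -- The Hessian of σ, the derivatives of μ and the Φσ terms are symmetric and cancel; the skew J
    -- doubles, leaving 2J(u,v)ρ.
    rw [hσ2, hΦ, 𝓕.skew x (V x) (U x)]
    ring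
  · ext w
    have hu := 𝓕.tractor_secondDeriv_snd hs hV hVx (U x) w
    have hv := 𝓕.tractor_secondDeriv_snd hs hU hUx (V x) w
    have hY := 𝓕.Y_eq x (U x) (V x) w
    change (_ - _ : ℝ) = (-((s x).2.1 (𝓕.V x (U x) (V x) w) : ℝ) +
      (s x).1 * (𝓕.Y x (U x) (V x) w : ℝ)) + (2 * (𝓕.form x (U x) (V x) : ℝ)) *
        ((𝓕.Phi x (𝓕.raise x (s x).2.1) w : ℝ) - (s x).1 * (𝓕.S x w : ℝ))
    refine (congrArg₂ (fun a b : ℝ ↦ a - b) hu hv).trans ?_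
    have hR' := hR w
    -- The rank-one terms in the decomposition of R are what the algebraic cross terms of the
    -- connection cancel. Only V and the term with 2J(u,v) survive.
    have hμR : ((s x).2.1 (𝓕.R x (U x) (V x) w) : ℝ) = ((s x).2.1 (𝓕.V x (U x) (V x) w) : ℝ) +
        ((𝓕.Phi x (V x) w : ℝ) * ((s x).2.1 (U x) : ℝ)
          - (𝓕.Phi x (U x) w : ℝ) * ((s x).2.1 (V x) : ℝ)
          + (𝓕.form x (U x) w : ℝ) * ((s x).2.1 (𝓕.raise x (𝓕.Phi x (V x))) : ℝ)
          - (𝓕.form x (V x) w : ℝ) * ((s x).2.1 (𝓕.raise x (𝓕.Phi x (U x))) : ℝ)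
          + (2 * (𝓕.form x (U x) (V x) : ℝ)) *
            ((s x).2.1 (𝓕.raise x (𝓕.Phi x w)) : ℝ)) := by
      rw [𝓕.R_eq]
      simp only [map_add, map_sub, map_smul]
      rfl
    rw [𝓕.apply_raise_comm x (s x).2.1 (𝓕.Phi x (V x)),
      𝓕.apply_raise_comm x (s x).2.1 (𝓕.Phi x (U x)),
      𝓕.apply_raise_comm x (s x).2.1 (𝓕.Phi x w)] at hμR
    have hR2 : ((𝓕.cotanConn (fun y ↦ 𝓕.cotanConn (fun y ↦ (s y).2.1) y (V y)) x (U x) :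
          Cotan E M x) w : ℝ) -
        ((𝓕.cotanConn (fun y ↦ 𝓕.cotanConn (fun y ↦ (s y).2.1) y (U y)) x (V x) :
          Cotan E M x) w : ℝ) = -((s x).2.1 (𝓕.R x (U x) (V x) w) : ℝ) := hR'
    rw [hY, 𝓕.Phi_symm x (𝓕.raise x (s x).2.1) w]
    linear_combination hR2 - hμR
  · have hu := 𝓕.tractor_secondDeriv_trd hs hV hVx (U x)
    have hv := 𝓕.tractor_secondDeriv_trd hs hU hUx (V x)
    -- Taking the raised μ as third argument turns the J terms of `Y_eq` into values of μ, which
    -- match the S ⊗ μ terms of the connection.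
    have hY := 𝓕.Y_eq x (U x) (V x) (𝓕.raise x (s x).2.1)
    rw [𝓕.form_apply_raise, 𝓕.form_apply_raise] at hY
    change (_ - _ : ℝ) = (-(𝓕.Y x (U x) (V x) (𝓕.raise x (s x).2.1) : ℝ) +
      (1 / (2 * (n : ℝ))) * (𝓕.contract x (𝓕.VPhi x (U x) (V x)) -
        𝓕.contract x (𝓕.gradYAux x (U x) (V x))) * (s x).1) +
      (2 * (𝓕.form x (U x) (V x) : ℝ)) * ((𝓕.S x (𝓕.raise x (s x).2.1) : ℝ) +
        (1 / (2 * (n : ℝ))) * 𝓕.contract x (𝓕.gradS x - 𝓕.PhiPhi x) * (s x).1)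
    refine (congrArg₂ (fun a b : ℝ ↦ a - b) hu hv).trans ?_
    rw [hY, hρ2, hΦ]
    -- By skewness the two quadratic Φ terms add to -2Φ(u, raise Φ(v)), so the coefficient of σ is
    -- the expression evaluated in `gradS_sub`.
    linear_combination (s x).1 * hD + (s x).1 * hQ

end TractorCurvature

end FedosovStructure

end

theorem mainTheorem6 {E : Type*} [NormedAddCommGroup E] [NormedSpace ℝ E] [FiniteDimensional ℝ E]
    {M : Type*} [TopologicalSpace M] [T2Space M] [ChartedSpace E M] [IsManifold 𝓘(ℝ, E) ∞ M]
    {n : ℕ} (𝓕 : FedosovStructure E M n) :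
    (∀ (x : M),
      (∀ s t : FedosovStructure.Tractor E M x, 𝓕.pairing x s t = -𝓕.pairing x t s) ∧
      (∀ s : FedosovStructure.Tractor E M x, (∀ t, 𝓕.pairing x s t = 0) → s = 0)) ∧
    (∀ s t : Π x, FedosovStructure.Tractor E M x,
      SmoothSection 𝓘(ℝ, E) (FedosovStructure.TractorFiber E) s →
      SmoothSection 𝓘(ℝ, E) (FedosovStructure.TractorFiber E) t →
      ∀ (x : M) (u : Tan E M x),
        mvfderiv 𝓘(ℝ, E) (fun y ↦ 𝓕.pairing y (s y) (t y)) x u =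
          𝓕.pairing x (𝓕.tractorConnection s x u) (t x) +
            𝓕.pairing x (s x) (𝓕.tractorConnection t x u)) ∧
    (∀ s : Π x, FedosovStructure.Tractor E M x,
      SmoothSection 𝓘(ℝ, E) (FedosovStructure.TractorFiber E) s →
      ∀ (x : M) (u v : Tan E M x),
        𝓕.curv 𝓕.tractorConnection s x u v =
          𝓕.curvatureVY x u v (s x) + (2 * (𝓕.form x u v : ℝ)) • 𝓕.Theta x (s x)) := by
  exact ⟨fun x ↦ ⟨𝓕.pairing_skew x, 𝓕.pairing_nondegenerate x⟩,
    fun _ _ hs ht ↦ 𝓕.mvfderiv_pairing hs ht, fun _ hs ↦ 𝓕.curv_tractorConnection hs⟩
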